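/- Let $(\tilde\Sigma,h_{ab},K_{ab})$ be an initial data set, that is, a smooth 3-manifold $\tilde\Sigma$ with a smooth Riemannian metric $h_{ab}$ and a smooth symmetric tensor field $K_{ab}$ (the extrinsic curvature). Let $\mathcal S\subset\tilde\Sigma$ be a closed (compact, without boundary), connected, smoothly embedded surface with smooth outward unit normal $n^a$, induced metric $q_{ab}$ and Levi-Civita connection $\mathcal D_a$ of $q_{ab}$. Put $\mathcal Z_1=q^{ab}K_{ab}$, $\mathcal Z_2=\mathcal D_an^a=q^{ab}\nabla_an_b$ (with $\nabla$ the Levi-Civita connection of $h_{ab}$; $\mathcal Z_2$ is the mean curvature of $\mathcal S$), $\theta_k=\mathcal Z_1+\mathcal Z_2$ and $\theta_\ell=\mathcal Z_1-\mathcal Z_2$. Assume that $\mathcal S$ is a MOTS, i.e. $\theta_k=0$ on $\mathcal S$. Let the smooth vector field $x^a$ on $\tilde\Sigma$ be a symmetry of the initial data set, i.e. $x^a$ is not identically zero, $\mathcal L_xh_{ab}=0$ and $\mathcal L_xK_{ab}=0$, and write $x^a=\alpha n^a+\tau^a$ along $\mathcal S$, with $\alpha$ a smooth function and $\tau^a$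 a smooth tangent vector field on $\mathcal S$. Then $$\alpha\,\mathcal Z_2+\mathcal D_a\tau^a=0\quad\text{on }\mathcal S,$$ and if $\tau^a$ is divergence-free, $\mathcal D_a\tau^a=0$ on $\mathcal S$, then either $x^a$ is tangent to $\mathcal S$ at every point of $\mathcal S$, or $\mathcal S$ is minimal, i.e. $\theta_k=\theta_\ell=0$ (equivalently $\mathcal Z_2=0$) at every point of $\mathcal S$. -/

import Mathlib

open scoped Manifold ContDiff
open Bundle

noncomputable section

/-! ### Tensor calculus on smooth manifolds, in charts

The coordinate formulas below are evaluated at a point `p` in the preferred chart at `p`. -/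

section Calculus

/-- Fields of bilinear forms, that is, covariant 2-tensor fields, on an `n`-manifold. -/
abbrev Tensor2 (n : ℕ) (M : Type*) [TopologicalSpace M]
    [ChartedSpace (EuclideanSpace ℝ (Fin n)) M] : Type _ :=
  ∀ x : M, TangentSpace (𝓡 n) x →L[ℝ] TangentSpace (𝓡 n) x →L[ℝ] ℝ

/-- Smoothness of a covariant 2-tensor field. -/
def Tensor2.IsSmooth {n : ℕ} {M : Type*} [TopologicalSpace M]
    [ChartedSpace (EuclideanSpace ℝ (Fin n)) M] [IsManifold (𝓡 n) ∞ M] (T : Tensor2 n M) : Prop :=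
  ContMDiff (𝓡 n)
    ((𝓡 n).prod 𝓘(ℝ, EuclideanSpace ℝ (Fin n) →L[ℝ] EuclideanSpace ℝ (Fin n) →L[ℝ] ℝ)) ∞
    (fun x : M ↦ TotalSpace.mk'
      (EuclideanSpace ℝ (Fin n) →L[ℝ] EuclideanSpace ℝ (Fin n) →L[ℝ] ℝ)
      (E := fun x : M ↦ TangentSpace (𝓡 n) x →L[ℝ] TangentSpace (𝓡 n) x →L[ℝ] ℝ) x (T x))

/-- Smoothness of a vector field along a map. -/
def IsSmoothFieldAlong {m n : ℕ} {M : Type*} [TopologicalSpace M]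
    [ChartedSpace (EuclideanSpace ℝ (Fin n)) M] [IsManifold (𝓡 n) ∞ M] {N : Type*}
    [TopologicalSpace N] [ChartedSpace (EuclideanSpace ℝ (Fin m)) N] (f : N → M)
    (Y : ∀ s : N, TangentSpace (𝓡 n) (f s)) : Prop :=
  ContMDiff (𝓡 m) (𝓡 n).tangent ∞ (fun s ↦ (⟨f s, Y s⟩ : TangentBundle (𝓡 n) M))

/-- The pullback `B(A·, A·)` of a bilinear form under a linear map. -/
def pullbackForm {V W : Type*} [AddCommGroup V] [Module ℝ V] [TopologicalSpace V]
    [AddCommGroup W] [Module ℝ W] [TopologicalSpace W]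
    (B : V →L[ℝ] V →L[ℝ] ℝ) (A : W →L[ℝ] V) : W →L[ℝ] W →L[ℝ] ℝ :=
  (ContinuousLinearMap.precomp ℝ A) ∘L B ∘L A

/-- The components, in the preferred chart at `p`, of vectors tangent at `s`: the differential at
`s` of the chart. -/
def coordMap {n : ℕ} {M : Type*} [TopologicalSpace M]
    [ChartedSpace (EuclideanSpace ℝ (Fin n)) M] (p s : M) :
    TangentSpace (𝓡 n) s →L[ℝ] EuclideanSpace ℝ (Fin n) :=
  mvfderiv (𝓡 n) (extChartAt (𝓡 n) p) s

/-- The tangent vector at the point with coordinates `y` that has given components in the preferred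
chart at `p`: the differential at `y` of the inverse of the chart. -/
def coordMapSymm {n : ℕ} {M : Type*} [TopologicalSpace M]
    [ChartedSpace (EuclideanSpace ℝ (Fin n)) M] (p : M) (y : EuclideanSpace ℝ (Fin n)) :
    EuclideanSpace ℝ (Fin n) →L[ℝ] TangentSpace (𝓡 n) ((extChartAt (𝓡 n) p).symm y) :=
  mfderiv (𝓡 n) (𝓡 n) (extChartAt (𝓡 n) p).symm y ∘L
    (NormedSpace.fromTangentSpace y).symm.toContinuousLinearMap

/-- The components of a covariant 2-tensor field in the preferred chart at `p`, as a function of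
the coordinates: the pullback of `T` under the inverse of the chart. -/
def tensorInChart {n : ℕ} {M : Type*} [TopologicalSpace M]
    [ChartedSpace (EuclideanSpace ℝ (Fin n)) M] (T : Tensor2 n M) (p : M)
    (y : EuclideanSpace ℝ (Fin n)) :
    EuclideanSpace ℝ (Fin n) →L[ℝ] EuclideanSpace ℝ (Fin n) →L[ℝ] ℝ :=
  pullbackForm (T ((extChartAt (𝓡 n) p).symm y)) (coordMapSymm p y)

/-- The `i`-th vector of the standard basis. -/
def coordVec {n : ℕ} (i : Fin n) : EuclideanSpace ℝ (Fin n) := EuclideanSpace.single i 1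

/-- The coordinate basis of the tangent space at `p`, for the preferred chart at `p`. -/
def coordFrame {n : ℕ} {M : Type*} [TopologicalSpace M]
    [ChartedSpace (EuclideanSpace ℝ (Fin n)) M] (p : M) (i : Fin n) : TangentSpace (𝓡 n) p :=
  (coordMap p p).inverse (coordVec i)

/-- The Gram matrix `gᵢⱼ = g(eᵢ, eⱼ)`. -/
def gramMatrix {n : ℕ} {V : Type*} (e : Fin n → V) (g : V → V → ℝ) : Matrix (Fin n) (Fin n) ℝ :=
  Matrix.of fun i j ↦ g (e i) (e j)

/-- The trace `gⁱʲ Bᵢⱼ` of a bilinear form `B` with respect to an inner product `g`, computed in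
a basis `e`. -/
def metricTrace {n : ℕ} {V : Type*} (e : Fin n → V) (g B : V → V → ℝ) : ℝ :=
  ∑ i, ∑ j, (gramMatrix e g)⁻¹ i j * B (e i) (e j)

/-- The Christoffel symbols, contracted with two vectors: the vector with components
`Γᵏᵢⱼ uⁱ vʲ`, where `Γᵏᵢⱼ = ½ gᵏˡ (∂ᵢ gⱼₗ + ∂ⱼ gᵢₗ - ∂ₗ gᵢⱼ)`. -/
def christoffel {n : ℕ}
    (g : EuclideanSpace ℝ (Fin n) →
      EuclideanSpace ℝ (Fin n) →L[ℝ] EuclideanSpace ℝ (Fin n) →L[ℝ] ℝ)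
    (y u v : EuclideanSpace ℝ (Fin n)) : EuclideanSpace ℝ (Fin n) :=
  ∑ k, (∑ l, (gramMatrix coordVec fun a b ↦ g y a b)⁻¹ k l *
    ((fderiv ℝ g y u v (coordVec l) + fderiv ℝ g y v u (coordVec l)
      - fderiv ℝ g y (coordVec l) u v) / 2)) • coordVec k

/-- The Levi-Civita covariant derivative `∇ᵥ Y` at `p` of a vector field `Y` along a map
`f : N → M`, for the metric `g` of `M` and `v` tangent to `N` at `p`. In coordinates:
`(∇ᵥ Y)ᵏ = v(Yᵏ) + Γᵏᵢⱼ (df v)ⁱ Yʲ`. For `f = id` it is the Levi-Civita connection of `g`. -/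
def covDerivAlong {m n : ℕ} {M : Type*} [TopologicalSpace M]
    [ChartedSpace (EuclideanSpace ℝ (Fin n)) M] {N : Type*} [TopologicalSpace N]
    [ChartedSpace (EuclideanSpace ℝ (Fin m)) N] (g : Tensor2 n M) (f : N → M)
    (Y : ∀ s : N, TangentSpace (𝓡 n) (f s)) (p : N) (v : TangentSpace (𝓡 m) p) :
    TangentSpace (𝓡 n) (f p) :=
  (coordMap (f p) (f p)).inverse
    (mvfderiv (𝓡 m) (fun s ↦ coordMap (f p) (f s) (Y s)) p v +
      christoffel (tensorInChart g (f p)) (extChartAt (𝓡 n) (f p) (f p))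
        (coordMap (f p) (f p) (mfderiv (𝓡 m) (𝓡 n) f p v)) (coordMap (f p) (f p) (Y p)))

/-- The divergence `Dₐ Yᵃ` of a vector field: the trace of `v ↦ Dᵥ Y`, where `D` is the
Levi-Civita connection of `g`. -/
def divergence {n : ℕ} {M : Type*} [TopologicalSpace M]
    [ChartedSpace (EuclideanSpace ℝ (Fin n)) M] (g : Tensor2 n M)
    (Y : ∀ x : M, TangentSpace (𝓡 n) x) (p : M) : ℝ :=
  ∑ i : Fin n,
    (coordMap p p (covDerivAlong (m := n) g (fun x : M ↦ x) Y p (coordFrame p i))) i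

/-- The Lie derivative of a covariant 2-tensor field along a vector field. In coordinates:
`(𝓛ₓ T)ᵢⱼ = xᵏ ∂ₖ Tᵢⱼ + Tₖⱼ ∂ᵢ xᵏ + Tᵢₖ ∂ⱼ xᵏ`. -/
def lieDeriv {n : ℕ} {M : Type*} [TopologicalSpace M]
    [ChartedSpace (EuclideanSpace ℝ (Fin n)) M] (x : ∀ p : M, TangentSpace (𝓡 n) p)
    (T : Tensor2 n M) (p : M) (u v : TangentSpace (𝓡 n) p) : ℝ :=
  let y : EuclideanSpace ℝ (Fin n) := extChartAt (𝓡 n) p p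
  let T' := tensorInChart T p
  let x' : EuclideanSpace ℝ (Fin n) → EuclideanSpace ℝ (Fin n) :=
    fun z ↦ coordMap p ((extChartAt (𝓡 n) p).symm z) (x ((extChartAt (𝓡 n) p).symm z))
  let u' := coordMap p p u
  let v' := coordMap p p v
  fderiv ℝ T' y (x' y) u' v' + T' y (fderiv ℝ x' y u') v' + T' y u' (fderiv ℝ x' y v')

end Calculus

/-! ### Initial data sets, their symmetries, and marginally outer trapped surfaces -/

/-- An initial data set `(Σ, h, K)`: a Riemannian metric `h` and a symmetric 2-tensor `K`
on a 3-manifold. -/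
structure InitialDataSet (M : Type*) [TopologicalSpace M]
    [ChartedSpace (EuclideanSpace ℝ (Fin 3)) M] [IsManifold (𝓡 3) ∞ M] where
  /-- the Riemannian metric -/
  metric : ContMDiffRiemannianMetric (𝓡 3) ∞ (EuclideanSpace ℝ (Fin 3))
    (fun x : M ↦ TangentSpace (𝓡 3) x)
  /-- the extrinsic curvature -/
  extrinsic : Tensor2 3 M
  extrinsic_symm : ∀ (x : M) (u v : TangentSpace (𝓡 3) x), extrinsic x u v = extrinsic x v u
  extrinsic_smooth : extrinsic.IsSmooth

namespace InitialDataSet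

variable {M : Type*} [TopologicalSpace M] [ChartedSpace (EuclideanSpace ℝ (Fin 3)) M]
  [IsManifold (𝓡 3) ∞ M]

/-- The metric as a 2-tensor field. -/
def h (D : InitialDataSet M) : Tensor2 3 M := D.metric.inner

/-- A symmetry of an initial data set: a non-trivial smooth vector field `x` such that
`𝓛ₓ h = 0` and `𝓛ₓ K = 0`. -/
structure IsSymmetry (D : InitialDataSet M) (x : ∀ p : M, TangentSpace (𝓡 3) p) : Prop where
  smooth : IsSmoothFieldAlong (m := 3) (fun p : M ↦ p) x
  nontrivial : ∃ p, x p ≠ 0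
  lie_metric : ∀ p u v, lieDeriv x D.h p u v = 0
  lie_extrinsic : ∀ p u v, lieDeriv x D.extrinsic p u v = 0

end InitialDataSet

/-- A surface `S` smoothly embedded in an initial data set, with a smooth unit normal field,
declared to point outward. -/
structure EmbeddedSurface {M : Type*} [TopologicalSpace M]
    [ChartedSpace (EuclideanSpace ℝ (Fin 3)) M] [IsManifold (𝓡 3) ∞ M] (D : InitialDataSet M)
    (S : Type*) [TopologicalSpace S] [ChartedSpace (EuclideanSpace ℝ (Fin 2)) S]
    [IsManifold (𝓡 2) ∞ S] where
  /-- the embedding -/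
  emb : S → M
  isSmoothEmbedding : Manifold.IsSmoothEmbedding (𝓡 2) (𝓡 3) ∞ emb
  /-- the outward unit normal -/
  normal : ∀ p : S, TangentSpace (𝓡 3) (emb p)
  normal_smooth : IsSmoothFieldAlong (m := 2) emb normal
  normal_orthogonal : ∀ (p : S) (v : TangentSpace (𝓡 2) p),
    D.h (emb p) (normal p) (mfderiv (𝓡 2) (𝓡 3) emb p v) = 0
  normal_unit : ∀ p : S, D.h (emb p) (normal p) (normal p) = 1

namespace EmbeddedSurface

variable {M : Type*} [TopologicalSpace M] [ChartedSpace (EuclideanSpace ℝ (Fin 3)) M]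
  [IsManifold (𝓡 3) ∞ M] {D : InitialDataSet M}
  {S : Type*} [TopologicalSpace S] [ChartedSpace (EuclideanSpace ℝ (Fin 2)) S]
  [IsManifold (𝓡 2) ∞ S]

/-- The induced metric `q` on `S`. -/
def q (𝒮 : EmbeddedSurface D S) : Tensor2 2 S := fun p ↦
  pullbackForm (D.h (𝒮.emb p)) (mfderiv (𝓡 2) (𝓡 3) 𝒮.emb p)

/-- `𝒵₁ = qᵃᵇ Kₐᵇ`, the trace over `S` of the extrinsic curvature of the slice. -/
def Z₁ (𝒮 : EmbeddedSurface D S) (p : S) : ℝ :=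
  metricTrace (coordFrame p) (fun a b ↦ 𝒮.q p a b) fun a b ↦ D.extrinsic (𝒮.emb p)
    (mfderiv (𝓡 2) (𝓡 3) 𝒮.emb p a) (mfderiv (𝓡 2) (𝓡 3) 𝒮.emb p b)

/-- `𝒵₂ = qᵃᵇ ∇ₐ nᵇ`, the mean curvature of `S`: the divergence along `S` of its outward unit
normal. -/
def Z₂ (𝒮 : EmbeddedSurface D S) (p : S) : ℝ :=
  metricTrace (coordFrame p) (fun a b ↦ 𝒮.q p a b) fun a b ↦ D.h (𝒮.emb p)
    (covDerivAlong (m := 2) D.h 𝒮.emb 𝒮.normal p a) (mfderiv (𝓡 2) (𝓡 3) 𝒮.emb p b)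

/-- The outward null expansion. -/
def θk (𝒮 : EmbeddedSurface D S) (p : S) : ℝ := 𝒮.Z₁ p + 𝒮.Z₂ p

/-- The inward null expansion. -/
def θl (𝒮 : EmbeddedSurface D S) (p : S) : ℝ := 𝒮.Z₁ p - 𝒮.Z₂ p

/-- `S` is marginally outer trapped: the outward null expansion vanishes on `S`. -/
def IsMOTS (𝒮 : EmbeddedSurface D S) : Prop := ∀ p, 𝒮.θk p = 0

/-- `S` is minimal: both null expansions vanish on `S`. -/
def IsMinimal (𝒮 : EmbeddedSurface D S) : Prop := ∀ p, 𝒮.θk p = 0 ∧ 𝒮.θl p = 0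

/-- A vector field of the slice is everywhere tangent to `S`. -/
def IsTangent (𝒮 : EmbeddedSurface D S) (x : ∀ p : M, TangentSpace (𝓡 3) p) : Prop :=
  ∀ p : S, ∃ w : TangentSpace (𝓡 2) p, x (𝒮.emb p) = mfderiv (𝓡 2) (𝓡 3) 𝒮.emb p w

end EmbeddedSurface

end

/-!
The divergence identity is the trace over `S` of the Killing equation. The dichotomy follows from
it by unique continuation for the normal component `α` of the symmetry.

Both halves are read off in coordinates `(y, z)` near a point of `S`, obtained from a chart of `S`
and the straight lines, in a chart of `M`, in the direction of the unit normal: `z = 0` is the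
surface, and `∂_z` is its unit normal there (`EmbeddedSurface.adaptedMetric`,
`EmbeddedSurface.adaptedField`). In these coordinates the induced metric is `q_ab = g_ab(y, 0)`, the
second fundamental form is `½ ∂_z g_ab` (`secondFundamentalForm_eq`), and along `z = 0` the symmetry
has components `(τ, α)`. So the tangential components of `𝓛ₓ g = 0` say `𝓛_τ q + α ∂_z g_ab = 0`,
whose trace is `2 (D_a τ^a + α 𝒵₂) = 0` (`EmbeddedSurface.normal_mul_Z₂_add_divergence`).

If `τ` is divergence-free, then `α 𝒵₂ = 0` on `S`. Suppose that the interior of `{α = 0}` is empty.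
Then `𝒵₂`, being continuous, vanishes identically; with `θ_k = 0` this makes `S` minimal. Suppose
that the interior is not empty. It is open, and it is closed by unique continuation, so it is all of
the connected surface `S`, and the symmetry is tangent to `S`.

For the unique continuation (`EmbeddedSurface.eventually_normal_component_eq_zero`), note that
where the mean curvature of `z = 0` vanishes, `α` satisfies a linear elliptic equation, the Jacobi
equation `Δα = c α + …`, as the flow of a Killing field preserves mean curvature. Here it is derived
by eliminating between the Killing equation and its first derivatives (`exists_jacobi_equation`).
The mean curvature vanishes wherever `α ≠ 0`; where `α` vanishes on an open set the equation is
trivial; hence it holds everywhere by continuity (`eventually_killing_normal_eq_zero`).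

The coefficients are smooth but not known to be analytic, so unique continuation is proved by a
Carleman estimate. In the plane, after division by the leading coefficient, the principal part is
`∂₀² + 2a ∂₀∂₁ + (a² + b²) ∂₁²` with `b > 0`. Up to first-order terms this is `P P̄` with
`P = ∂₀ + (a + ib)∂₁`, so that the pair `v = (u, P̄u)` satisfies the differential inequality
`|Pv| ≤ C |v|`; here `|Pu| = |P̄u|`, since `u` is real (`exists_bound_beltrami`). The Carleman
estimate for such first-order operators (`carleman_of_pseudoconvex`) is an integration by parts;
weights for it are the functions `e^{-sρ}` with `s` large and `dρ ≠ 0`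
(`exists_pseudoconvex_weight`), and `ρ = |y - z|²` propagates the
vanishing of a solution from a neighbourhood of `z` to every ball about `z`
(`eq_zero_of_elliptic`, `eventuallyEq_zero_of_elliptic`).
-/

open scoped Topology
open MeasureTheory

/-! ### Partial derivatives in the plane -/

/-- The partial derivative `∂ᵢ f` of a function of `n` real variables. -/
noncomputable def partialDeriv {n : ℕ} (i : Fin n) (f : EuclideanSpace ℝ (Fin n) → ℝ)
    (y : EuclideanSpace ℝ (Fin n)) : ℝ := fderiv ℝ f y (coordVec i)

section PartialDeriv

variable {n : ℕ} {f g : EuclideanSpace ℝ (Fin n) → ℝ} {y : EuclideanSpace ℝ (Fin n)}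

lemma partialDeriv_add (i : Fin n) (hf : DifferentiableAt ℝ f y) (hg : DifferentiableAt ℝ g y) :
    partialDeriv i (fun z ↦ f z + g z) y = partialDeriv i f y + partialDeriv i g y := by
  simp only [partialDeriv]
  rw [fderiv_fun_add hf hg]; rfl

lemma partialDeriv_neg (i : Fin n) :
    partialDeriv i (fun z ↦ - f z) y = - partialDeriv i f y := by
  simp only [partialDeriv]
  rw [fderiv_fun_neg (𝕜 := ℝ)]; rfl

lemma partialDeriv_mul (i : Fin n) (hf : DifferentiableAt ℝ f y) (hg : DifferentiableAt ℝ g y) :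
    partialDeriv i (fun z ↦ f z * g z) y
      = partialDeriv i f y * g y + f y * partialDeriv i g y := by
  simp only [partialDeriv]
  rw [fderiv_fun_mul hf hg]
  simp
  ring

lemma partialDeriv_const (i : Fin n) (c : ℝ) :
    partialDeriv i (fun _ ↦ c) y = 0 := by
  simp [partialDeriv]

lemma partialDeriv_exp (i : Fin n) (hf : DifferentiableAt ℝ f y) :
    partialDeriv i (fun z ↦ Real.exp (f z)) y = Real.exp (f y) * partialDeriv i f y := by
  simp only [partialDeriv]
  rw [fderiv_exp hf]
  simp

lemma partialDeriv_congr (i : Fin n) (h : f =ᶠ[𝓝 y] g) :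
    partialDeriv i f =ᶠ[𝓝 y] partialDeriv i g := by
  filter_upwards [h.fderiv (𝕜 := ℝ)] with z hz
  simp only [partialDeriv, hz]

lemma partialDeriv_comm {i j : Fin n} (hf : ContDiffAt ℝ ∞ f y) :
    partialDeriv i (partialDeriv j f) y = partialDeriv j (partialDeriv i f) y := by
  have hs : IsSymmSndFDerivAt ℝ f y := by
    refine hf.isSymmSndFDerivAt ?_
    simp only [minSmoothness_of_isRCLikeNormedField]
    exact WithTop.coe_le_coe.2 (le_top : (2 : ℕ∞) ≤ ⊤)
  have hd : DifferentiableAt ℝ (fderiv ℝ f) y :=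
    (hf.fderiv_right (m := 1) (by norm_cast)).differentiableAt one_ne_zero
  have key : ∀ k l : Fin n, partialDeriv k (partialDeriv l f) y
      = fderiv ℝ (fderiv ℝ f) y (coordVec k) (coordVec l) := by
    intro k l
    unfold partialDeriv
    rw [fderiv_clm_apply hd (differentiableAt_const _)]
    simp
  rw [key, key, hs.eq]

lemma ContDiff.partialDeriv (i : Fin n) (hf : ContDiff ℝ ∞ f) :
    ContDiff ℝ ∞ (partialDeriv i f) := by
  have := hf.fderiv_right (m := ∞) (by simp)
  exact this.clm_apply contDiff_const

lemma ContDiffOn.partialDeriv {s : Set (EuclideanSpace ℝ (Fin n))} (hs : IsOpen s) (i : Fin n)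
    (hf : ContDiffOn ℝ ∞ f s) : ContDiffOn ℝ ∞ (partialDeriv i f) s := by
  have := hf.fderiv_of_isOpen (m := ∞) hs (by simp)
  exact this.clm_apply contDiffOn_const

lemma HasCompactSupport.partialDeriv (i : Fin n) (hf : HasCompactSupport f) :
    HasCompactSupport (partialDeriv i f) := by
  have := hf.fderiv_apply (𝕜 := ℝ) (coordVec i)
  exact this

lemma partialDeriv_eq_zero_of_notMem_tsupport (i : Fin n) (hy : y ∉ tsupport f) :
    partialDeriv i f y = 0 := by
  have h := partialDeriv_congr i (notMem_tsupport_iff_eventuallyEq.1 hy)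
  rw [h.eq_of_nhds]
  exact partialDeriv_const i 0

lemma integral_partialDeriv_eq_zero (i : Fin n) (hf : ContDiff ℝ ∞ f)
    (hs : HasCompactSupport f) : ∫ y, partialDeriv i f y = 0 := by
  have hfi : Integrable f := hf.continuous.integrable_of_hasCompactSupport hs
  have hgi : Integrable (partialDeriv i f) :=
    (hf.partialDeriv i).continuous.integrable_of_hasCompactSupport (hs.partialDeriv i)
  have h := integral_mul_fderiv_eq_neg_fderiv_mul_of_integrable (𝕜 := ℝ)
    (f := fun _ : EuclideanSpace ℝ (Fin n) ↦ (1 : ℝ)) (g := f) (v := coordVec i)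
    (μ := volume) (by simp) (by simpa using! hgi) (by simpa using hfi)
    (fun x _ ↦ differentiableAt_const _) (fun x _ ↦ (hf.differentiable (by simp)).differentiableAt)
  simpa [partialDeriv] using h

end PartialDeriv

/-! ### A Carleman estimate for first-order elliptic operators in the plane -/

/-- The pointwise algebra behind the Carleman estimate. Here `p` stands for the conjugated operator
applied to `v = F + iG`, `q` for its formal adjoint up to lower order terms and sign, `κ` collects
the terms of order `lam` caused by the variation of the coefficients, and `dX` is the divergence of
the vector field `2A∇φ`. -/
lemma carleman_pointwise {F G Fx Fy Gx Gy a b bx by' φx φy lam c K dX β p₁ p₂ q₁ q₂ κ : ℝ}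
    (hlam : 0 ≤ lam)
    (hp₁ : p₁ = Fx + a * Fy - b * Gy - lam * ((φx + a * φy) * F - b * φy * G))
    (hp₂ : p₂ = Gx + a * Gy + b * Fy - lam * ((φx + a * φy) * G + b * φy * F))
    (hq₁ : q₁ = Fx + a * Fy + b * Gy + lam * ((φx + a * φy) * F + b * φy * G))
    (hq₂ : q₂ = Gx + a * Gy - b * Fy + lam * ((φx + a * φy) * G - b * φy * F))
    (hβ : β * b = bx + a * by') (hκ : κ = β * (φx + a * φy) + b * by' * φy)
    (hc : 2 * c + 4 * |κ| ≤ dX) (hK : 2 * (β ^ 2 + by' ^ 2) ≤ K) :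
    2 * lam * c * (F ^ 2 + G ^ 2) + (p₁ ^ 2 + p₂ ^ 2 - q₁ ^ 2 - q₂ ^ 2
        - 4 * F * (bx * Gy - by' * Gx) - lam * dX * (F ^ 2 + G ^ 2))
      ≤ 2 * (p₁ ^ 2 + p₂ ^ 2) + K * (F ^ 2 + G ^ 2) := by
  have e : 4 * F * (bx * Gy - by' * Gx)
      = -2 * β * F * (p₁ - q₁) - 2 * by' * F * (p₂ + q₂) - 4 * lam * F ^ 2 * κ := by
    have hbx : bx = β * b - a * by' := by linarith
    rw [hp₁, hp₂, hq₁, hq₂, hκ, hbx]; ring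
  have h1 : lam * (2 * c + 4 * |κ|) * (F ^ 2 + G ^ 2) ≤ lam * dX * (F ^ 2 + G ^ 2) := by gcongr
  have h2 : 4 * lam * F ^ 2 * κ ≤ 4 * lam * (F ^ 2 + G ^ 2) * |κ| := by
    have := le_abs_self κ
    have h0 := abs_nonneg κ
    calc 4 * lam * F ^ 2 * κ ≤ 4 * lam * F ^ 2 * |κ| := by gcongr
      _ ≤ 4 * lam * (F ^ 2 + G ^ 2) * |κ| := by gcongr; nlinarith [sq_nonneg G]
  have h3 : 2 * (β ^ 2 + by' ^ 2) * (F ^ 2 + G ^ 2) ≤ K * (F ^ 2 + G ^ 2) := by gcongr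
  nlinarith [sq_nonneg (p₁ - β * F), sq_nonneg (q₁ + β * F), sq_nonneg (p₂ - by' * F),
    sq_nonneg (q₂ - by' * F), mul_nonneg (sq_nonneg β) (sq_nonneg G),
    mul_nonneg (sq_nonneg by') (sq_nonneg G)]

/-- The real part of `(∂₀ + (a + ib)∂₁)(f + ig)`. -/
noncomputable def beltramiRe (a b f g : EuclideanSpace ℝ (Fin 2) → ℝ)
    (y : EuclideanSpace ℝ (Fin 2)) : ℝ :=
  partialDeriv 0 f y + a y * partialDeriv 1 f y - b y * partialDeriv 1 g y

/-- The imaginary part of `(∂₀ + (a + ib)∂₁)(f + ig)`. -/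
noncomputable def beltramiIm (a b f g : EuclideanSpace ℝ (Fin 2) → ℝ)
    (y : EuclideanSpace ℝ (Fin 2)) : ℝ :=
  partialDeriv 0 g y + a y * partialDeriv 1 g y + b y * partialDeriv 1 f y

/-- The Carleman estimate `lam c ∫ e^{2 lam φ}|v|² ≤ 2 ∫ e^{2 lam φ}|Pv|²` for the first-order
elliptic operator `P = ∂₀ + (a + ib)∂₁` on functions supported in `A`, for a weight `φ` that is
strictly pseudoconvex on `A`. Conjugating by the weight, the commutator of `P` with its adjoint
contributes the divergence of `2A∇φ`, up to terms that the hypotheses absorb. -/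
theorem carleman_of_pseudoconvex {a b φ f g : EuclideanSpace ℝ (Fin 2) → ℝ}
    {A : Set (EuclideanSpace ℝ (Fin 2))} {c K lam : ℝ}
    (ha : ContDiff ℝ ∞ a) (hb : ContDiff ℝ ∞ b) (hφ : ContDiff ℝ ∞ φ) (hb0 : ∀ y, 0 < b y)
    (hf : ContDiff ℝ ∞ f) (hg : ContDiff ℝ ∞ g)
    (hfs : HasCompactSupport f) (hgs : HasCompactSupport g)
    (hfA : tsupport f ⊆ A) (hgA : tsupport g ⊆ A) (hlam : 0 ≤ lam) (hlamc : K ≤ lam * c)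
    (hc : ∀ y ∈ A, 2 * c + 4 * |(partialDeriv 0 b y + a y * partialDeriv 1 b y) / b y *
        (partialDeriv 0 φ y + a y * partialDeriv 1 φ y)
          + b y * partialDeriv 1 b y * partialDeriv 1 φ y|
      ≤ 2 * (partialDeriv 0 (fun z ↦ partialDeriv 0 φ z + a z * partialDeriv 1 φ z) y
        + partialDeriv 1 (fun z ↦ a z * partialDeriv 0 φ z
          + (a z * a z + b z * b z) * partialDeriv 1 φ z) y))
    (hK : ∀ y ∈ A, 2 * (((partialDeriv 0 b y + a y * partialDeriv 1 b y) / b y) ^ 2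
      + partialDeriv 1 b y ^ 2) ≤ K) :
    lam * c * ∫ y, Real.exp (2 * lam * φ y) * (f y ^ 2 + g y ^ 2)
      ≤ 2 * ∫ y, Real.exp (2 * lam * φ y) *
        (beltramiRe a b f g y ^ 2 + beltramiIm a b f g y ^ 2) := by
  set w : EuclideanSpace ℝ (Fin 2) → ℝ := fun y ↦ Real.exp (lam * φ y) with hw
  have hwC : ContDiff ℝ ∞ w := (contDiff_const.mul hφ).exp
  set F : EuclideanSpace ℝ (Fin 2) → ℝ := fun y ↦ w y * f y with hF
  set G : EuclideanSpace ℝ (Fin 2) → ℝ := fun y ↦ w y * g y with hG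
  have hFC : ContDiff ℝ ∞ F := hwC.mul hf
  have hGC : ContDiff ℝ ∞ G := hwC.mul hg
  have hFs : HasCompactSupport F := hfs.mul_left
  have hGs : HasCompactSupport G := hgs.mul_left
  have dif : ∀ {u : EuclideanSpace ℝ (Fin 2) → ℝ}, ContDiff ℝ ∞ u → ∀ y, DifferentiableAt ℝ u y :=
    fun h y ↦ (h.differentiable (by simp)).differentiableAt
  -- the components of the two boundary terms
  set A₀ : EuclideanSpace ℝ (Fin 2) → ℝ := fun y ↦ -4 * (b y * (F y * partialDeriv 1 G y))
    + (-2 * lam) * ((partialDeriv 0 φ y + a y * partialDeriv 1 φ y) * (F y * F y + G y * G y))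
    with hA₀
  set A₁ : EuclideanSpace ℝ (Fin 2) → ℝ := fun y ↦ 4 * (b y * (F y * partialDeriv 0 G y))
    + (-2 * lam) * ((a y * partialDeriv 0 φ y + (a y * a y + b y * b y) * partialDeriv 1 φ y)
      * (F y * F y + G y * G y)) with hA₁
  have hX₀ : ContDiff ℝ ∞ fun y ↦ partialDeriv 0 φ y + a y * partialDeriv 1 φ y :=
    (hφ.partialDeriv 0).add (ha.mul (hφ.partialDeriv 1))
  have hX₁ : ContDiff ℝ ∞ fun y ↦ a y * partialDeriv 0 φ y
      + (a y * a y + b y * b y) * partialDeriv 1 φ y :=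
    (ha.mul (hφ.partialDeriv 0)).add (((ha.mul ha).add (hb.mul hb)).mul (hφ.partialDeriv 1))
  have hN : ContDiff ℝ ∞ fun y ↦ F y * F y + G y * G y := (hFC.mul hFC).add (hGC.mul hGC)
  have hNs : HasCompactSupport fun y ↦ F y * F y + G y * G y := hFs.mul_left.add hGs.mul_left
  have hA₀C : ContDiff ℝ ∞ A₀ :=
    (contDiff_const.mul (hb.mul (hFC.mul (hGC.partialDeriv 1)))).add
      (contDiff_const.mul (hX₀.mul hN))
  have hA₁C : ContDiff ℝ ∞ A₁ :=
    (contDiff_const.mul (hb.mul (hFC.mul (hGC.partialDeriv 0)))).add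
      (contDiff_const.mul (hX₁.mul hN))
  have hA₀s : HasCompactSupport A₀ :=
    (HasCompactSupport.mul_left (HasCompactSupport.mul_left hFs.mul_right)).add
      (HasCompactSupport.mul_left hNs.mul_left)
  have hA₁s : HasCompactSupport A₁ :=
    (HasCompactSupport.mul_left (HasCompactSupport.mul_left hFs.mul_right)).add
      (HasCompactSupport.mul_left hNs.mul_left)
  have hwsq : ∀ y, Real.exp (2 * lam * φ y) = w y * w y := by
    intro y
    simp only [hw, ← Real.exp_add]
    congr 1; ring
  have hPC₁ : ContDiff ℝ ∞ (beltramiRe a b f g) :=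
    ((hf.partialDeriv 0).add (ha.mul (hf.partialDeriv 1))).sub (hb.mul (hg.partialDeriv 1))
  have hPC₂ : ContDiff ℝ ∞ (beltramiIm a b f g) :=
    ((hg.partialDeriv 0).add (ha.mul (hg.partialDeriv 1))).add (hb.mul (hf.partialDeriv 1))
  have hPs₁ : HasCompactSupport (beltramiRe a b f g) := by
    have := ((hfs.partialDeriv 0).add ((hfs.partialDeriv 1).mul_left (f := a))).sub
      ((hgs.partialDeriv 1).mul_left (f := b))
    exact this
  have hPs₂ : HasCompactSupport (beltramiIm a b f g) := by
    have := ((hgs.partialDeriv 0).add ((hgs.partialDeriv 1).mul_left (f := a))).add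
      ((hfs.partialDeriv 1).mul_left (f := b))
    exact this
  have hIv : Integrable fun y ↦ Real.exp (2 * lam * φ y) * (f y ^ 2 + g y ^ 2) := by
    refine Continuous.integrable_of_hasCompactSupport ?_ ?_
    · have := hφ.continuous; have := hf.continuous; have := hg.continuous; fun_prop
    · refine HasCompactSupport.mul_left ?_
      simp only [pow_two]
      exact hfs.mul_left.add hgs.mul_left
  have hIp : Integrable fun y ↦ Real.exp (2 * lam * φ y) *
      (beltramiRe a b f g y ^ 2 + beltramiIm a b f g y ^ 2) := by
    refine Continuous.integrable_of_hasCompactSupport ?_ ?_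
    · have := hφ.continuous; have := hPC₁.continuous; have := hPC₂.continuous; fun_prop
    · refine HasCompactSupport.mul_left ?_
      simp only [pow_two]
      exact hPs₁.mul_left.add hPs₂.mul_left
  have hID : ∀ i, ∀ {u : EuclideanSpace ℝ (Fin 2) → ℝ}, ContDiff ℝ ∞ u → HasCompactSupport u →
      Integrable (partialDeriv i u) := fun i u hu hus ↦
    (hu.partialDeriv i).continuous.integrable_of_hasCompactSupport (hus.partialDeriv i)
  have key : ∀ y, 2 * lam * c * (Real.exp (2 * lam * φ y) * (f y ^ 2 + g y ^ 2))
      + (partialDeriv 0 A₀ y + partialDeriv 1 A₁ y)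
      ≤ 2 * (Real.exp (2 * lam * φ y) * (beltramiRe a b f g y ^ 2 + beltramiIm a b f g y ^ 2))
        + K * (Real.exp (2 * lam * φ y) * (f y ^ 2 + g y ^ 2)) := by
    intro y
    by_cases hy : y ∈ A
    swap
    · have hfy : y ∉ tsupport f := fun h ↦ hy (hfA h)
      have hgy : y ∉ tsupport g := fun h ↦ hy (hgA h)
      have hf0 := notMem_tsupport_iff_eventuallyEq.1 hfy
      have hg0 := notMem_tsupport_iff_eventuallyEq.1 hgy
      have hA0 : A₀ =ᶠ[𝓝 y] fun _ ↦ 0 := by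
        filter_upwards [hf0, hg0] with z h1 h2
        simp only [Pi.zero_apply] at h1 h2
        simp [hA₀, hF, hG, h1, h2]
      have hA1 : A₁ =ᶠ[𝓝 y] fun _ ↦ 0 := by
        filter_upwards [hf0, hg0] with z h1 h2
        simp only [Pi.zero_apply] at h1 h2
        simp [hA₁, hF, hG, h1, h2]
      rw [(partialDeriv_congr 0 hA0).eq_of_nhds, (partialDeriv_congr 1 hA1).eq_of_nhds,
        partialDeriv_const, partialDeriv_const, hf0.eq_of_nhds, hg0.eq_of_nhds]
      simp only [Pi.zero_apply]
      have : 0 ≤ Real.exp (2 * lam * φ y) *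
        (beltramiRe a b f g y ^ 2 + beltramiIm a b f g y ^ 2) := by positivity
      simpa using this
    have hwd : ∀ i, partialDeriv i w y = w y * (lam * partialDeriv i φ y) := by
      intro i
      rw [hw, partialDeriv_exp i ((dif hφ y).const_mul lam),
        partialDeriv_mul i (differentiableAt_const _) (dif hφ y), partialDeriv_const]
      ring
    have hFd : ∀ i, partialDeriv i F y
        = w y * (partialDeriv i f y + lam * partialDeriv i φ y * f y) := by
      intro i
      rw [hF, partialDeriv_mul i (dif hwC y) (dif hf y), hwd]; ring
    have hGd : ∀ i, partialDeriv i G y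
        = w y * (partialDeriv i g y + lam * partialDeriv i φ y * g y) := by
      intro i
      rw [hG, partialDeriv_mul i (dif hwC y) (dif hg y), hwd]; ring
    have hNd : ∀ i, partialDeriv i (fun y ↦ F y * F y + G y * G y) y
        = 2 * (F y * partialDeriv i F y + G y * partialDeriv i G y) := by
      intro i
      rw [partialDeriv_add i (dif (hFC.mul hFC) y) (dif (hGC.mul hGC) y),
        partialDeriv_mul i (dif hFC y) (dif hFC y), partialDeriv_mul i (dif hGC y) (dif hGC y)]
      ring
    have hA₀d : partialDeriv 0 A₀ y = -4 * (partialDeriv 0 b y * (F y * partialDeriv 1 G y)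
        + b y * (partialDeriv 0 F y * partialDeriv 1 G y
          + F y * partialDeriv 0 (partialDeriv 1 G) y))
        + (-2 * lam) * (partialDeriv 0 (fun z ↦ partialDeriv 0 φ z + a z * partialDeriv 1 φ z) y
            * (F y * F y + G y * G y) + (partialDeriv 0 φ y + a y * partialDeriv 1 φ y)
            * (2 * (F y * partialDeriv 0 F y + G y * partialDeriv 0 G y))) := by
      have hFG := hFC.mul (hGC.partialDeriv 1)
      rw [hA₀, partialDeriv_add 0 (dif (contDiff_const.mul (hb.mul hFG)) y)
          (dif (contDiff_const.mul (hX₀.mul hN)) y),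
        partialDeriv_mul 0 (dif contDiff_const y) (dif (hb.mul hFG) y),
        partialDeriv_mul 0 (dif hb y) (dif hFG y),
        partialDeriv_mul 0 (dif hFC y) (dif (hGC.partialDeriv 1) y),
        partialDeriv_mul 0 (dif contDiff_const y) (dif (hX₀.mul hN) y),
        partialDeriv_mul 0 (dif hX₀ y) (dif hN y), partialDeriv_const, partialDeriv_const, hNd]
      ring
    have hA₁d : partialDeriv 1 A₁ y = 4 * (partialDeriv 1 b y * (F y * partialDeriv 0 G y)
        + b y * (partialDeriv 1 F y * partialDeriv 0 G y
          + F y * partialDeriv 1 (partialDeriv 0 G) y))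
        + (-2 * lam) * (partialDeriv 1 (fun z ↦ a z * partialDeriv 0 φ z
            + (a z * a z + b z * b z) * partialDeriv 1 φ z) y
            * (F y * F y + G y * G y) + (a y * partialDeriv 0 φ y
            + (a y * a y + b y * b y) * partialDeriv 1 φ y)
            * (2 * (F y * partialDeriv 1 F y + G y * partialDeriv 1 G y))) := by
      have hFG := hFC.mul (hGC.partialDeriv 0)
      rw [hA₁, partialDeriv_add 1 (dif (contDiff_const.mul (hb.mul hFG)) y)
          (dif (contDiff_const.mul (hX₁.mul hN)) y),
        partialDeriv_mul 1 (dif contDiff_const y) (dif (hb.mul hFG) y),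
        partialDeriv_mul 1 (dif hb y) (dif hFG y),
        partialDeriv_mul 1 (dif hFC y) (dif (hGC.partialDeriv 0) y),
        partialDeriv_mul 1 (dif contDiff_const y) (dif (hX₁.mul hN) y),
        partialDeriv_mul 1 (dif hX₁ y) (dif hN y), partialDeriv_const, partialDeriv_const, hNd]
      ring
    have hcomm : partialDeriv 1 (partialDeriv 0 G) y = partialDeriv 0 (partialDeriv 1 G) y :=
      partialDeriv_comm hGC.contDiffAt
    have h := carleman_pointwise (F := F y) (G := G y) (Fx := partialDeriv 0 F y)
      (Fy := partialDeriv 1 F y) (Gx := partialDeriv 0 G y) (Gy := partialDeriv 1 G y)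
      (a := a y) (b := b y) (bx := partialDeriv 0 b y) (by' := partialDeriv 1 b y)
      (φx := partialDeriv 0 φ y) (φy := partialDeriv 1 φ y) (lam := lam) (c := c) (K := K)
      hlam rfl rfl rfl rfl (div_mul_cancel₀ _ (hb0 y).ne') rfl (hc y hy) (hK y hy)
    have e1 : F y ^ 2 + G y ^ 2 = Real.exp (2 * lam * φ y) * (f y ^ 2 + g y ^ 2) := by
      rw [hwsq]; simp only [hF, hG]; ring
    have e2 : partialDeriv 0 F y + a y * partialDeriv 1 F y - b y * partialDeriv 1 G y
        - lam * ((partialDeriv 0 φ y + a y * partialDeriv 1 φ y) * F y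
          - b y * partialDeriv 1 φ y * G y) = w y * beltramiRe a b f g y := by
      simp only [hFd, hGd, beltramiRe]; simp only [hF, hG]; ring
    have e3 : partialDeriv 0 G y + a y * partialDeriv 1 G y + b y * partialDeriv 1 F y
        - lam * ((partialDeriv 0 φ y + a y * partialDeriv 1 φ y) * G y
          + b y * partialDeriv 1 φ y * F y) = w y * beltramiIm a b f g y := by
      simp only [hFd, hGd, beltramiIm]; simp only [hF, hG]; ring
    have e4 : 2 * (Real.exp (2 * lam * φ y) *
        (beltramiRe a b f g y ^ 2 + beltramiIm a b f g y ^ 2))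
        = 2 * ((w y * beltramiRe a b f g y) ^ 2 + (w y * beltramiIm a b f g y) ^ 2) := by
      rw [hwsq]; ring
    rw [e4, ← e1, ← e2, ← e3]
    refine le_trans (le_of_eq ?_) h
    rw [hA₀d, hA₁d, hcomm]
    ring
  have hint := integral_mono (((hIv.const_mul (2 * lam * c)).add
    ((hID 0 hA₀C hA₀s).add (hID 1 hA₁C hA₁s)))) ((hIp.const_mul 2).add (hIv.const_mul K)) key
  simp only [Pi.add_apply] at hint
  have i1 : ∫ y, (2 * lam * c * (Real.exp (2 * lam * φ y) * (f y ^ 2 + g y ^ 2))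
      + (partialDeriv 0 A₀ y + partialDeriv 1 A₁ y))
      = 2 * lam * c * ∫ y, Real.exp (2 * lam * φ y) * (f y ^ 2 + g y ^ 2) := by
    have h := integral_add (hIv.const_mul (2 * lam * c))
      ((hID 0 hA₀C hA₀s).add (hID 1 hA₁C hA₁s))
    simp only [Pi.add_apply] at h
    rw [h, integral_add (hID 0 hA₀C hA₀s) (hID 1 hA₁C hA₁s),
      integral_partialDeriv_eq_zero 0 hA₀C hA₀s,
      integral_partialDeriv_eq_zero 1 hA₁C hA₁s, integral_const_mul]
    ring
  rw [integral_add (hIp.const_mul 2) (hIv.const_mul K), integral_const_mul, integral_const_mul]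
    at hint
  have hI0 : 0 ≤ ∫ y, Real.exp (2 * lam * φ y) * (f y ^ 2 + g y ^ 2) :=
    integral_nonneg fun y ↦ by positivity
  have := mul_le_mul_of_nonneg_right hlamc hI0
  linarith [i1.symm.le.trans hint]

/-- On a compact set where `dρ ≠ 0`, the function `e^{-sρ}` is a pseudoconvex weight in the sense of
`carleman_of_pseudoconvex` as soon as `s` is large: the term `s² A∇ρ·∇ρ` dominates. -/
lemma exists_pseudoconvex_weight {a b ρ : EuclideanSpace ℝ (Fin 2) → ℝ}
    {A : Set (EuclideanSpace ℝ (Fin 2))} (hA : IsCompact A)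
    (ha : ContDiff ℝ ∞ a) (hb : ContDiff ℝ ∞ b) (hρ : ContDiff ℝ ∞ ρ) (hb0 : ∀ y, 0 < b y)
    (hd : ∀ y ∈ A, partialDeriv 0 ρ y ≠ 0 ∨ partialDeriv 1 ρ y ≠ 0) :
    ∃ s : ℝ, 0 < s ∧ ∃ c : ℝ, 0 < c ∧ ∃ φ : EuclideanSpace ℝ (Fin 2) → ℝ,
      (φ = fun y ↦ Real.exp (-s * ρ y)) ∧
      ∀ y ∈ A, 2 * c + 4 * |(partialDeriv 0 b y + a y * partialDeriv 1 b y) / b y *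
        (partialDeriv 0 φ y + a y * partialDeriv 1 φ y)
          + b y * partialDeriv 1 b y * partialDeriv 1 φ y|
      ≤ 2 * (partialDeriv 0 (fun z ↦ partialDeriv 0 φ z + a z * partialDeriv 1 φ z) y
        + partialDeriv 1 (fun z ↦ a z * partialDeriv 0 φ z
          + (a z * a z + b z * b z) * partialDeriv 1 φ z) y) := by
  have dif : ∀ {u : EuclideanSpace ℝ (Fin 2) → ℝ}, ContDiff ℝ ∞ u → ∀ y, DifferentiableAt ℝ u y :=
    fun h y ↦ (h.differentiable (by simp)).differentiableAt
  set Y₀ : EuclideanSpace ℝ (Fin 2) → ℝ := fun y ↦ partialDeriv 0 ρ y + a y * partialDeriv 1 ρ y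
    with hY₀
  set Y₁ : EuclideanSpace ℝ (Fin 2) → ℝ := fun y ↦ a y * partialDeriv 0 ρ y
    + (a y * a y + b y * b y) * partialDeriv 1 ρ y with hY₁
  have hY₀C : ContDiff ℝ ∞ Y₀ := (hρ.partialDeriv 0).add (ha.mul (hρ.partialDeriv 1))
  have hY₁C : ContDiff ℝ ∞ Y₁ :=
    (ha.mul (hρ.partialDeriv 0)).add (((ha.mul ha).add (hb.mul hb)).mul (hρ.partialDeriv 1))
  set κ : EuclideanSpace ℝ (Fin 2) → ℝ := fun y ↦
    (partialDeriv 0 b y + a y * partialDeriv 1 b y) / b y * Y₀ y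
      + b y * partialDeriv 1 b y * partialDeriv 1 ρ y with hκ
  set m : EuclideanSpace ℝ (Fin 2) → ℝ := fun y ↦
    partialDeriv 0 ρ y * Y₀ y + partialDeriv 1 ρ y * Y₁ y with hm
  have hmpos : ∀ y ∈ A, 0 < m y := by
    intro y hy
    have e : m y = (partialDeriv 0 ρ y + a y * partialDeriv 1 ρ y) ^ 2
        + (b y * partialDeriv 1 ρ y) ^ 2 := by simp only [hm, hY₀, hY₁]; ring
    have hby := hb0 y
    rw [e]
    by_cases h1 : partialDeriv 1 ρ y = 0
    · have h0 : partialDeriv 0 ρ y ≠ 0 := (hd y hy).resolve_right (by simpa using h1)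
      simp only [h1, mul_zero, add_zero]
      positivity
    · positivity
  have cρ : ∀ i, Continuous (partialDeriv i ρ) := fun i ↦ (hρ.partialDeriv i).continuous
  have cb : ∀ i, Continuous (partialDeriv i b) := fun i ↦ (hb.partialDeriv i).continuous
  have cκ : Continuous κ := by
    have := cρ 1; have := cb 0; have := cb 1; have := ha.continuous; have := hb.continuous
    have := hY₀C.continuous
    have h0 : ∀ y, b y ≠ 0 := fun y ↦ (hb0 y).ne'
    simp only [hκ]
    fun_prop (disch := assumption)
  have cm : Continuous m := by
    have := cρ 0; have := cρ 1; have := hY₀C.continuous; have := hY₁C.continuous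
    fun_prop
  have cdiv : Continuous fun y ↦ partialDeriv 0 Y₀ y + partialDeriv 1 Y₁ y :=
    ((hY₀C.partialDeriv 0).continuous).add ((hY₁C.partialDeriv 1).continuous)
  obtain ⟨s₀, hs₀⟩ := hA.exists_bound_of_continuousOn
    (f := fun y ↦ (2 * |κ y| + |partialDeriv 0 Y₀ y + partialDeriv 1 Y₁ y| + 1) / m y)
    (ContinuousOn.div ((((cκ.abs.const_mul 2).add cdiv.abs).add_const 1).continuousOn)
      cm.continuousOn fun y hy ↦ (hmpos y hy).ne')
  set s := max s₀ 1 with hs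
  have hspos : 0 < s := lt_of_lt_of_le one_pos (le_max_right _ _)
  have hsm : ∀ y ∈ A, 2 * |κ y| + |partialDeriv 0 Y₀ y + partialDeriv 1 Y₁ y| + 1 ≤ s * m y := by
    intro y hy
    have h1 := (le_abs_self _).trans ((hs₀ y hy).trans (le_max_left s₀ 1))
    rwa [div_le_iff₀ (hmpos y hy)] at h1
  obtain ⟨B, hB⟩ := hA.exists_bound_of_continuousOn (f := fun y ↦ s * ρ y)
    ((hρ.continuous.const_mul s).continuousOn)
  refine ⟨s, hspos, s * Real.exp (-B), by positivity, fun y ↦ Real.exp (-s * ρ y), rfl, ?_⟩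
  set φ : EuclideanSpace ℝ (Fin 2) → ℝ := fun y ↦ Real.exp (-s * ρ y) with hφ
  have hφC : ContDiff ℝ ∞ φ := (contDiff_const.mul hρ).exp
  have hφd : ∀ i y, partialDeriv i φ y = -s * (φ y * partialDeriv i ρ y) := by
    intro i y
    rw [hφ, partialDeriv_exp i ((dif hρ y).const_mul (-s)),
      partialDeriv_mul i (differentiableAt_const _) (dif hρ y), partialDeriv_const]
    ring
  intro y hy
  have hX₀ : (fun z ↦ partialDeriv 0 φ z + a z * partialDeriv 1 φ z)
      = fun z ↦ (-s) * (φ z * Y₀ z) := by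
    funext z; rw [hφd, hφd]; simp only [hY₀]; ring
  have hX₁ : (fun z ↦ a z * partialDeriv 0 φ z + (a z * a z + b z * b z) * partialDeriv 1 φ z)
      = fun z ↦ (-s) * (φ z * Y₁ z) := by
    funext z; rw [hφd, hφd]; simp only [hY₁]; ring
  have hdiv : partialDeriv 0 (fun z ↦ (-s) * (φ z * Y₀ z)) y
      + partialDeriv 1 (fun z ↦ (-s) * (φ z * Y₁ z)) y
      = s * φ y * (s * m y - (partialDeriv 0 Y₀ y + partialDeriv 1 Y₁ y)) := by
    rw [partialDeriv_mul 0 (differentiableAt_const _) (dif (hφC.mul hY₀C) y),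
      partialDeriv_mul 1 (differentiableAt_const _) (dif (hφC.mul hY₁C) y),
      partialDeriv_mul 0 (dif hφC y) (dif hY₀C y), partialDeriv_mul 1 (dif hφC y) (dif hY₁C y),
      partialDeriv_const, partialDeriv_const, hφd, hφd]
    simp only [hm]; ring
  have hφpos : 0 < φ y := Real.exp_pos _
  have hκφ : (partialDeriv 0 b y + a y * partialDeriv 1 b y) / b y *
        (partialDeriv 0 φ y + a y * partialDeriv 1 φ y)
          + b y * partialDeriv 1 b y * partialDeriv 1 φ y = -(s * φ y * κ y) := by
    rw [hφd, hφd]; simp only [hκ, hY₀]; ring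
  rw [hX₀, hX₁, hdiv, hκφ, abs_neg, abs_mul, abs_of_pos (mul_pos hspos hφpos)]
  have hφB : Real.exp (-B) ≤ φ y := by
    simp only [hφ]
    gcongr
    have := (le_abs_self _).trans (hB y hy)
    linarith
  have h1 := hsm y hy
  have h2 := le_abs_self (partialDeriv 0 Y₀ y + partialDeriv 1 Y₁ y)
  calc 2 * (s * Real.exp (-B)) + 4 * (s * φ y * |κ y|)
      ≤ 2 * (s * φ y) + 4 * (s * φ y * |κ y|) := by gcongr
    _ = 2 * (s * φ y * (1 + 2 * |κ y|)) := by ring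
    _ ≤ 2 * (s * φ y * (s * m y - (partialDeriv 0 Y₀ y + partialDeriv 1 Y₁ y))) := by
      have : 1 + 2 * |κ y| ≤ s * m y - (partialDeriv 0 Y₀ y + partialDeriv 1 Y₁ y) := by linarith
      gcongr

/-! ### Unique continuation for second-order elliptic equations in the plane -/

section UniqueContinuation

variable {a b u : EuclideanSpace ℝ (Fin 2) → ℝ}

lemma ContDiff.beltramiRe {f g : EuclideanSpace ℝ (Fin 2) → ℝ} (ha : ContDiff ℝ ∞ a)
    (hb : ContDiff ℝ ∞ b) (hf : ContDiff ℝ ∞ f) (hg : ContDiff ℝ ∞ g) :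
    ContDiff ℝ ∞ (beltramiRe a b f g) :=
  ((hf.partialDeriv 0).add (ha.mul (hf.partialDeriv 1))).sub (hb.mul (hg.partialDeriv 1))

lemma ContDiff.beltramiIm {f g : EuclideanSpace ℝ (Fin 2) → ℝ} (ha : ContDiff ℝ ∞ a)
    (hb : ContDiff ℝ ∞ b) (hf : ContDiff ℝ ∞ f) (hg : ContDiff ℝ ∞ g) :
    ContDiff ℝ ∞ (beltramiIm a b f g) :=
  ((hg.partialDeriv 0).add (ha.mul (hg.partialDeriv 1))).add (hb.mul (hf.partialDeriv 1))

/-- The second-order operator `∂₀² + 2a ∂₀∂₁ + (a² + b²)∂₁²`. -/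
noncomputable def ellipticOp (a b u : EuclideanSpace ℝ (Fin 2) → ℝ)
    (y : EuclideanSpace ℝ (Fin 2)) : ℝ :=
  partialDeriv 0 (partialDeriv 0 u) y + 2 * a y * partialDeriv 0 (partialDeriv 1 u) y
    + (a y ^ 2 + b y ^ 2) * partialDeriv 1 (partialDeriv 1 u) y

/-- The factorization `P P̄ = ∂₀² + 2a ∂₀∂₁ + (a² + b²)∂₁² +` first order terms, for
`P = ∂₀ + (a + ib)∂₁`: real part of `P P̄ u`. -/
lemma beltramiRe_conj_beltrami (ha : ContDiff ℝ ∞ a) (hb : ContDiff ℝ ∞ b) (hu : ContDiff ℝ ∞ u)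
    (y : EuclideanSpace ℝ (Fin 2)) :
    beltramiRe a b (fun y ↦ partialDeriv 0 u y + a y * partialDeriv 1 u y)
      (fun y ↦ -(b y * partialDeriv 1 u y)) y
      = ellipticOp a b u y + (partialDeriv 0 a y + a y * partialDeriv 1 a y
        + b y * partialDeriv 1 b y) * partialDeriv 1 u y := by
  have dif : ∀ {u : EuclideanSpace ℝ (Fin 2) → ℝ}, ContDiff ℝ ∞ u → ∀ y, DifferentiableAt ℝ u y :=
    fun h y ↦ (h.differentiable (by simp)).differentiableAt
  have h1 := hu.partialDeriv 1
  have h0 := hu.partialDeriv 0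
  have hc : partialDeriv 1 (partialDeriv 0 u) y = partialDeriv 0 (partialDeriv 1 u) y :=
    partialDeriv_comm hu.contDiffAt
  simp only [beltramiRe, ellipticOp, partialDeriv_neg]
  rw [partialDeriv_add 0 (dif h0 y) (dif (ha.mul h1) y),
    partialDeriv_add 1 (dif h0 y) (dif (ha.mul h1) y),
    partialDeriv_mul 0 (dif ha y) (dif h1 y), partialDeriv_mul 1 (dif ha y) (dif h1 y),
    partialDeriv_mul 1 (dif hb y) (dif h1 y), hc]
  ring

lemma beltramiIm_conj_beltrami (ha : ContDiff ℝ ∞ a) (hb : ContDiff ℝ ∞ b) (hu : ContDiff ℝ ∞ u)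
    (y : EuclideanSpace ℝ (Fin 2)) :
    beltramiIm a b (fun y ↦ partialDeriv 0 u y + a y * partialDeriv 1 u y)
      (fun y ↦ -(b y * partialDeriv 1 u y)) y
      = (b y * partialDeriv 1 a y - partialDeriv 0 b y - a y * partialDeriv 1 b y)
        * partialDeriv 1 u y := by
  have dif : ∀ {u : EuclideanSpace ℝ (Fin 2) → ℝ}, ContDiff ℝ ∞ u → ∀ y, DifferentiableAt ℝ u y :=
    fun h y ↦ (h.differentiable (by simp)).differentiableAt
  have h1 := hu.partialDeriv 1
  have h0 := hu.partialDeriv 0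
  have hc : partialDeriv 1 (partialDeriv 0 u) y = partialDeriv 0 (partialDeriv 1 u) y :=
    partialDeriv_comm hu.contDiffAt
  simp only [beltramiIm, partialDeriv_neg]
  rw [partialDeriv_add 1 (dif h0 y) (dif (ha.mul h1) y),
    partialDeriv_mul 1 (dif ha y) (dif h1 y), partialDeriv_mul 0 (dif hb y) (dif h1 y),
    partialDeriv_mul 1 (dif hb y) (dif h1 y), hc]
  ring

/-- The pointwise algebra behind `exists_bound_beltrami`: `E` is the value of the second-order
operator, and `eᵢ u₁` are the first-order terms in the factorization. As `b` is bounded below,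
`|du|` is controlled by `P̄u = (u₀ + a u₁, -b u₁)`. -/
lemma beltrami_bound_aux {E U u₀ u₁ a b e₁ e₂ C D : ℝ} (hE : |E| ≤ C * (|U| + |u₀| + |u₁|))
    (hD : 0 < D) (hb : 1 ≤ D * b ^ 2) (ha : a ^ 2 ≤ D) (he : 2 * e₁ ^ 2 + e₂ ^ 2 ≤ D) :
    (u₀ + a * u₁) ^ 2 + (b * u₁) ^ 2 + ((E + e₁ * u₁) ^ 2 + (e₂ * u₁) ^ 2)
      ≤ (1 + 6 * C ^ 2 * (3 + 2 * D ^ 2 + D) + D ^ 2)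
        * (U ^ 2 + 0 ^ 2 + ((u₀ + a * u₁) ^ 2 + (-(b * u₁)) ^ 2)) := by
  have hu1 : u₁ ^ 2 ≤ D * (b * u₁) ^ 2 := by
    have := mul_le_mul_of_nonneg_right hb (sq_nonneg u₁)
    linarith
  have hE2 : E ^ 2 ≤ 3 * C ^ 2 * (U ^ 2 + u₀ ^ 2 + u₁ ^ 2) := by
    have h1 : E ^ 2 ≤ (C * (|U| + |u₀| + |u₁|)) ^ 2 := sq_le_sq.2 (hE.trans (le_abs_self _))
    have h2 : (|U| + |u₀| + |u₁|) ^ 2 ≤ 3 * (U ^ 2 + u₀ ^ 2 + u₁ ^ 2) := by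
      rw [← sq_abs U, ← sq_abs u₀, ← sq_abs u₁]
      nlinarith [sq_nonneg (|U| - |u₀|), sq_nonneg (|U| - |u₁|), sq_nonneg (|u₀| - |u₁|)]
    have h3 := mul_le_mul_of_nonneg_left h2 (sq_nonneg C)
    nlinarith
  obtain ⟨f, hf⟩ : ∃ f, f = u₀ + a * u₁ := ⟨_, rfl⟩
  obtain ⟨g, hg⟩ : ∃ g, g = b * u₁ := ⟨_, rfl⟩
  rw [← hf, ← hg]
  rw [← hg] at hu1
  have hu0 : u₀ ^ 2 ≤ 2 * f ^ 2 + 2 * (D ^ 2 * g ^ 2) := by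
    have e : u₀ = f - a * u₁ := by rw [hf]; ring
    have h1 : (a * u₁) ^ 2 ≤ D * (D * g ^ 2) := by
      rw [mul_pow]; gcongr
    rw [e]; nlinarith [sq_nonneg (f + a * u₁)]
  have h4 : (2 * e₁ ^ 2 + e₂ ^ 2) * u₁ ^ 2 ≤ D * (D * g ^ 2) := by gcongr
  have h5 : E ^ 2 ≤ 3 * C ^ 2 * (U ^ 2 + (2 * f ^ 2 + 2 * (D ^ 2 * g ^ 2)) + D * g ^ 2) := by
    refine hE2.trans ?_
    gcongr
  have h6 : (E + e₁ * u₁) ^ 2 ≤ 2 * E ^ 2 + 2 * e₁ ^ 2 * u₁ ^ 2 := by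
    nlinarith [sq_nonneg (E - e₁ * u₁)]
  have h7 : U ^ 2 + (2 * f ^ 2 + 2 * (D ^ 2 * g ^ 2)) + D * g ^ 2
      ≤ (3 + 2 * D ^ 2 + D) * (U ^ 2 + f ^ 2 + g ^ 2) := by
    have : 0 ≤ D * U ^ 2 := by positivity
    have : 0 ≤ D * f ^ 2 := by positivity
    have : 0 ≤ D ^ 2 * U ^ 2 := by positivity
    have : 0 ≤ D ^ 2 * f ^ 2 := by positivity
    linarith [sq_nonneg U, sq_nonneg f, sq_nonneg g]
  have h8 : 6 * C ^ 2 * (U ^ 2 + (2 * f ^ 2 + 2 * (D ^ 2 * g ^ 2)) + D * g ^ 2)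
      ≤ 6 * C ^ 2 * ((3 + 2 * D ^ 2 + D) * (U ^ 2 + f ^ 2 + g ^ 2)) := by gcongr
  have : 0 ≤ D ^ 2 * U ^ 2 := by positivity
  have : 0 ≤ D ^ 2 * f ^ 2 := by positivity
  linarith [sq_nonneg U]

/-- If `|∂₀²u + 2a ∂₀∂₁u + (a² + b²)∂₁²u| ≤ C (|u| + |du|)`, then the pair `v = (u, P̄u)` satisfies
the differential inequality `|Pv|² ≤ K |v|²`. -/
lemma exists_bound_beltrami {s : Set (EuclideanSpace ℝ (Fin 2))} (hs : IsCompact s)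
    (ha : ContDiff ℝ ∞ a) (hb : ContDiff ℝ ∞ b) (hu : ContDiff ℝ ∞ u) (hb0 : ∀ y, 0 < b y)
    {C : ℝ} (hC : ∀ y ∈ s, |ellipticOp a b u y|
      ≤ C * (|u y| + |partialDeriv 0 u y| + |partialDeriv 1 u y|)) :
    ∃ K : ℝ, 0 ≤ K ∧ ∀ y ∈ s,
      beltramiRe a b u (fun _ ↦ 0) y ^ 2 + beltramiIm a b u (fun _ ↦ 0) y ^ 2
        + (beltramiRe a b (fun y ↦ partialDeriv 0 u y + a y * partialDeriv 1 u y)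
            (fun y ↦ -(b y * partialDeriv 1 u y)) y ^ 2
          + beltramiIm a b (fun y ↦ partialDeriv 0 u y + a y * partialDeriv 1 u y)
            (fun y ↦ -(b y * partialDeriv 1 u y)) y ^ 2)
      ≤ K * (u y ^ 2 + 0 ^ 2 + ((partialDeriv 0 u y + a y * partialDeriv 1 u y) ^ 2
          + (-(b y * partialDeriv 1 u y)) ^ 2)) := by
  have ca := ha.continuous
  have cb := hb.continuous
  have ca' : ∀ i, Continuous (partialDeriv i a) := fun i ↦ (ha.partialDeriv i).continuous
  have cb' : ∀ i, Continuous (partialDeriv i b) := fun i ↦ (hb.partialDeriv i).continuous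
  have hbne : ∀ y, b y ^ 2 ≠ 0 := fun y ↦ (pow_pos (hb0 y) 2).ne'
  set e₁ : EuclideanSpace ℝ (Fin 2) → ℝ := fun y ↦ partialDeriv 0 a y + a y * partialDeriv 1 a y
    + b y * partialDeriv 1 b y with he₁
  set e₂ : EuclideanSpace ℝ (Fin 2) → ℝ := fun y ↦ b y * partialDeriv 1 a y - partialDeriv 0 b y
    - a y * partialDeriv 1 b y with he₂
  have := ca' 0; have := ca' 1; have := cb' 0; have := cb' 1
  have ce₁ : Continuous e₁ := by fun_prop
  have ce₂ : Continuous e₂ := by fun_prop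
  obtain ⟨D, hD⟩ := hs.exists_bound_of_continuousOn
    (f := fun y ↦ 2 * e₁ y ^ 2 + e₂ y ^ 2 + a y ^ 2 + 1 / b y ^ 2)
    (by fun_prop (disch := assumption) : Continuous _).continuousOn
  refine ⟨1 + 6 * C ^ 2 * (3 + 2 * D ^ 2 + |D|) + D ^ 2, by positivity, fun y hy ↦ ?_⟩
  rw [beltramiRe_conj_beltrami ha hb hu, beltramiIm_conj_beltrami ha hb hu]
  have hCy := hC y hy
  have hDy := (le_abs_self _).trans (hD y hy)
  simp only [beltramiRe, beltramiIm, partialDeriv_const]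
  change _ + ((_ + e₁ y * _) ^ 2 + (e₂ y * _) ^ 2) ≤ _
  have hby := hb0 y
  have hbinv : 0 < 1 / b y ^ 2 := by positivity
  have hb2 : 1 ≤ D * b y ^ 2 := by
    rw [← div_le_iff₀ (by positivity)]
    nlinarith [sq_nonneg (e₁ y), sq_nonneg (e₂ y), sq_nonneg (a y)]
  have ha2 : a y ^ 2 ≤ D := by nlinarith [sq_nonneg (e₁ y), sq_nonneg (e₂ y)]
  have he : 2 * e₁ y ^ 2 + e₂ y ^ 2 ≤ D := by nlinarith [sq_nonneg (a y)]
  have hD0 : 0 < D := by nlinarith [sq_nonneg (e₁ y), sq_nonneg (e₂ y), sq_nonneg (a y)]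
  rw [abs_of_pos hD0]
  refine le_trans (le_of_eq ?_) (beltrami_bound_aux hCy hD0 hb2 ha2 he)
  ring

/-- Unique continuation from a ball to a concentric ball: a solution of the differential inequality
`|∂₀²u + 2a ∂₀∂₁u + (a² + b²)∂₁²u| ≤ C (|u| + |du|)` that vanishes near the centre `z` vanishes on
the whole ball. The Carleman weight is `e^{-s|y - z|²}`, whose critical point `z` is harmless
because `u` vanishes there. -/
theorem eq_zero_of_elliptic (ha : ContDiff ℝ ∞ a) (hb : ContDiff ℝ ∞ b) (hu : ContDiff ℝ ∞ u)
    (hb0 : ∀ y, 0 < b y) {z : EuclideanSpace ℝ (Fin 2)} {ε R C : ℝ} (hε : 0 < ε)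
    (hC : ∀ y ∈ Metric.closedBall z R, |ellipticOp a b u y|
      ≤ C * (|u y| + |partialDeriv 0 u y| + |partialDeriv 1 u y|))
    (h0 : ∀ y ∈ Metric.ball z ε, u y = 0) : ∀ y ∈ Metric.ball z R, u y = 0 := by
  -- it suffices to treat balls of smaller radius `r`
  suffices H : ∀ r, 0 < r → r < R → ∀ y ∈ Metric.ball z r, u y = 0 by
    intro y hy
    rw [Metric.mem_ball] at hy
    obtain ⟨r, hr1, hr2⟩ := exists_between hy
    exact H r (dist_nonneg.trans_lt hr1) hr2 y hr1
  intro r hr0 hrR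
  set η : ContDiffBump z := ⟨r, R, hr0, hrR⟩ with hη
  have hηC : ContDiff ℝ ∞ η := η.contDiff
  set f : EuclideanSpace ℝ (Fin 2) → ℝ := fun y ↦ partialDeriv 0 u y + a y * partialDeriv 1 u y
    with hf
  set g : EuclideanSpace ℝ (Fin 2) → ℝ := fun y ↦ -(b y * partialDeriv 1 u y) with hg
  have hfC : ContDiff ℝ ∞ f := (hu.partialDeriv 0).add (ha.mul (hu.partialDeriv 1))
  have hgC : ContDiff ℝ ∞ g := (hb.mul (hu.partialDeriv 1)).neg
  set A : Set (EuclideanSpace ℝ (Fin 2)) := Metric.closedBall z R \ Metric.ball z ε with hA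
  have hAc : IsCompact A := (isCompact_closedBall z R).diff Metric.isOpen_ball
  set ρ : EuclideanSpace ℝ (Fin 2) → ℝ := fun y ↦ ‖y - z‖ ^ 2 with hρ
  have hρC : ContDiff ℝ ∞ ρ := (contDiff_id.sub contDiff_const).norm_sq ℝ
  have hρd : ∀ i y, partialDeriv i ρ y = 2 * (y i - z i) := by
    intro i y
    simp only [partialDeriv, hρ]
    have h := ((hasFDerivAt_id (𝕜 := ℝ) y).sub_const z).norm_sq
    simp only [id] at h
    rw [h.fderiv]
    simp [coordVec, PiLp.inner_apply]
  have hρA : ∀ y ∈ A, partialDeriv 0 ρ y ≠ 0 ∨ partialDeriv 1 ρ y ≠ 0 := by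
    intro y hy
    by_contra! hcon
    rw [hρd, hρd] at hcon
    apply hy.2
    have : y = z := by
      ext i
      fin_cases i
      · simpa [sub_eq_zero] using hcon.1
      · simpa [sub_eq_zero] using hcon.2
    rw [this]; exact Metric.mem_ball_self hε
  obtain ⟨s, hs, c, hc, φ, hφ, hφA⟩ := exists_pseudoconvex_weight hAc ha hb hρC hb0 hρA
  have hφC : ContDiff ℝ ∞ φ := by rw [hφ]; exact (contDiff_const.mul hρC).exp
  have hbne : ∀ y, b y ≠ 0 := fun y ↦ (hb0 y).ne'
  obtain ⟨K₀, hK₀⟩ := hAc.exists_bound_of_continuousOn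
    (f := fun y ↦ 2 * (((partialDeriv 0 b y + a y * partialDeriv 1 b y) / b y) ^ 2
      + partialDeriv 1 b y ^ 2))
    (by
      have := ha.continuous; have := hb.continuous; have := (hb.partialDeriv 0).continuous
      have := (hb.partialDeriv 1).continuous
      fun_prop (disch := assumption) : Continuous _).continuousOn
  obtain ⟨K, hK0, hK⟩ := exists_bound_beltrami (isCompact_closedBall z R) ha hb hu hb0 hC
  -- supports of the truncated functions
  have hηs : HasCompactSupport η := η.hasCompactSupport
  have hη_ball : ∀ y, y ∉ Metric.closedBall z R → y ∉ tsupport η := by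
    intro y hy
    rwa [η.tsupport_eq]
  have hz0 : ∀ y ∈ Metric.ball z ε, u =ᶠ[𝓝 y] fun _ ↦ 0 := fun y hy ↦ by
    filter_upwards [Metric.isOpen_ball.mem_nhds hy] with w hw using h0 w hw
  have hd0 : ∀ i, ∀ y ∈ Metric.ball z ε, partialDeriv i u y = 0 := fun i y hy ↦ by
    rw [(partialDeriv_congr i (hz0 y hy)).eq_of_nhds, partialDeriv_const]
  have supp : ∀ {v : EuclideanSpace ℝ (Fin 2) → ℝ}, (∀ y ∈ Metric.ball z ε, v y = 0) →
      tsupport (fun y ↦ η y * v y) ⊆ A := by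
    intro v hv
    have h1 : tsupport (fun y ↦ η y * v y) ⊆ Metric.closedBall z R := by
      refine (tsupport_mul_subset_left (f := η) (g := v)).trans ?_
      rw [η.tsupport_eq]
    have h2 : tsupport (fun y ↦ η y * v y) ⊆ (Metric.ball z ε)ᶜ := by
      refine closure_minimal ?_ Metric.isOpen_ball.isClosed_compl
      intro y hy hyε
      apply hy
      simp [hv y hyε]
    exact fun y hy ↦ ⟨h1 hy, h2 hy⟩
  set f₁ : EuclideanSpace ℝ (Fin 2) → ℝ := fun y ↦ η y * u y with hf₁
  set g₁ : EuclideanSpace ℝ (Fin 2) → ℝ := fun y ↦ η y * (fun _ ↦ (0 : ℝ)) y with hg₁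
  set f₂ : EuclideanSpace ℝ (Fin 2) → ℝ := fun y ↦ η y * f y with hf₂
  set g₂ : EuclideanSpace ℝ (Fin 2) → ℝ := fun y ↦ η y * g y with hg₂
  have hf₁C : ContDiff ℝ ∞ f₁ := hηC.mul hu
  have hg₁C : ContDiff ℝ ∞ g₁ := hηC.mul contDiff_const
  have hf₂C : ContDiff ℝ ∞ f₂ := hηC.mul hfC
  have hg₂C : ContDiff ℝ ∞ g₂ := hηC.mul hgC
  have hf₁A : tsupport f₁ ⊆ A := supp h0
  have hg₁A : tsupport g₁ ⊆ A := supp fun y _ ↦ rfl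
  have hf₂A : tsupport f₂ ⊆ A := supp fun y hy ↦ by simp [hf, hd0 _ y hy]
  have hg₂A : tsupport g₂ ⊆ A := supp fun y hy ↦ by simp [hg, hd0 _ y hy]
  -- the functions `|w|²` and `|Pw|²`, where `w` is the truncation of `v = (u, P̄u)`
  set W : EuclideanSpace ℝ (Fin 2) → ℝ := fun y ↦ f₁ y ^ 2 + g₁ y ^ 2 + (f₂ y ^ 2 + g₂ y ^ 2)
    with hW
  set Q : EuclideanSpace ℝ (Fin 2) → ℝ := fun y ↦
    beltramiRe a b f₁ g₁ y ^ 2 + beltramiIm a b f₁ g₁ y ^ 2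
      + (beltramiRe a b f₂ g₂ y ^ 2 + beltramiIm a b f₂ g₂ y ^ 2) with hQ
  have cRe₁ := (ContDiff.beltramiRe ha hb hf₁C hg₁C).continuous
  have cIm₁ := (ContDiff.beltramiIm ha hb hf₁C hg₁C).continuous
  have cRe₂ := (ContDiff.beltramiRe ha hb hf₂C hg₂C).continuous
  have cIm₂ := (ContDiff.beltramiIm ha hb hf₂C hg₂C).continuous
  have cQ : Continuous Q := by fun_prop
  have cW : Continuous W := by
    have := hf₁C.continuous; have := hg₁C.continuous; have := hf₂C.continuous
    have := hg₂C.continuous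
    fun_prop
  have cφ := hφC.continuous
  obtain ⟨T, hT⟩ := (isCompact_closedBall z R).exists_bound_of_continuousOn cQ.continuousOn
  have hT0 : 0 ≤ T := (norm_nonneg _).trans (hT z (Metric.mem_closedBall_self (hr0.trans hrR).le))
  have compact_of : ∀ {v : EuclideanSpace ℝ (Fin 2) → ℝ},
      (∀ y, y ∉ Metric.closedBall z R → v y = 0) → HasCompactSupport v := fun h ↦
    HasCompactSupport.of_support_subset_isCompact (isCompact_closedBall z R)
      fun y hy ↦ by_contra fun hy' ↦ hy (h y hy')
  have hη0 : ∀ y, y ∉ Metric.closedBall z R → η y = 0 := fun y hy ↦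
    image_eq_zero_of_notMem_tsupport (hη_ball y hy)
  have d0 : ∀ {v : EuclideanSpace ℝ (Fin 2) → ℝ} (i) (y), y ∉ Metric.closedBall z R →
      tsupport v ⊆ A → partialDeriv i v y = 0 := fun i y hy hv ↦
    partialDeriv_eq_zero_of_notMem_tsupport i fun h ↦ hy (hv h).1
  have hQ0 : ∀ y, y ∉ Metric.closedBall z R → Q y = 0 := by
    intro y hy
    simp [hQ, beltramiRe, beltramiIm, d0 _ y hy hf₁A, d0 _ y hy hg₁A, d0 _ y hy hf₂A,
      d0 _ y hy hg₂A]
  have hW0 : ∀ y, y ∉ Metric.closedBall z R → W y = 0 := by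
    intro y hy
    simp [hW, hf₁, hg₁, hf₂, hg₂, hη0 y hy]
  have cs : ∀ {v : EuclideanSpace ℝ (Fin 2) → ℝ}, tsupport v ⊆ A → HasCompactSupport v :=
    fun h ↦ HasCompactSupport.of_support_subset_isCompact hAc ((subset_tsupport _).trans h)
  set φr := Real.exp (-s * r ^ 2) with hφr
  have hφ_in : ∀ y ∈ Metric.ball z r, φr ≤ φ y := by
    intro y hy
    rw [Metric.mem_ball, dist_eq_norm] at hy
    have h1 : ‖y - z‖ ^ 2 ≤ r ^ 2 := by gcongr
    simp only [hφr, hφ, hρ]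
    gcongr Real.exp ?_
    nlinarith
  have hφ_out : ∀ y, y ∉ Metric.ball z r → φ y ≤ φr := by
    intro y hy
    rw [Metric.mem_ball, dist_eq_norm, not_lt] at hy
    have h1 : r ^ 2 ≤ ‖y - z‖ ^ 2 := by gcongr
    simp only [hφr, hφ, hρ]
    gcongr Real.exp ?_
    nlinarith
  have hη1 : ∀ y ∈ Metric.ball z r, η =ᶠ[𝓝 y] fun _ ↦ 1 := fun y hy ↦ by
    filter_upwards [Metric.isOpen_ball.mem_nhds hy] with w hw
    exact η.one_of_mem_closedBall (Metric.ball_subset_closedBall hw)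
  have hcut : ∀ {v : EuclideanSpace ℝ (Fin 2) → ℝ}, ∀ y ∈ Metric.ball z r,
      (fun y ↦ η y * v y) =ᶠ[𝓝 y] v := fun y hy ↦ by
    filter_upwards [hη1 y hy] with w hw
    simp [hw]
  have hQW : ∀ y ∈ Metric.ball z r, Q y ≤ K * W y := by
    intro y hy
    have hyR : y ∈ Metric.closedBall z R :=
      Metric.ball_subset_closedBall (Metric.ball_subset_ball hrR.le hy)
    have h := hK y hyR
    have e : ∀ {v : EuclideanSpace ℝ (Fin 2) → ℝ} (i), partialDeriv i (fun y ↦ η y * v y) y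
        = partialDeriv i v y := fun i ↦ (partialDeriv_congr i (hcut y hy)).eq_of_nhds
    have e' : η y = 1 := (hη1 y hy).eq_of_nhds
    have eQ : Q y = beltramiRe a b u (fun _ ↦ 0) y ^ 2 + beltramiIm a b u (fun _ ↦ 0) y ^ 2
        + (beltramiRe a b f g y ^ 2 + beltramiIm a b f g y ^ 2) := by
      simp only [hQ, hf₁, hg₁, hf₂, hg₂, beltramiRe, beltramiIm, e]
    have eW : W y = u y ^ 2 + 0 ^ 2 + (f y ^ 2 + g y ^ 2) := by
      simp [hW, hf₁, hg₁, hf₂, hg₂, e']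
    rw [eQ, eW]
    exact h
  -- the integrated inequality
  set J := ∫ y in Metric.ball z r, u y ^ 2 with hJ
  set vol := (volume : Measure (EuclideanSpace ℝ (Fin 2))).real (Metric.closedBall z R) with hvol
  have main : ∀ lam : ℝ, 0 ≤ lam → K₀ ≤ lam * c → 2 * K ≤ lam * c →
      (lam * c - 2 * K) * J ≤ 2 * T * vol := by
    intro lam hl hl1 hl2
    have hIW : Integrable fun y ↦ Real.exp (2 * lam * φ y) * W y :=
      Continuous.integrable_of_hasCompactSupport (by fun_prop)
        (compact_of fun y hy ↦ by simp [hW0 y hy])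
    have hIQ : Integrable fun y ↦ Real.exp (2 * lam * φ y) * Q y :=
      Continuous.integrable_of_hasCompactSupport (by fun_prop)
        (compact_of fun y hy ↦ by simp [hQ0 y hy])
    have carl : lam * c * ∫ y, Real.exp (2 * lam * φ y) * W y
        ≤ 2 * ∫ y, Real.exp (2 * lam * φ y) * Q y := by
      have C1 := carleman_of_pseudoconvex ha hb hφC hb0 hf₁C hg₁C (cs hf₁A) (cs hg₁A) hf₁A hg₁A
        hl hl1 hφA fun y hy ↦ (le_abs_self _).trans (hK₀ y hy)
      have C2 := carleman_of_pseudoconvex ha hb hφC hb0 hf₂C hg₂C (cs hf₂A) (cs hg₂A) hf₂A hg₂A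
        hl hl1 hφA fun y hy ↦ (le_abs_self _).trans (hK₀ y hy)
      have i1 : Integrable fun y ↦ Real.exp (2 * lam * φ y) * (f₁ y ^ 2 + g₁ y ^ 2) := by
        have := hf₁C.continuous; have := hg₁C.continuous
        exact Continuous.integrable_of_hasCompactSupport (by fun_prop)
          (compact_of fun y hy ↦ by simp [hf₁, hg₁, hη0 y hy])
      have i2 : Integrable fun y ↦ Real.exp (2 * lam * φ y) * (f₂ y ^ 2 + g₂ y ^ 2) := by
        have := hf₂C.continuous; have := hg₂C.continuous
        exact Continuous.integrable_of_hasCompactSupport (by fun_prop)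
          (compact_of fun y hy ↦ by simp [hf₂, hg₂, hη0 y hy])
      have i3 : Integrable fun y ↦ Real.exp (2 * lam * φ y) *
          (beltramiRe a b f₁ g₁ y ^ 2 + beltramiIm a b f₁ g₁ y ^ 2) :=
        Continuous.integrable_of_hasCompactSupport (by fun_prop)
          (compact_of fun y hy ↦ by
            simp [beltramiRe, beltramiIm, d0 _ y hy hf₁A, d0 _ y hy hg₁A])
      have i4 : Integrable fun y ↦ Real.exp (2 * lam * φ y) *
          (beltramiRe a b f₂ g₂ y ^ 2 + beltramiIm a b f₂ g₂ y ^ 2) :=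
        Continuous.integrable_of_hasCompactSupport (by fun_prop)
          (compact_of fun y hy ↦ by
            simp [beltramiRe, beltramiIm, d0 _ y hy hf₂A, d0 _ y hy hg₂A])
      have e1 := integral_add i1 i2
      have e2 := integral_add i3 i4
      simp only [← mul_add] at e1 e2
      rw [e1, e2, mul_add, mul_add]
      exact add_le_add C1 C2
    have hEr : 0 < Real.exp (2 * lam * φr) := Real.exp_pos _
    have up : ∫ y, Real.exp (2 * lam * φ y) * Q y
        ≤ K * (∫ y, Real.exp (2 * lam * φ y) * W y) + T * Real.exp (2 * lam * φr) * vol := by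
      have hind : Integrable ((Metric.closedBall z R).indicator
          fun _ : EuclideanSpace ℝ (Fin 2) ↦ T * Real.exp (2 * lam * φr)) := by
        rw [integrable_indicator_iff measurableSet_closedBall]
        exact integrableOn_const (measure_closedBall_lt_top).ne
      have := integral_mono hIQ ((hIW.const_mul K).add hind) fun y ↦ by
        simp only [Pi.add_apply]
        have hW_nonneg : 0 ≤ W y := by simp only [hW]; positivity
        have hQ_nonneg : 0 ≤ Q y := by simp only [hQ]; positivity
        by_cases hyR : y ∈ Metric.closedBall z R
        · rw [Set.indicator_of_mem hyR]
          by_cases hyr : y ∈ Metric.ball z r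
          · have h1 := mul_le_mul_of_nonneg_left (hQW y hyr) (Real.exp_pos (2 * lam * φ y)).le
            have h2 : 0 ≤ T * Real.exp (2 * lam * φr) := by positivity
            linarith
          · have h1 : Q y ≤ T := (le_abs_self _).trans (hT y hyR)
            have h2 : Real.exp (2 * lam * φ y) ≤ Real.exp (2 * lam * φr) := by
              gcongr; exact hφ_out y hyr
            have h3 : Real.exp (2 * lam * φ y) * Q y ≤ Real.exp (2 * lam * φr) * T := by gcongr
            have h4 : 0 ≤ K * (Real.exp (2 * lam * φ y) * W y) := by positivity
            linarith
        · rw [Set.indicator_of_notMem hyR, hQ0 y hyR, hW0 y hyR]; simp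
      refine this.trans (le_of_eq ?_)
      simp only [Pi.add_apply]
      rw [integral_add (hIW.const_mul K) hind, integral_const_mul,
        integral_indicator measurableSet_closedBall, setIntegral_const, smul_eq_mul]
      ring
    have low : Real.exp (2 * lam * φr) * J ≤ ∫ y, Real.exp (2 * lam * φ y) * W y := by
      rw [hJ, ← integral_const_mul, ← integral_indicator measurableSet_ball]
      refine integral_mono ?_ hIW fun y ↦ ?_
      · rw [integrable_indicator_iff measurableSet_ball]
        have := hu.continuous
        refine (ContinuousOn.integrableOn_compact (isCompact_closedBall z r)
          (Continuous.continuousOn ?_)).mono_set Metric.ball_subset_closedBall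
        fun_prop
      · by_cases hyr : y ∈ Metric.ball z r
        · rw [Set.indicator_of_mem hyr]
          have e' : η y = 1 := (hη1 y hyr).eq_of_nhds
          have h1 : u y ^ 2 ≤ W y := by
            simp only [hW, hf₁, e', one_mul]
            nlinarith [sq_nonneg (g₁ y), sq_nonneg (f₂ y), sq_nonneg (g₂ y)]
          have h2 : Real.exp (2 * lam * φr) ≤ Real.exp (2 * lam * φ y) := by
            gcongr; exact hφ_in y hyr
          gcongr
        · rw [Set.indicator_of_notMem hyr]
          simp only [hW]; positivity
    have h1 : (lam * c - 2 * K) * (Real.exp (2 * lam * φr) * J)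
        ≤ (lam * c - 2 * K) * ∫ y, Real.exp (2 * lam * φ y) * W y := by
      gcongr
    have h2 : Real.exp (2 * lam * φr) * ((lam * c - 2 * K) * J)
        ≤ Real.exp (2 * lam * φr) * (2 * T * vol) := by nlinarith
    exact le_of_mul_le_mul_left h2 hEr
  have hJ0 : 0 ≤ J := setIntegral_nonneg measurableSet_ball fun y _ ↦ sq_nonneg _
  have hJz : J = 0 := by
    by_contra hne
    have hJpos : 0 < J := lt_of_le_of_ne hJ0 (Ne.symm hne)
    have hvol0 : 0 ≤ 2 * T * vol := by positivity
    have h1 : 0 ≤ 2 * T * vol / J := by positivity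
    have h2 := main ((|K₀| + 2 * K + (2 * T * vol / J + 1)) / c) (by positivity)
      (by rw [div_mul_cancel₀ _ hc.ne']; linarith [le_abs_self K₀])
      (by rw [div_mul_cancel₀ _ hc.ne']; linarith [abs_nonneg K₀])
    rw [div_mul_cancel₀ _ hc.ne'] at h2
    have h3 : (2 * T * vol / J + 1) * J ≤ 2 * T * vol := by
      nlinarith [abs_nonneg K₀, mul_nonneg (abs_nonneg K₀) hJ0]
    rw [add_mul, div_mul_cancel₀ _ hJpos.ne'] at h3
    linarith
  have hae : (fun y ↦ u y ^ 2) =ᵐ[volume.restrict (Metric.ball z r)] 0 := by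
    refine (setIntegral_eq_zero_iff_of_nonneg_ae ?_ ?_).1 hJz
    · exact Filter.Eventually.of_forall fun y ↦ sq_nonneg _
    · exact ((hu.continuous.pow 2).continuousOn.integrableOn_compact
        (isCompact_closedBall z r)).mono_set Metric.ball_subset_closedBall
  have heq := Measure.eqOn_open_of_ae_eq hae Metric.isOpen_ball (hu.continuous.pow 2).continuousOn
    continuousOn_const
  intro y hy
  simpa using heq hy

end UniqueContinuation

lemma ContDiffOn.contDiff_bump_mul {n : ℕ} {f : EuclideanSpace ℝ (Fin n) → ℝ}
    {y₀ : EuclideanSpace ℝ (Fin n)} (χ : ContDiffBump y₀) {s : Set (EuclideanSpace ℝ (Fin n))}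
    (hs : IsOpen s) (hχ : Metric.closedBall y₀ χ.rOut ⊆ s) (hf : ContDiffOn ℝ ∞ f s) :
    ContDiff ℝ ∞ fun y ↦ χ y * f y := by
  refine contDiff_iff_contDiffAt.2 fun y ↦ ?_
  by_cases hy : y ∈ tsupport fun y ↦ χ y * f y
  swap
  · exact contDiffAt_const.congr_of_eventuallyEq (notMem_tsupport_iff_eventuallyEq.1 hy)
  have hy' : y ∈ s := by
    apply hχ
    rw [← χ.tsupport_eq]
    exact tsupport_mul_subset_left (f := χ) (g := f) hy
  exact χ.contDiff.contDiffAt.mul (hf.contDiffAt (hs.mem_nhds hy'))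

/-- Unique continuation for solutions of a linear second-order elliptic equation with smooth
principal part and continuous lower order coefficients, on a ball in the plane: a solution that
vanishes on an open set having the centre in its closure vanishes near the centre. -/
theorem eventuallyEq_zero_of_elliptic {u A₀₀ A₀₁ A₁₁ c c₀ c₁ : EuclideanSpace ℝ (Fin 2) → ℝ}
    {y₀ : EuclideanSpace ℝ (Fin 2)} {r : ℝ} (hr : 0 < r)
    (hu : ContDiffOn ℝ ∞ u (Metric.ball y₀ r))
    (hA₀₀ : ContDiffOn ℝ ∞ A₀₀ (Metric.ball y₀ r)) (hA₀₁ : ContDiffOn ℝ ∞ A₀₁ (Metric.ball y₀ r))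
    (hA₁₁ : ContDiffOn ℝ ∞ A₁₁ (Metric.ball y₀ r))
    (hc : ContinuousOn c (Metric.ball y₀ r)) (hc₀ : ContinuousOn c₀ (Metric.ball y₀ r))
    (hc₁ : ContinuousOn c₁ (Metric.ball y₀ r))
    (hpos : ∀ y ∈ Metric.ball y₀ r, 0 < A₀₀ y)
    (hdet : ∀ y ∈ Metric.ball y₀ r, 0 < A₀₀ y * A₁₁ y - A₀₁ y ^ 2)
    (heq : ∀ y ∈ Metric.ball y₀ r, A₀₀ y * partialDeriv 0 (partialDeriv 0 u) y
      + 2 * A₀₁ y * partialDeriv 0 (partialDeriv 1 u) y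
      + A₁₁ y * partialDeriv 1 (partialDeriv 1 u) y
      = c y * u y + c₀ y * partialDeriv 0 u y + c₁ y * partialDeriv 1 u y)
    (hy₀ : y₀ ∈ closure (interior {y | u y = 0})) : ∀ᶠ y in 𝓝 y₀, u y = 0 := by
  obtain ⟨ρ, hρr⟩ : ∃ ρ, r = 5 * ρ := ⟨r / 5, by ring⟩
  have hρ : 0 < ρ := by linarith
  subst hρr
  obtain ⟨z, hz, hzd⟩ := Metric.mem_closure_iff.1 hy₀ ρ hρ
  obtain ⟨ε, hε, hεz⟩ := Metric.isOpen_iff.1 isOpen_interior z hz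
  set χ : ContDiffBump y₀ := ⟨3 * ρ, 4 * ρ, by linarith, by linarith⟩ with hχ
  have hsub : Metric.closedBall y₀ χ.rOut ⊆ Metric.ball y₀ (5 * ρ) :=
    Metric.closedBall_subset_ball (by simp only [hχ]; linarith)
  set a : EuclideanSpace ℝ (Fin 2) → ℝ := fun y ↦ A₀₁ y / A₀₀ y with ha
  set b : EuclideanSpace ℝ (Fin 2) → ℝ := fun y ↦ √(A₀₀ y * A₁₁ y - A₀₁ y ^ 2) / A₀₀ y with hb
  have haC : ContDiffOn ℝ ∞ a (Metric.ball y₀ (5 * ρ)) :=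
    hA₀₁.div hA₀₀ fun y hy ↦ (hpos y hy).ne'
  have hbC : ContDiffOn ℝ ∞ b (Metric.ball y₀ (5 * ρ)) :=
    (((hA₀₀.mul hA₁₁).sub (hA₀₁.pow 2)).sqrt fun y hy ↦ (hdet y hy).ne').div hA₀₀
      fun y hy ↦ (hpos y hy).ne'
  -- globally defined coefficients and unknown, unchanged near the closed ball of radius `2ρ` at `z`
  set a' : EuclideanSpace ℝ (Fin 2) → ℝ := fun y ↦ χ y * a y with ha'
  set b' : EuclideanSpace ℝ (Fin 2) → ℝ := fun y ↦ χ y * b y + (1 - χ y) with hb'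
  set u' : EuclideanSpace ℝ (Fin 2) → ℝ := fun y ↦ χ y * u y with hu'
  have ha'C : ContDiff ℝ ∞ a' := haC.contDiff_bump_mul χ Metric.isOpen_ball hsub
  have hu'C : ContDiff ℝ ∞ u' := hu.contDiff_bump_mul χ Metric.isOpen_ball hsub
  have hb'C : ContDiff ℝ ∞ b' :=
    (hbC.contDiff_bump_mul χ Metric.isOpen_ball hsub).add (contDiff_const.sub χ.contDiff)
  have hbpos : ∀ y ∈ Metric.ball y₀ (5 * ρ), 0 < b y := fun y hy ↦
    div_pos (Real.sqrt_pos.2 (hdet y hy)) (hpos y hy)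
  have hb'pos : ∀ y, 0 < b' y := by
    intro y
    simp only [hb']
    have h0 := χ.nonneg (x := y)
    have h1 := χ.le_one (x := y)
    by_cases hy : y ∈ Metric.ball y₀ (5 * ρ)
    · have := hbpos y hy
      rcases h0.eq_or_lt with h | h
      · rw [← h]; norm_num
      · have := mul_pos h this
        linarith
    · have : χ y = 0 := χ.zero_of_le_dist (by
        rw [Metric.mem_ball, not_lt] at hy
        simp only [hχ]; linarith)
      rw [this]; norm_num
  have hzball : Metric.closedBall z (2 * ρ) ⊆ Metric.ball y₀ (3 * ρ) := by
    intro y hy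
    rw [Metric.mem_closedBall] at hy
    rw [Metric.mem_ball]
    have := dist_triangle y z y₀
    rw [dist_comm z y₀] at this
    linarith
  have hχ1 : ∀ y ∈ Metric.ball y₀ (3 * ρ), χ y = 1 := fun y hy ↦
    χ.one_of_mem_closedBall (Metric.ball_subset_closedBall hy)
  have huu : ∀ y ∈ Metric.ball y₀ (3 * ρ), u' =ᶠ[𝓝 y] u := fun y hy ↦ by
    filter_upwards [Metric.isOpen_ball.mem_nhds hy] with w hw
    simp [hu', hχ1 w hw]
  have hsub3 : Metric.closedBall y₀ (3 * ρ) ⊆ Metric.ball y₀ (5 * ρ) :=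
    Metric.closedBall_subset_ball (by linarith)
  have hne : ∀ y ∈ Metric.closedBall y₀ (3 * ρ), A₀₀ y ≠ 0 := fun y hy ↦ (hpos y (hsub3 hy)).ne'
  have hbd : ∀ {k : EuclideanSpace ℝ (Fin 2) → ℝ}, ContinuousOn k (Metric.ball y₀ (5 * ρ)) →
      ∃ C, ∀ y ∈ Metric.closedBall y₀ (3 * ρ), ‖k y / A₀₀ y‖ ≤ C := fun hk ↦
    (isCompact_closedBall y₀ (3 * ρ)).exists_bound_of_continuousOn
      ((hk.mono hsub3).div (hA₀₀.continuousOn.mono hsub3) hne)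
  obtain ⟨C, hC⟩ := hbd hc
  obtain ⟨C₀, hC₀⟩ := hbd hc₀
  obtain ⟨C₁, hC₁⟩ := hbd hc₁
  have hz0 : ∀ y ∈ Metric.ball z ε, u' y = 0 := by
    intro y hy
    have : u y = 0 := (interior_subset (hεz hy) : y ∈ {y | u y = 0})
    simp [hu', this]
  have main := eq_zero_of_elliptic ha'C hb'C hu'C hb'pos (z := z) (R := 2 * ρ)
    (C := max C (max C₀ C₁)) hε (fun y hy ↦ ?_) hz0
  · have hy₀z : y₀ ∈ Metric.ball z (2 * ρ) := by
      rw [Metric.mem_ball]; linarith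
    filter_upwards [Metric.isOpen_ball.mem_nhds hy₀z] with y hy
    have h1 := main y hy
    have h2 := hχ1 y (hzball (Metric.ball_subset_closedBall hy))
    simpa [hu', h2] using h1
  · have hy3 := hzball hy
    have hy3' := Metric.ball_subset_closedBall hy3
    have hy5 := hsub3 hy3'
    have e0 := huu y hy3
    have e1 : ∀ i, partialDeriv i u' y = partialDeriv i u y := fun i ↦
      (partialDeriv_congr i e0).eq_of_nhds
    have e2 : ∀ i j, partialDeriv i (partialDeriv j u') y = partialDeriv i (partialDeriv j u) y :=
      fun i j ↦ (partialDeriv_congr i (partialDeriv_congr j e0)).eq_of_nhds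
    have h1 := hχ1 y hy3
    have hp := hpos y hy5
    have hell : ellipticOp a' b' u' y = c y / A₀₀ y * u y + c₀ y / A₀₀ y * partialDeriv 0 u y
        + c₁ y / A₀₀ y * partialDeriv 1 u y := by
      have hb2 : b' y ^ 2 = (A₀₀ y * A₁₁ y - A₀₁ y ^ 2) / A₀₀ y ^ 2 := by
        simp only [hb', hb, h1]
        rw [one_mul, sub_self, add_zero, div_pow, Real.sq_sqrt (hdet y hy5).le]
      have ha2 : a' y = A₀₁ y / A₀₀ y := by simp [ha', ha, h1]
      have h := heq y hy5
      simp only [ellipticOp, e2, hb2, ha2]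
      field_simp
      linear_combination A₀₀ y * h
    rw [hell, e1, e1, e0.eq_of_nhds]
    have k0 := hC y hy3'
    have k1 := hC₀ y hy3'
    have k2 := hC₁ y hy3'
    rw [Real.norm_eq_abs] at k0 k1 k2
    calc |c y / A₀₀ y * u y + c₀ y / A₀₀ y * partialDeriv 0 u y
          + c₁ y / A₀₀ y * partialDeriv 1 u y|
        ≤ |c y / A₀₀ y| * |u y| + |c₀ y / A₀₀ y| * |partialDeriv 0 u y|
          + |c₁ y / A₀₀ y| * |partialDeriv 1 u y| := by
          rw [← abs_mul, ← abs_mul, ← abs_mul]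
          exact (abs_add_le _ _).trans (add_le_add_left (abs_add_le _ _) _)
      _ ≤ max C (max C₀ C₁) * |u y| + max C (max C₀ C₁) * |partialDeriv 0 u y|
          + max C (max C₀ C₁) * |partialDeriv 1 u y| := by
          gcongr
          · exact k0.trans (le_max_left _ _)
          · exact k1.trans ((le_max_left _ _).trans (le_max_right _ _))
          · exact k2.trans ((le_max_right _ _).trans (le_max_right _ _))
      _ = max C (max C₀ C₁) * (|u y| + |partialDeriv 0 u y| + |partialDeriv 1 u y|) := by ring

/-! ### The Jacobi equation for the normal component of a Killing field -/

/-- The coordinate frame `∂₀, ∂₁, ∂_z` of `ℝ² × ℝ`. -/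
noncomputable def adaptedFrame (k : Fin 3) : EuclideanSpace ℝ (Fin 2) × ℝ :=
  ![(coordVec 0, 0), (coordVec 1, 0), (0, 1)] k

/-- The components of a vector of `ℝ² × ℝ` in the coordinate frame. -/
noncomputable def adaptedCoord (k : Fin 3) : EuclideanSpace ℝ (Fin 2) × ℝ →L[ℝ] ℝ :=
  ![EuclideanSpace.proj 0 ∘L ContinuousLinearMap.fst ℝ _ _,
    EuclideanSpace.proj 1 ∘L ContinuousLinearMap.fst ℝ _ _, ContinuousLinearMap.snd ℝ _ _] k

/-- The coordinate derivatives on `ℝ² × ℝ`. -/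
noncomputable def adaptedDeriv (k : Fin 3) (f : EuclideanSpace ℝ (Fin 2) × ℝ → ℝ)
    (w : EuclideanSpace ℝ (Fin 2) × ℝ) : ℝ := fderiv ℝ f w (adaptedFrame k)

lemma sum_adaptedCoord_smul (v : EuclideanSpace ℝ (Fin 2) × ℝ) :
    ∑ k, adaptedCoord k v • adaptedFrame k = v := by
  simp only [Fin.sum_univ_three, adaptedCoord, adaptedFrame, Matrix.cons_val_zero,
    Matrix.cons_val_one, Matrix.cons_val, coordVec]
  ext i
  · fin_cases i <;> simp
  · simp

section AdaptedDeriv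

variable {f g : EuclideanSpace ℝ (Fin 2) × ℝ → ℝ} {w : EuclideanSpace ℝ (Fin 2) × ℝ}
  {O : Set (EuclideanSpace ℝ (Fin 2) × ℝ)}

lemma ContDiffOn.adaptedDeriv (hO : IsOpen O) (k : Fin 3) (hf : ContDiffOn ℝ ∞ f O) :
    ContDiffOn ℝ ∞ (adaptedDeriv k f) O :=
  (hf.fderiv_of_isOpen (m := ∞) hO (by simp)).clm_apply contDiffOn_const

lemma adaptedDeriv_add (k : Fin 3) (hf : DifferentiableAt ℝ f w) (hg : DifferentiableAt ℝ g w) :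
    adaptedDeriv k (fun z ↦ f z + g z) w = adaptedDeriv k f w + adaptedDeriv k g w := by
  simp only [adaptedDeriv]
  rw [fderiv_fun_add hf hg]; rfl

lemma adaptedDeriv_mul (k : Fin 3) (hf : DifferentiableAt ℝ f w) (hg : DifferentiableAt ℝ g w) :
    adaptedDeriv k (fun z ↦ f z * g z) w
      = adaptedDeriv k f w * g w + f w * adaptedDeriv k g w := by
  simp only [adaptedDeriv]
  rw [fderiv_fun_mul hf hg]
  simp
  ring

lemma adaptedDeriv_sum {ι : Type*} {s : Finset ι} {F : ι → EuclideanSpace ℝ (Fin 2) × ℝ → ℝ}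
    (k : Fin 3) (hF : ∀ i ∈ s, DifferentiableAt ℝ (F i) w) :
    adaptedDeriv k (fun z ↦ ∑ i ∈ s, F i z) w = ∑ i ∈ s, adaptedDeriv k (F i) w := by
  simp only [adaptedDeriv]
  rw [fderiv_fun_sum hF]
  simp

lemma adaptedDeriv_comm (hO : IsOpen O) (hf : ContDiffOn ℝ ∞ f O) (hw : w ∈ O) (k l : Fin 3) :
    adaptedDeriv k (adaptedDeriv l f) w = adaptedDeriv l (adaptedDeriv k f) w := by
  have hf' := hf.contDiffAt (hO.mem_nhds hw)
  have hs : IsSymmSndFDerivAt ℝ f w := by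
    refine hf'.isSymmSndFDerivAt ?_
    simp only [minSmoothness_of_isRCLikeNormedField]
    exact WithTop.coe_le_coe.2 (le_top : (2 : ℕ∞) ≤ ⊤)
  have hd : DifferentiableAt ℝ (fderiv ℝ f) w :=
    (hf'.fderiv_right (m := 1) (by norm_cast)).differentiableAt one_ne_zero
  have key : ∀ k l : Fin 3, adaptedDeriv k (adaptedDeriv l f) w
      = fderiv ℝ (fderiv ℝ f) w (adaptedFrame k) (adaptedFrame l) := by
    intro k l
    unfold adaptedDeriv
    rw [fderiv_clm_apply hd (differentiableAt_const _)]
    simp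
  rw [key, key, hs.eq]

lemma adaptedDeriv_eq_zero (hO : IsOpen O) (hf : ∀ w ∈ O, f w = 0) (hw : w ∈ O) (k : Fin 3) :
    adaptedDeriv k f w = 0 := by
  have : f =ᶠ[𝓝 w] fun _ ↦ 0 := by
    filter_upwards [hO.mem_nhds hw] with z hz using hf z hz
  simp [adaptedDeriv, this.fderiv_eq]

lemma partialDeriv_slice (a : Fin 2) {y : EuclideanSpace ℝ (Fin 2)}
    (hf : DifferentiableAt ℝ f (y, 0)) :
    partialDeriv a (fun z ↦ f (z, 0)) y = adaptedDeriv a.castSucc f (y, 0) := by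
  have h1 : HasFDerivAt (fun z : EuclideanSpace ℝ (Fin 2) ↦ (z, (0 : ℝ)))
      (ContinuousLinearMap.inl ℝ (EuclideanSpace ℝ (Fin 2)) ℝ) y := by
    exact (ContinuousLinearMap.inl ℝ (EuclideanSpace ℝ (Fin 2)) ℝ).hasFDerivAt
  have h2 := HasFDerivAt.comp y (g := f) hf.hasFDerivAt h1
  have h3 : fderiv ℝ (fun z ↦ f (z, 0)) y = _ := h2.fderiv
  simp only [partialDeriv, adaptedDeriv, h3]
  fin_cases a <;> simp [adaptedFrame]

/-- A function constant on a piece of `z = 0` has vanishing tangential derivatives there. -/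
lemma adaptedDeriv_castSucc_eq_zero {B : Set (EuclideanSpace ℝ (Fin 2))} (hB : IsOpen B) {c : ℝ}
    (h0 : ∀ y ∈ B, f (y, 0) = c) {y : EuclideanSpace ℝ (Fin 2)} (hy : y ∈ B)
    (hf : DifferentiableAt ℝ f (y, 0)) (a : Fin 2) : adaptedDeriv a.castSucc f (y, 0) = 0 := by
  rw [← partialDeriv_slice a hf]
  have : (fun z ↦ f (z, 0)) =ᶠ[𝓝 y] fun _ ↦ c := by
    filter_upwards [hB.mem_nhds hy] with z hz using h0 z hz
  rw [(partialDeriv_congr a this).eq_of_nhds, partialDeriv_const]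

end AdaptedDeriv

/-- The elimination behind the Jacobi equation. The first five equations are the components of the
Killing equation on the surface `z = 0`, the next seven are the normal derivative of its tangential
components and the tangential derivatives of its mixed components, and the last three say that
`H = q₁₁k₀₀ - 2q₀₁k₀₁ + q₀₀k₁₁` and its derivatives vanish. Here `q` is the induced metric,
`k = ∂_z g`, `l = ∂_z² g`, `mₐ = ∂_z gₐ_z`, and the Killing field is `(t, α)` with normal derivative
`(x, ζ)`. -/
lemma jacobi_elimination
    {q₀₀ q₀₁ q₁₁ k₀₀ k₀₁ k₁₁ l₀₀ l₀₁ l₁₁ m₀ m₁ α α₀ α₁ α₀₀ α₀₁ α₁₁ t₀ t₁ x₀ x₁ ζ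
      q₀₀_0 q₀₁_0 q₁₁_0 q₀₀_1 q₀₁_1 q₁₁_1 k₀₀_0 k₀₁_0 k₁₁_0 k₀₀_1 k₀₁_1 k₁₁_1
      m₀_0 m₀_1 m₁_0 m₁_1 t₀_0 t₀_1 t₁_0 t₁_1 x₀_0 x₀_1 x₁_0 x₁_1 : ℝ}
    (hδ : q₀₀ * q₁₁ - q₀₁ ^ 2 ≠ 0)
    (T₀₀ : α * k₀₀ + t₀ * q₀₀_0 + t₁ * q₀₀_1 + 2 * (q₀₀ * t₀_0 + q₀₁ * t₁_0) = 0)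
    (T₀₁ : α * k₀₁ + t₀ * q₀₁_0 + t₁ * q₀₁_1 + (q₀₁ * t₀_0 + q₁₁ * t₁_0)
      + (q₀₀ * t₀_1 + q₀₁ * t₁_1) = 0)
    (T₁₁ : α * k₁₁ + t₀ * q₁₁_0 + t₁ * q₁₁_1 + 2 * (q₀₁ * t₀_1 + q₁₁ * t₁_1) = 0)
    (T₀z : α * m₀ + α₀ + q₀₀ * x₀ + q₀₁ * x₁ = 0)
    (T₁z : α * m₁ + α₁ + q₀₁ * x₀ + q₁₁ * x₁ = 0)
    (dT₀₀ : x₀ * q₀₀_0 + x₁ * q₀₀_1 + ζ * k₀₀ + t₀ * k₀₀_0 + t₁ * k₀₀_1 + α * l₀₀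
      + 2 * (k₀₀ * t₀_0 + k₀₁ * t₁_0 + m₀ * α₀ + q₀₀ * x₀_0 + q₀₁ * x₁_0) = 0)
    (dT₀₁ : x₀ * q₀₁_0 + x₁ * q₀₁_1 + ζ * k₀₁ + t₀ * k₀₁_0 + t₁ * k₀₁_1 + α * l₀₁
      + (k₀₁ * t₀_0 + k₁₁ * t₁_0 + m₁ * α₀ + q₀₁ * x₀_0 + q₁₁ * x₁_0)
      + (k₀₀ * t₀_1 + k₀₁ * t₁_1 + m₀ * α₁ + q₀₀ * x₀_1 + q₀₁ * x₁_1) = 0)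
    (dT₁₁ : x₀ * q₁₁_0 + x₁ * q₁₁_1 + ζ * k₁₁ + t₀ * k₁₁_0 + t₁ * k₁₁_1 + α * l₁₁
      + 2 * (k₀₁ * t₀_1 + k₁₁ * t₁_1 + m₁ * α₁ + q₀₁ * x₀_1 + q₁₁ * x₁_1) = 0)
    (dT₀z_0 : α₀ * m₀ + α * m₀_0 + α₀₀ + q₀₀_0 * x₀ + q₀₁_0 * x₁ + q₀₀ * x₀_0 + q₀₁ * x₁_0 = 0)
    (dT₀z_1 : α₁ * m₀ + α * m₀_1 + α₀₁ + q₀₀_1 * x₀ + q₀₁_1 * x₁ + q₀₀ * x₀_1 + q₀₁ * x₁_1 = 0)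
    (dT₁z_0 : α₀ * m₁ + α * m₁_0 + α₀₁ + q₀₁_0 * x₀ + q₁₁_0 * x₁ + q₀₁ * x₀_0 + q₁₁ * x₁_0 = 0)
    (dT₁z_1 : α₁ * m₁ + α * m₁_1 + α₁₁ + q₀₁_1 * x₀ + q₁₁_1 * x₁ + q₀₁ * x₀_1 + q₁₁ * x₁_1 = 0)
    (H : q₁₁ * k₀₀ - 2 * q₀₁ * k₀₁ + q₀₀ * k₁₁ = 0)
    (H_0 : q₁₁_0 * k₀₀ + q₁₁ * k₀₀_0 - 2 * (q₀₁_0 * k₀₁ + q₀₁ * k₀₁_0)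
      + (q₀₀_0 * k₁₁ + q₀₀ * k₁₁_0) = 0)
    (H_1 : q₁₁_1 * k₀₀ + q₁₁ * k₀₀_1 - 2 * (q₀₁_1 * k₀₁ + q₀₁ * k₀₁_1)
      + (q₀₀_1 * k₁₁ + q₀₀ * k₁₁_1) = 0)
    {γ₀ γ₁ : ℝ}
    (hγ₀ : γ₀ = q₁₁ * (q₀₀_0 - 2 * q₀₀_0) - 2 * q₀₁ * (q₀₁_0 - q₀₀_1 - q₀₁_0)
      + q₀₀ * (q₁₁_0 - 2 * q₀₁_1))
    (hγ₁ : γ₁ = q₁₁ * (q₀₀_1 - 2 * q₀₁_0) - 2 * q₀₁ * (q₀₁_1 - q₀₁_1 - q₁₁_0)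
      + q₀₀ * (q₁₁_1 - 2 * q₁₁_1)) :
    q₁₁ * α₀₀ + 2 * -q₀₁ * α₀₁ + q₀₀ * α₁₁
      = ((q₁₁ * (l₀₀ - 2 * m₀_0) - 2 * q₀₁ * (l₀₁ - m₀_1 - m₁_0) + q₀₀ * (l₁₁ - 2 * m₁_1)
          + 2 * (k₀₀ * k₁₁ - k₀₁ ^ 2)
          - (γ₀ * (q₁₁ * m₀ - q₀₁ * m₁) + γ₁ * (q₀₀ * m₁ - q₀₁ * m₀))
            / (q₀₀ * q₁₁ - q₀₁ ^ 2)) / 2) * α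
        + ((γ₁ * q₀₁ - γ₀ * q₁₁) / (q₀₀ * q₁₁ - q₀₁ ^ 2) / 2) * α₀
        + ((γ₀ * q₀₁ - γ₁ * q₀₀) / (q₀₀ * q₁₁ - q₀₁ ^ 2) / 2) * α₁ := by
  have hx₀ : x₀ = -(q₁₁ * (α * m₀ + α₀) - q₀₁ * (α * m₁ + α₁)) / (q₀₀ * q₁₁ - q₀₁ ^ 2) := by
    rw [eq_div_iff hδ]
    linear_combination q₁₁ * T₀z - q₀₁ * T₁z
  have hx₁ : x₁ = -(q₀₀ * (α * m₁ + α₁) - q₀₁ * (α * m₀ + α₀)) / (q₀₀ * q₁₁ - q₀₁ ^ 2) := by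
    rw [eq_div_iff hδ]
    linear_combination q₀₀ * T₁z - q₀₁ * T₀z
  have key : 2 * (q₁₁ * α₀₀ + 2 * -q₀₁ * α₀₁ + q₀₀ * α₁₁)
      = γ₀ * x₀ + γ₁ * x₁ + α * (q₁₁ * (l₀₀ - 2 * m₀_0) - 2 * q₀₁ * (l₀₁ - m₀_1 - m₁_0)
        + q₀₀ * (l₁₁ - 2 * m₁_1) + 2 * (k₀₀ * k₁₁ - k₀₁ ^ 2)) := by
    rw [hγ₀, hγ₁]
    linear_combination -q₁₁ * dT₀₀ + 2 * q₀₁ * dT₀₁ - q₀₀ * dT₁₁ + 2 * q₁₁ * dT₀z_0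
      - 2 * q₀₁ * dT₀z_1 - 2 * q₀₁ * dT₁z_0 + 2 * q₀₀ * dT₁z_1 + t₀ * H_0 + t₁ * H_1
      + (ζ + 2 * t₀_0 + 2 * t₁_1) * H - k₀₀ * T₁₁ + 2 * k₀₁ * T₀₁ - k₁₁ * T₀₀
  have e : q₁₁ * α₀₀ + 2 * -q₀₁ * α₀₁ + q₀₀ * α₁₁ = (γ₀ * x₀ + γ₁ * x₁
      + α * (q₁₁ * (l₀₀ - 2 * m₀_0) - 2 * q₀₁ * (l₀₁ - m₀_1 - m₁_0)
        + q₀₀ * (l₁₁ - 2 * m₁_1) + 2 * (k₀₀ * k₁₁ - k₀₁ ^ 2))) / 2 := by linarith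
  rw [e, hx₀, hx₁]
  field_simp
  ring

section KillingComponents

variable {g : EuclideanSpace ℝ (Fin 2) × ℝ →
    EuclideanSpace ℝ (Fin 2) × ℝ →L[ℝ] EuclideanSpace ℝ (Fin 2) × ℝ →L[ℝ] ℝ}
  {X : EuclideanSpace ℝ (Fin 2) × ℝ → EuclideanSpace ℝ (Fin 2) × ℝ}
  {O : Set (EuclideanSpace ℝ (Fin 2) × ℝ)} {B : Set (EuclideanSpace ℝ (Fin 2))}

/-- The components of a bilinear form on `ℝ² × ℝ` in the coordinate frame. -/
noncomputable def adaptedComp (g : EuclideanSpace ℝ (Fin 2) × ℝ →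
    EuclideanSpace ℝ (Fin 2) × ℝ →L[ℝ] EuclideanSpace ℝ (Fin 2) × ℝ →L[ℝ] ℝ) (i j : Fin 3)
    (w : EuclideanSpace ℝ (Fin 2) × ℝ) : ℝ := g w (adaptedFrame i) (adaptedFrame j)

lemma ContDiffOn.adaptedComp (hg : ContDiffOn ℝ ∞ g O) (i j : Fin 3) :
    ContDiffOn ℝ ∞ (adaptedComp g i j) O :=
  (hg.clm_apply contDiffOn_const).clm_apply contDiffOn_const

lemma ContDiffOn.adaptedCoord (hX : ContDiffOn ℝ ∞ X O) (k : Fin 3) :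
    ContDiffOn ℝ ∞ (fun w ↦ adaptedCoord k (X w)) O :=
  (_root_.adaptedCoord k).contDiff.comp_contDiffOn hX

/-- The Killing equation in components. -/
lemma killing_components (hO : IsOpen O) (hg : ContDiffOn ℝ ∞ g O) (hX : ContDiffOn ℝ ∞ X O)
    (hK : ∀ w ∈ O, ∀ u v, fderiv ℝ g w (X w) u v + g w (fderiv ℝ X w u) v
      + g w u (fderiv ℝ X w v) = 0) {w : EuclideanSpace ℝ (Fin 2) × ℝ} (hw : w ∈ O)
    (i j : Fin 3) :
    ∑ k, (adaptedCoord k (X w) * adaptedDeriv k (adaptedComp g i j) w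
      + adaptedComp g k j w * adaptedDeriv i (fun w ↦ adaptedCoord k (X w)) w
      + adaptedComp g i k w * adaptedDeriv j (fun w ↦ adaptedCoord k (X w)) w) = 0 := by
  have dg : DifferentiableAt ℝ g w := (hg.contDiffAt (hO.mem_nhds hw)).differentiableAt (by simp)
  have dX : DifferentiableAt ℝ X w := (hX.contDiffAt (hO.mem_nhds hw)).differentiableAt (by simp)
  have h1 : ∀ v, fderiv ℝ g w v (adaptedFrame i) (adaptedFrame j)
      = fderiv ℝ (adaptedComp g i j) w v := by
    intro v
    unfold adaptedComp
    rw [fderiv_clm_apply (dg.clm_apply (differentiableAt_const _)) (differentiableAt_const _),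
      fderiv_clm_apply dg (differentiableAt_const _)]
    simp
  have h2 : ∀ k l, adaptedDeriv l (fun w ↦ adaptedCoord k (X w)) w
      = adaptedCoord k (fderiv ℝ X w (adaptedFrame l)) := by
    intro k l
    have := ((adaptedCoord k).hasFDerivAt.comp w dX.hasFDerivAt).fderiv
    simp only [adaptedDeriv]
    rw [show (fun w ↦ adaptedCoord k (X w)) = adaptedCoord k ∘ X from rfl, this]
    rfl
  have h := hK w hw (adaptedFrame i) (adaptedFrame j)
  rw [h1, ← sum_adaptedCoord_smul (X w), ← sum_adaptedCoord_smul (fderiv ℝ X w (adaptedFrame i)),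
    ← sum_adaptedCoord_smul (fderiv ℝ X w (adaptedFrame j))] at h
  simp only [Fin.sum_univ_three, map_add, map_smul, smul_eq_mul, add_apply, smul_apply] at h
  simp only [Fin.sum_univ_three, h2]
  simp only [adaptedDeriv, adaptedComp]
  linarith

/-- The first derivatives of the Killing equation in components. -/
lemma killing_components_deriv (hO : IsOpen O) (hg : ContDiffOn ℝ ∞ g O)
    (hX : ContDiffOn ℝ ∞ X O)
    (hK : ∀ w ∈ O, ∀ u v, fderiv ℝ g w (X w) u v + g w (fderiv ℝ X w u) v
      + g w u (fderiv ℝ X w v) = 0) {w : EuclideanSpace ℝ (Fin 2) × ℝ} (hw : w ∈ O)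
    (l i j : Fin 3) :
    ∑ k, (adaptedDeriv l (fun w ↦ adaptedCoord k (X w)) w * adaptedDeriv k (adaptedComp g i j) w
      + adaptedCoord k (X w) * adaptedDeriv l (adaptedDeriv k (adaptedComp g i j)) w
      + (adaptedDeriv l (adaptedComp g k j) w * adaptedDeriv i (fun w ↦ adaptedCoord k (X w)) w
      + adaptedComp g k j w * adaptedDeriv l (adaptedDeriv i fun w ↦ adaptedCoord k (X w)) w)
      + (adaptedDeriv l (adaptedComp g i k) w * adaptedDeriv j (fun w ↦ adaptedCoord k (X w)) w
      + adaptedComp g i k w * adaptedDeriv l (adaptedDeriv j fun w ↦ adaptedCoord k (X w)) w))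
      = 0 := by
  have dif : ∀ {f : EuclideanSpace ℝ (Fin 2) × ℝ → ℝ}, ContDiffOn ℝ ∞ f O →
      DifferentiableAt ℝ f w := fun hf ↦ (hf.contDiffAt (hO.mem_nhds hw)).differentiableAt (by simp)
  have hgc := fun i j ↦ hg.adaptedComp i j
  have hXc := fun k ↦ hX.adaptedCoord k
  have h := adaptedDeriv_eq_zero hO (fun w hw ↦ killing_components hO hg hX hK hw i j) hw l
  have d1 := fun k ↦ (hXc k).mul ((hgc i j).adaptedDeriv hO k)
  have d2 := fun k ↦ (hgc k j).mul ((hXc k).adaptedDeriv hO i)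
  have d3 := fun k ↦ (hgc i k).mul ((hXc k).adaptedDeriv hO j)
  rw [adaptedDeriv_sum l fun k _ ↦ dif (((d1 k).add (d2 k)).add (d3 k))] at h
  rw [← h]
  refine Finset.sum_congr rfl fun k _ ↦ ?_
  rw [adaptedDeriv_add l (dif ((d1 k).add (d2 k))) (dif (d3 k)),
    adaptedDeriv_add l (dif (d1 k)) (dif (d2 k)),
    adaptedDeriv_mul l (dif (hXc k)) (dif ((hgc i j).adaptedDeriv hO k)),
    adaptedDeriv_mul l (dif (hgc k j)) (dif ((hXc k).adaptedDeriv hO i)),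
    adaptedDeriv_mul l (dif (hgc i k)) (dif ((hXc k).adaptedDeriv hO j))]

/-- The mean curvature of `z = 0`, for a metric `g` on `ℝ² × ℝ` with `∂_z` normal to `z = 0`, up to
the factor `2 det q`: the trace of `∂_z g_ab` with respect to `det q · q^{ab}`. -/
noncomputable def sliceMeanCurvature (g : EuclideanSpace ℝ (Fin 2) × ℝ →
    EuclideanSpace ℝ (Fin 2) × ℝ →L[ℝ] EuclideanSpace ℝ (Fin 2) × ℝ →L[ℝ] ℝ)
    (y : EuclideanSpace ℝ (Fin 2)) : ℝ :=
  adaptedComp g 1 1 (y, 0) * adaptedDeriv 2 (adaptedComp g 0 0) (y, 0)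
    - 2 * adaptedComp g 0 1 (y, 0) * adaptedDeriv 2 (adaptedComp g 0 1) (y, 0)
    + adaptedComp g 0 0 (y, 0) * adaptedDeriv 2 (adaptedComp g 1 1) (y, 0)

/-- The Jacobi equation: where `z = 0` is minimal, the normal component `α` of a Killing field
satisfies a linear second-order equation with principal part `det q · q^{ab} ∂ₐ∂_b`. -/
theorem exists_jacobi_equation (hO : IsOpen O) (hB : IsOpen B) (hBO : ∀ y ∈ B, (y, (0 : ℝ)) ∈ O)
    (hg : ContDiffOn ℝ ∞ g O) (hX : ContDiffOn ℝ ∞ X O)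
    (hsymm : ∀ w ∈ O, ∀ u v, g w u v = g w v u)
    (hK : ∀ w ∈ O, ∀ u v, fderiv ℝ g w (X w) u v + g w (fderiv ℝ X w u) v
      + g w u (fderiv ℝ X w v) = 0)
    (hnormal : ∀ y ∈ B, ∀ a : Fin 2, adaptedComp g a.castSucc 2 (y, 0) = 0)
    (hunit : ∀ y ∈ B, adaptedComp g 2 2 (y, 0) = 1)
    (hdet : ∀ y ∈ B, 0 < adaptedComp g 0 0 (y, 0) * adaptedComp g 1 1 (y, 0)
      - adaptedComp g 0 1 (y, 0) ^ 2) :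
    ∃ c c₀ c₁ : EuclideanSpace ℝ (Fin 2) → ℝ,
      ContinuousOn c B ∧ ContinuousOn c₀ B ∧ ContinuousOn c₁ B ∧
      ∀ y ∈ B, (∀ᶠ y' in 𝓝 y, sliceMeanCurvature g y' = 0) →
        adaptedComp g 1 1 (y, 0) * partialDeriv 0 (partialDeriv 0 fun y ↦ (X (y, 0)).2) y
          + 2 * -adaptedComp g 0 1 (y, 0)
            * partialDeriv 0 (partialDeriv 1 fun y ↦ (X (y, 0)).2) y
          + adaptedComp g 0 0 (y, 0) * partialDeriv 1 (partialDeriv 1 fun y ↦ (X (y, 0)).2) y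
        = c y * (X (y, 0)).2 + c₀ y * partialDeriv 0 (fun y ↦ (X (y, 0)).2) y
          + c₁ y * partialDeriv 1 (fun y ↦ (X (y, 0)).2) y := by
  have hgc := fun i j ↦ hg.adaptedComp i j
  have hXc := fun k ↦ hX.adaptedCoord k
  have slice : ∀ {f : EuclideanSpace ℝ (Fin 2) × ℝ → ℝ}, ContDiffOn ℝ ∞ f O →
      ContinuousOn (fun y ↦ f (y, 0)) B := fun hf ↦
    hf.continuousOn.comp (Continuous.continuousOn (by fun_prop)) hBO
  have sq := fun i j ↦ slice (hgc i j)
  have sdq := fun k i j ↦ slice ((hgc i j).adaptedDeriv hO k)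
  have sddq := fun l k i j ↦ slice (((hgc i j).adaptedDeriv hO k).adaptedDeriv hO l)
  -- the values along `z = 0` of the components of `g` and of their derivatives, under opaque names
  obtain ⟨q, hq⟩ : ∃ q : Fin 3 → Fin 3 → EuclideanSpace ℝ (Fin 2) → ℝ,
    q = fun i j y ↦ adaptedComp g i j (y, 0) := ⟨_, rfl⟩
  obtain ⟨dq, hdq⟩ : ∃ dq : Fin 3 → Fin 3 → Fin 3 → EuclideanSpace ℝ (Fin 2) → ℝ,
    dq = fun k i j y ↦ adaptedDeriv k (adaptedComp g i j) (y, 0) := ⟨_, rfl⟩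
  obtain ⟨ddq, hddq⟩ : ∃ ddq : Fin 3 → Fin 3 → Fin 3 → Fin 3 → EuclideanSpace ℝ (Fin 2) → ℝ,
    ddq = fun l k i j y ↦ adaptedDeriv l (adaptedDeriv k (adaptedComp g i j)) (y, 0) := ⟨_, rfl⟩
  replace sq : ∀ i j, ContinuousOn (q i j) B := by rw [hq]; exact sq
  replace sdq : ∀ k i j, ContinuousOn (dq k i j) B := by rw [hdq]; exact sdq
  replace sddq : ∀ l k i j, ContinuousOn (ddq l k i j) B := by rw [hddq]; exact sddq
  -- `γₐ = det q · q^{bc} (∂ₐ q_bc - ∂_b q_ac - ∂_c q_ab)`, a contracted Christoffel symbol of `q`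
  obtain ⟨γ₀, hγ₀⟩ : ∃ γ₀ : EuclideanSpace ℝ (Fin 2) → ℝ,
      γ₀ = fun y ↦ q 1 1 y * (dq 0 0 0 y - 2 * dq 0 0 0 y)
    - 2 * q 0 1 y * (dq 0 0 1 y - dq 1 0 0 y - dq 0 0 1 y)
    + q 0 0 y * (dq 0 1 1 y - 2 * dq 1 0 1 y) := ⟨_, rfl⟩
  obtain ⟨γ₁, hγ₁⟩ : ∃ γ₁ : EuclideanSpace ℝ (Fin 2) → ℝ,
      γ₁ = fun y ↦ q 1 1 y * (dq 1 0 0 y - 2 * dq 0 0 1 y)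
    - 2 * q 0 1 y * (dq 1 0 1 y - dq 1 0 1 y - dq 0 1 1 y)
    + q 0 0 y * (dq 1 1 1 y - 2 * dq 1 1 1 y) := ⟨_, rfl⟩
  obtain ⟨δ, hδ⟩ : ∃ δ : EuclideanSpace ℝ (Fin 2) → ℝ,
    δ = fun y ↦ q 0 0 y * q 1 1 y - q 0 1 y ^ 2 := ⟨_, rfl⟩
  have cγ₀ : ContinuousOn γ₀ B := by rw [hγ₀]; fun_prop
  have cγ₁ : ContinuousOn γ₁ B := by rw [hγ₁]; fun_prop
  have cδ : ContinuousOn δ B := by rw [hδ]; fun_prop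
  have hδ0 : ∀ y ∈ B, δ y ≠ 0 := fun y hy ↦ by
    rw [hδ, hq]; exact (hdet y hy).ne'
  refine ⟨fun y ↦ (q 1 1 y * (ddq 2 2 0 0 y - 2 * ddq 0 2 0 2 y)
      - 2 * q 0 1 y * (ddq 2 2 0 1 y - ddq 1 2 0 2 y - ddq 0 2 1 2 y)
      + q 0 0 y * (ddq 2 2 1 1 y - 2 * ddq 1 2 1 2 y)
      + 2 * (dq 2 0 0 y * dq 2 1 1 y - dq 2 0 1 y ^ 2)
      - (γ₀ y * (q 1 1 y * dq 2 0 2 y - q 0 1 y * dq 2 1 2 y)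
        + γ₁ y * (q 0 0 y * dq 2 1 2 y - q 0 1 y * dq 2 0 2 y)) / δ y) / 2,
    fun y ↦ (γ₁ y * q 0 1 y - γ₀ y * q 1 1 y) / δ y / 2,
    fun y ↦ (γ₀ y * q 0 1 y - γ₁ y * q 0 0 y) / δ y / 2,
    by fun_prop (disch := assumption), by fun_prop (disch := assumption),
    by fun_prop (disch := assumption), fun y hy hH ↦ ?_⟩
  have hw : (y, (0 : ℝ)) ∈ O := hBO y hy
  have dif : ∀ {f : EuclideanSpace ℝ (Fin 2) × ℝ → ℝ}, ContDiffOn ℝ ∞ f O →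
      ∀ y ∈ B, DifferentiableAt ℝ f (y, 0) := fun hf y hy ↦
    (hf.contDiffAt (hO.mem_nhds (hBO y hy))).differentiableAt (by simp)
  have ps : ∀ {f : EuclideanSpace ℝ (Fin 2) × ℝ → ℝ}, ContDiffOn ℝ ∞ f O → ∀ (a : Fin 2),
      ∀ y ∈ B, partialDeriv a (fun z ↦ f (z, 0)) y = adaptedDeriv a.castSucc f (y, 0) :=
    fun hf a y hy ↦ partialDeriv_slice a (dif hf y hy)
  have c0 : (0 : Fin 2).castSucc = 0 := rfl
  have c1 : (1 : Fin 2).castSucc = 1 := rfl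
  -- symmetry of the components and of their derivatives
  have sym : ∀ i j, ∀ w ∈ O, adaptedComp g i j w = adaptedComp g j i w :=
    fun i j w hw ↦ hsymm w hw _ _
  have symd : ∀ i j k, ∀ w ∈ O, adaptedDeriv k (adaptedComp g i j) w
      = adaptedDeriv k (adaptedComp g j i) w := by
    intro i j k w hw
    have : adaptedComp g i j =ᶠ[𝓝 w] adaptedComp g j i := by
      filter_upwards [hO.mem_nhds hw] with z hz using sym i j z hz
    simp only [adaptedDeriv, this.fderiv_eq]
  -- tangential derivatives of the components that are constant along `z = 0`
  have n0 : ∀ y ∈ B, adaptedComp g 0 2 (y, 0) = 0 := fun y hy ↦ hnormal y hy 0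
  have n1 : ∀ y ∈ B, adaptedComp g 1 2 (y, 0) = 0 := fun y hy ↦ hnormal y hy 1
  have tz : ∀ {f : EuclideanSpace ℝ (Fin 2) × ℝ → ℝ} {c : ℝ}, ContDiffOn ℝ ∞ f O →
      (∀ y ∈ B, f (y, 0) = c) → ∀ y ∈ B, adaptedDeriv 0 f (y, 0) = 0 ∧
        adaptedDeriv 1 f (y, 0) = 0 := fun hf h0 y hy ↦
    ⟨adaptedDeriv_castSucc_eq_zero hB h0 hy (dif hf y hy) 0,
      adaptedDeriv_castSucc_eq_zero hB h0 hy (dif hf y hy) 1⟩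
  have n0d := tz (hgc 0 2) n0
  have n1d := tz (hgc 1 2) n1
  have n2d := tz (hgc 2 2) hunit
  have n0d0 := tz ((hgc 0 2).adaptedDeriv hO 0) (fun y hy ↦ (n0d y hy).1) y hy
  have n0d1 := tz ((hgc 0 2).adaptedDeriv hO 1) (fun y hy ↦ (n0d y hy).2) y hy
  have n1d0 := tz ((hgc 1 2).adaptedDeriv hO 0) (fun y hy ↦ (n1d y hy).1) y hy
  have n1d1 := tz ((hgc 1 2).adaptedDeriv hO 1) (fun y hy ↦ (n1d y hy).2) y hy
  have m0 := n0 y hy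
  have m1 := n1 y hy
  have m2 := hunit y hy
  -- derivatives of the normal component
  have hα1 : ∀ (a : Fin 2), ∀ y ∈ B, partialDeriv a (fun y ↦ (X (y, 0)).2) y
      = adaptedDeriv a.castSucc (fun w ↦ adaptedCoord 2 (X w)) (y, 0) := fun a y hy ↦
    ps (hXc 2) a y hy
  have hα2 : ∀ a b : Fin 2, partialDeriv a (partialDeriv b fun y ↦ (X (y, 0)).2) y
      = adaptedDeriv a.castSucc (adaptedDeriv b.castSucc fun w ↦ adaptedCoord 2 (X w)) (y, 0) := by
    intro a b
    rw [← ps ((hXc 2).adaptedDeriv hO _) a y hy]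
    refine (partialDeriv_congr a ?_).eq_of_nhds
    filter_upwards [hB.mem_nhds hy] with z hz using hα1 b z hz
  -- vanishing mean curvature and its tangential derivatives
  have H0 : sliceMeanCurvature g y = 0 := hH.self_of_nhds
  have Hd : ∀ a : Fin 2,
      partialDeriv a (q 1 1) y * dq 2 0 0 y + q 1 1 y * partialDeriv a (dq 2 0 0) y
      - 2 * (partialDeriv a (q 0 1) y * dq 2 0 1 y + q 0 1 y * partialDeriv a (dq 2 0 1) y)
      + (partialDeriv a (q 0 0) y * dq 2 1 1 y + q 0 0 y * partialDeriv a (dq 2 1 1) y) = 0 := by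
    intro a
    have h1 : partialDeriv a (sliceMeanCurvature g) y = 0 := by
      have h : sliceMeanCurvature g =ᶠ[𝓝 y] fun _ ↦ 0 := hH
      rw [(partialDeriv_congr a h).eq_of_nhds, partialDeriv_const]
    have sd : ∀ {f : EuclideanSpace ℝ (Fin 2) × ℝ → ℝ}, ContDiffOn ℝ ∞ f O →
        DifferentiableAt ℝ (fun z ↦ f (z, 0)) y := fun hf ↦
      DifferentiableAt.comp y (dif hf y hy) (by fun_prop)
    have dq' : ∀ i j, DifferentiableAt ℝ (q i j) y := by
      rw [hq]; exact fun i j ↦ sd (hgc i j)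
    have ddq' : ∀ k i j, DifferentiableAt ℝ (dq k i j) y := by
      rw [hdq]; exact fun k i j ↦ sd ((hgc i j).adaptedDeriv hO k)
    have h2 : sliceMeanCurvature g = fun y ↦ q 1 1 y * dq 2 0 0 y
        + (-2) * (q 0 1 y * dq 2 0 1 y) + q 0 0 y * dq 2 1 1 y := by
      funext y; simp only [sliceMeanCurvature, hq, hdq]; ring
    rw [h2, partialDeriv_add a (((dq' 1 1).fun_mul (ddq' 2 0 0)).fun_add
        (((dq' 0 1).fun_mul (ddq' 2 0 1)).const_mul (-2))) ((dq' 0 0).fun_mul (ddq' 2 1 1)),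
      partialDeriv_add a ((dq' 1 1).fun_mul (ddq' 2 0 0))
        (((dq' 0 1).fun_mul (ddq' 2 0 1)).const_mul (-2)),
      partialDeriv_mul a (differentiableAt_const _) ((dq' 0 1).fun_mul (ddq' 2 0 1)),
      partialDeriv_mul a (dq' 0 1) (ddq' 2 0 1), partialDeriv_mul a (dq' 1 1) (ddq' 2 0 0),
      partialDeriv_mul a (dq' 0 0) (ddq' 2 1 1), partialDeriv_const] at h1
    linarith
  have Hd0 := Hd 0
  have Hd1 := Hd 1
  simp only [hq, hdq] at Hd0 Hd1
  simp only [ps (hgc _ _) _ y hy, ps ((hgc _ _).adaptedDeriv hO _) _ y hy, c0, c1] at Hd0 Hd1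
  -- the Killing equation and its derivatives at the point
  have T := killing_components hO hg hX hK hw
  have dT := killing_components_deriv hO hg hX hK hw
  have cm := fun {f : EuclideanSpace ℝ (Fin 2) × ℝ → ℝ} (hf : ContDiffOn ℝ ∞ f O) k l ↦
    adaptedDeriv_comm hO hf hw k l
  have T00 := T 0 0
  have T01 := T 0 1
  have T11 := T 1 1
  have T02 := T 0 2
  have T12 := T 1 2
  have dT00 := dT 2 0 0
  have dT01 := dT 2 0 1
  have dT11 := dT 2 1 1
  have dT02_0 := dT 0 0 2
  have dT02_1 := dT 1 0 2
  have dT12_0 := dT 0 1 2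
  have dT12_1 := dT 1 1 2
  simp only [Fin.sum_univ_three, sym 1 0 _ hw, sym 2 0 _ hw, sym 2 1 _ hw, symd 1 0 _ _ hw,
    symd 2 0 _ _ hw, symd 2 1 _ _ hw, m0, m1, m2, (n0d y hy).1, (n0d y hy).2, (n1d y hy).1,
    (n1d y hy).2, (n2d y hy).1, (n2d y hy).2, n0d0.1, n0d0.2, n0d1.1, n0d1.2, n1d0.1, n1d0.2,
    n1d1.1, n1d1.2, cm (hgc _ _) 2 0, cm (hgc _ _) 2 1, cm (hXc _) 2 0, cm (hXc _) 2 1]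
    at T00 T01 T11 T02 T12 dT00 dT01 dT11 dT02_0 dT02_1 dT12_0 dT12_1
  have hX10 := cm (hXc 2) 1 0
  have hc2 : adaptedCoord 2 (X (y, 0)) = (X (y, 0)).2 := rfl
  rw [hc2] at T00 T01 T11 T02 T12 dT00 dT01 dT11 dT02_0 dT02_1 dT12_0 dT12_1
  simp only [hα1 _ y hy, hα2, c0, c1]
  have hδy := hδ0 y hy
  simp only [hδ, hγ₀, hγ₁, hq, hdq, hddq] at hδy ⊢
  refine jacobi_elimination hδy
    (t₀ := adaptedCoord 0 (X (y, 0))) (t₁ := adaptedCoord 1 (X (y, 0)))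
    (x₀ := adaptedDeriv 2 (fun w ↦ adaptedCoord 0 (X w)) (y, 0))
    (x₁ := adaptedDeriv 2 (fun w ↦ adaptedCoord 1 (X w)) (y, 0))
    (ζ := adaptedDeriv 2 (fun w ↦ adaptedCoord 2 (X w)) (y, 0))
    (t₀_0 := adaptedDeriv 0 (fun w ↦ adaptedCoord 0 (X w)) (y, 0))
    (t₀_1 := adaptedDeriv 1 (fun w ↦ adaptedCoord 0 (X w)) (y, 0))
    (t₁_0 := adaptedDeriv 0 (fun w ↦ adaptedCoord 1 (X w)) (y, 0))
    (t₁_1 := adaptedDeriv 1 (fun w ↦ adaptedCoord 1 (X w)) (y, 0))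
    (x₀_0 := adaptedDeriv 0 (adaptedDeriv 2 fun w ↦ adaptedCoord 0 (X w)) (y, 0))
    (x₀_1 := adaptedDeriv 1 (adaptedDeriv 2 fun w ↦ adaptedCoord 0 (X w)) (y, 0))
    (x₁_0 := adaptedDeriv 0 (adaptedDeriv 2 fun w ↦ adaptedCoord 1 (X w)) (y, 0))
    (x₁_1 := adaptedDeriv 1 (adaptedDeriv 2 fun w ↦ adaptedCoord 1 (X w)) (y, 0))
    (k₀₀_0 := adaptedDeriv 0 (adaptedDeriv 2 (adaptedComp g 0 0)) (y, 0))
    (k₀₁_0 := adaptedDeriv 0 (adaptedDeriv 2 (adaptedComp g 0 1)) (y, 0))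
    (k₁₁_0 := adaptedDeriv 0 (adaptedDeriv 2 (adaptedComp g 1 1)) (y, 0))
    (k₀₀_1 := adaptedDeriv 1 (adaptedDeriv 2 (adaptedComp g 0 0)) (y, 0))
    (k₀₁_1 := adaptedDeriv 1 (adaptedDeriv 2 (adaptedComp g 0 1)) (y, 0))
    (k₁₁_1 := adaptedDeriv 1 (adaptedDeriv 2 (adaptedComp g 1 1)) (y, 0))
    (q₀₀_0 := adaptedDeriv 0 (adaptedComp g 0 0) (y, 0))
    (q₀₁_0 := adaptedDeriv 0 (adaptedComp g 0 1) (y, 0))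
    (q₁₁_0 := adaptedDeriv 0 (adaptedComp g 1 1) (y, 0))
    (q₀₀_1 := adaptedDeriv 1 (adaptedComp g 0 0) (y, 0))
    (q₀₁_1 := adaptedDeriv 1 (adaptedComp g 0 1) (y, 0))
    (q₁₁_1 := adaptedDeriv 1 (adaptedComp g 1 1) (y, 0))
    ?_ ?_ ?_ ?_ ?_ ?_ ?_ ?_ ?_ ?_ ?_ ?_ H0 Hd0 Hd1 rfl rfl
  · linear_combination T00
  · linear_combination T01
  · linear_combination T11
  · linear_combination T02
  · linear_combination T12
  · linear_combination dT00
  · linear_combination dT01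
  · linear_combination dT11
  · linear_combination dT02_0
  · linear_combination dT02_1 - hX10
  · linear_combination dT12_0
  · linear_combination dT12_1

end KillingComponents

/-- Unique continuation for the normal component `α` of a Killing field along the surface `z = 0`
of mean curvature `H`, under the condition `α H = 0`: the Jacobi equation holds where `α ≠ 0`, and
trivially where `α` vanishes identically, hence everywhere by continuity. -/
theorem eventually_killing_normal_eq_zero
    {g : EuclideanSpace ℝ (Fin 2) × ℝ →
      EuclideanSpace ℝ (Fin 2) × ℝ →L[ℝ] EuclideanSpace ℝ (Fin 2) × ℝ →L[ℝ] ℝ}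
    {X : EuclideanSpace ℝ (Fin 2) × ℝ → EuclideanSpace ℝ (Fin 2) × ℝ}
    {O : Set (EuclideanSpace ℝ (Fin 2) × ℝ)} {y₀ : EuclideanSpace ℝ (Fin 2)} {r : ℝ}
    (hO : IsOpen O) (hr : 0 < r) (hBO : ∀ y ∈ Metric.ball y₀ r, (y, (0 : ℝ)) ∈ O)
    (hg : ContDiffOn ℝ ∞ g O) (hX : ContDiffOn ℝ ∞ X O)
    (hsymm : ∀ w ∈ O, ∀ u v, g w u v = g w v u)
    (hK : ∀ w ∈ O, ∀ u v, fderiv ℝ g w (X w) u v + g w (fderiv ℝ X w u) v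
      + g w u (fderiv ℝ X w v) = 0)
    (hnormal : ∀ y ∈ Metric.ball y₀ r, ∀ a : Fin 2, adaptedComp g a.castSucc 2 (y, 0) = 0)
    (hunit : ∀ y ∈ Metric.ball y₀ r, adaptedComp g 2 2 (y, 0) = 1)
    (hpos : ∀ y ∈ Metric.ball y₀ r, 0 < adaptedComp g 1 1 (y, 0))
    (hdet : ∀ y ∈ Metric.ball y₀ r, 0 < adaptedComp g 0 0 (y, 0) * adaptedComp g 1 1 (y, 0)
      - adaptedComp g 0 1 (y, 0) ^ 2)
    (hH : ∀ y ∈ Metric.ball y₀ r, (X (y, 0)).2 ≠ 0 → sliceMeanCurvature g y = 0)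
    (hy₀ : y₀ ∈ closure (interior {y | (X (y, 0)).2 = 0})) :
    ∀ᶠ y in 𝓝 y₀, (X (y, 0)).2 = 0 := by
  set B := Metric.ball y₀ r with hBdef
  have hB : IsOpen B := Metric.isOpen_ball
  obtain ⟨c, c₀, c₁, hc, hc₀, hc₁, hJ⟩ :=
    exists_jacobi_equation hO hB hBO hg hX hsymm hK hnormal hunit hdet
  set α : EuclideanSpace ℝ (Fin 2) → ℝ := fun y ↦ (X (y, 0)).2 with hα
  have slice : ∀ {f : EuclideanSpace ℝ (Fin 2) × ℝ → ℝ}, ContDiffOn ℝ ∞ f O →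
      ContDiffOn ℝ ∞ (fun y ↦ f (y, 0)) B := fun hf ↦
    hf.comp (ContDiff.contDiffOn (by fun_prop)) hBO
  have hαC : ContDiffOn ℝ ∞ α B := slice (hX.adaptedCoord 2)
  have h00 := slice (hg.adaptedComp 0 0)
  have h01 := slice (hg.adaptedComp 0 1)
  have h11 := slice (hg.adaptedComp 1 1)
  have d0 := hαC.partialDeriv hB 0
  have d1 := hαC.partialDeriv hB 1
  have d00 := d0.partialDeriv hB 0
  have d01 := d1.partialDeriv hB 0
  have d11 := d1.partialDeriv hB 1
  refine eventuallyEq_zero_of_elliptic (u := α) hr hαC h11 h01.neg h00 hc hc₀ hc₁ hpos ?_ ?_ hy₀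
  · intro y hy
    have := hdet y hy
    simp only [neg_sq]
    linarith
  intro y hy
  by_cases hy0 : α y = 0
  swap
  · -- where `α ≠ 0` the surface is minimal
    apply hJ y hy
    filter_upwards [(hαC.continuousOn.continuousAt (hB.mem_nhds hy)).eventually_ne hy0,
      hB.mem_nhds hy] with z hz hzB using hH z hzB hz
  by_cases hyi : y ∈ interior {y | α y = 0}
  · have e : α =ᶠ[𝓝 y] fun _ ↦ 0 := by
      filter_upwards [isOpen_interior.mem_nhds hyi] with z hz using
          (interior_subset hz : z ∈ {y | α y = 0})
    have e1 : ∀ i, partialDeriv i α =ᶠ[𝓝 y] fun _ ↦ 0 := fun i ↦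
      (partialDeriv_congr i e).trans (Filter.Eventually.of_forall fun z ↦ partialDeriv_const i 0)
    have e2 : ∀ i j, partialDeriv i (partialDeriv j α) y = 0 := fun i j ↦ by
      rw [(partialDeriv_congr i (e1 j)).eq_of_nhds, partialDeriv_const]
    rw [e2, e2, e2, (e1 0).eq_of_nhds, (e1 1).eq_of_nhds, hy0]
    ring
  · -- `y` is a limit of points where `α ≠ 0`
    have hE : ContinuousAt (fun y ↦ adaptedComp g 1 1 (y, 0) * partialDeriv 0 (partialDeriv 0 α) y
        + 2 * -adaptedComp g 0 1 (y, 0) * partialDeriv 0 (partialDeriv 1 α) y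
        + adaptedComp g 0 0 (y, 0) * partialDeriv 1 (partialDeriv 1 α) y
        - (c y * α y + c₀ y * partialDeriv 0 α y + c₁ y * partialDeriv 1 α y)) y := by
      have := h00.continuousOn; have := h01.continuousOn; have := h11.continuousOn
      have := d0.continuousOn; have := d1.continuousOn; have := d00.continuousOn
      have := d01.continuousOn; have := d11.continuousOn; have := hαC.continuousOn
      refine ContinuousOn.continuousAt (s := B) ?_ (hB.mem_nhds hy)
      fun_prop
    by_contra hne
    have hfreq : ∃ᶠ z in 𝓝 y, α z ≠ 0 := by
      rw [mem_interior_iff_mem_nhds] at hyi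
      exact fun h ↦ hyi (by filter_upwards [h] with z hz using not_not.1 hz)
    obtain ⟨z, hz, hzE, hzB⟩ := (hfreq.and_eventually
      ((hE.eventually_ne (sub_ne_zero.2 hne)).and (hB.mem_nhds hy))).exists
    apply hzE
    rw [sub_eq_zero]
    apply hJ z hzB
    filter_upwards [(hαC.continuousOn.continuousAt (hB.mem_nhds hzB)).eventually_ne hz,
      hB.mem_nhds hzB] with x hx hxB using hH x hxB hx

/-! ### Pulling back metrics by smooth maps -/

section Naturality

variable {W E : Type*} [NormedAddCommGroup W] [NormedSpace ℝ W] [NormedAddCommGroup E]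
  [NormedSpace ℝ E]

/-- The pullback `Ψ^* G` of a field of bilinear forms. -/
noncomputable def pullbackField (G : E → E →L[ℝ] E →L[ℝ] ℝ) (Ψ : W → E) (w : W) :
    W →L[ℝ] W →L[ℝ] ℝ :=
  pullbackForm (G (Ψ w)) (fderiv ℝ Ψ w)

lemma pullbackField_apply (G : E → E →L[ℝ] E →L[ℝ] ℝ) (Ψ : W → E) (w u v : W) :
    pullbackField G Ψ w u v = G (Ψ w) (fderiv ℝ Ψ w u) (fderiv ℝ Ψ w v) := rfl

/-- The Christoffel symbols of the first kind
`Γ_{uva} = ½ (∂ᵤ G_{va} + ∂ᵥ G_{ua} - ∂ₐ G_{uv})`. -/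
noncomputable def christoffelLower (G : E → E →L[ℝ] E →L[ℝ] ℝ) (y u v a : E) : ℝ :=
  (fderiv ℝ G y u v a + fderiv ℝ G y v u a - fderiv ℝ G y a u v) / 2

set_option synthInstance.maxHeartbeats 200000

variable {G : E → E →L[ℝ] E →L[ℝ] ℝ} {Ψ : W → E} {w : W}

lemma ContDiffOn.pullbackField [FiniteDimensional ℝ W] {O : Set W} {U : Set E} (hO : IsOpen O)
    (hG : ContDiffOn ℝ ∞ G U) (hΨ : ContDiffOn ℝ ∞ Ψ O) (hOU : Set.MapsTo Ψ O U) :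
    ContDiffOn ℝ ∞ (pullbackField G Ψ) O := by
  have hd := hΨ.fderiv_of_isOpen (m := ∞) hO (by simp)
  refine contDiffOn_clm_apply.2 fun u ↦ contDiffOn_clm_apply.2 fun v ↦ ?_
  simp only [pullbackField_apply]
  exact ((hG.comp hΨ hOU).clm_apply (hd.clm_apply contDiffOn_const)).clm_apply
    (hd.clm_apply contDiffOn_const)

lemma hasFDerivAt_comp_field {F : Type*} [NormedAddCommGroup F] [NormedSpace ℝ F] {G : E → F}
    (hG : DifferentiableAt ℝ G (Ψ w)) (hΨ : DifferentiableAt ℝ Ψ w) :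
    HasFDerivAt (fun w ↦ G (Ψ w)) ((fderiv ℝ G (Ψ w)).comp (fderiv ℝ Ψ w)) w :=
  hG.hasFDerivAt.comp w hΨ.hasFDerivAt

lemma differentiableAt_pullbackField (hG : DifferentiableAt ℝ G (Ψ w)) (hΨ : ContDiffAt ℝ 2 Ψ w) :
    DifferentiableAt ℝ (pullbackField G Ψ) w := by
  have hd : DifferentiableAt ℝ (fderiv ℝ Ψ) w :=
    (hΨ.fderiv_right (m := 1) (by norm_num)).differentiableAt one_ne_zero
  have h1 : DifferentiableAt ℝ (fun w ↦ G (Ψ w)) w :=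
    (hasFDerivAt_comp_field (G := G) hG (hΨ.differentiableAt two_ne_zero)).differentiableAt
  have h2 : DifferentiableAt ℝ
      (fun w ↦ (ContinuousLinearMap.compL ℝ W E ℝ).flip (fderiv ℝ Ψ w)) w :=
    (hasFDerivAt_comp_field (G := (ContinuousLinearMap.compL ℝ W E ℝ).flip)
      (ContinuousLinearMap.differentiableAt _) hd).differentiableAt
  exact h2.clm_comp (h1.clm_comp hd)

/-- The derivative of a pulled back field of bilinear forms. -/
lemma fderiv_pullbackField (hG : DifferentiableAt ℝ G (Ψ w)) (hΨ : ContDiffAt ℝ 2 Ψ w)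
    (a u v : W) : fderiv ℝ (pullbackField G Ψ) w a u v
      = fderiv ℝ G (Ψ w) (fderiv ℝ Ψ w a) (fderiv ℝ Ψ w u) (fderiv ℝ Ψ w v)
        + G (Ψ w) (fderiv ℝ (fderiv ℝ Ψ) w a u) (fderiv ℝ Ψ w v)
        + G (Ψ w) (fderiv ℝ Ψ w u) (fderiv ℝ (fderiv ℝ Ψ) w a v) := by
  have hd : DifferentiableAt ℝ (fderiv ℝ Ψ) w :=
    (hΨ.fderiv_right (m := 1) (by norm_num)).differentiableAt one_ne_zero
  have h0 := differentiableAt_pullbackField hG hΨ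
  have e1 : fderiv ℝ (pullbackField G Ψ) w a u v
      = fderiv ℝ (fun w ↦ pullbackField G Ψ w u v) w a := by
    rw [fderiv_clm_apply (h0.clm_apply (differentiableAt_const _)) (differentiableAt_const _),
      fderiv_clm_apply h0 (differentiableAt_const _)]
    simp
  have hu : ∀ u, HasFDerivAt (fun w ↦ fderiv ℝ Ψ w u) ((fderiv ℝ (fderiv ℝ Ψ) w).flip u) w := by
    intro u
    have := hd.hasFDerivAt.clm_apply (hasFDerivAt_const u w)
    simpa using this
  have hGΨ := hasFDerivAt_comp_field (G := G) hG (hΨ.differentiableAt two_ne_zero)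
  have h := (hGΨ.clm_apply (hu u)).clm_apply (hu v)
  rw [e1]
  simp only [pullbackField_apply]
  rw [h.fderiv]
  simp
  ring

/-- Naturality of the Lie derivative: if `Ψ` maps the vector field `X` to `Y`, then
`𝓛_X (Ψ^* G) = Ψ^* (𝓛_Y G)`. -/
lemma lie_pullbackField {X : W → W} {Y : E → E} (hG : DifferentiableAt ℝ G (Ψ w))
    (hΨ : ContDiffAt ℝ 2 Ψ w) (hX : DifferentiableAt ℝ X w) (hY : DifferentiableAt ℝ Y (Ψ w))
    (hXY : ∀ᶠ w' in 𝓝 w, fderiv ℝ Ψ w' (X w') = Y (Ψ w')) (u v : W) :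
    fderiv ℝ (pullbackField G Ψ) w (X w) u v + pullbackField G Ψ w (fderiv ℝ X w u) v
      + pullbackField G Ψ w u (fderiv ℝ X w v)
    = fderiv ℝ G (Ψ w) (Y (Ψ w)) (fderiv ℝ Ψ w u) (fderiv ℝ Ψ w v)
      + G (Ψ w) (fderiv ℝ Y (Ψ w) (fderiv ℝ Ψ w u)) (fderiv ℝ Ψ w v)
      + G (Ψ w) (fderiv ℝ Ψ w u) (fderiv ℝ Y (Ψ w) (fderiv ℝ Ψ w v)) := by
  have hd : DifferentiableAt ℝ (fderiv ℝ Ψ) w :=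
    (hΨ.fderiv_right (m := 1) (by norm_num)).differentiableAt one_ne_zero
  have hs : ∀ a b, fderiv ℝ (fderiv ℝ Ψ) w a b = fderiv ℝ (fderiv ℝ Ψ) w b a :=
    (hΨ.isSymmSndFDerivAt (by simp)).eq
  have e0 := hXY.self_of_nhds
  have e1 : ∀ a, fderiv ℝ Y (Ψ w) (fderiv ℝ Ψ w a)
      = fderiv ℝ (fderiv ℝ Ψ) w (X w) a + fderiv ℝ Ψ w (fderiv ℝ X w a) := by
    intro a
    have h1 := (hd.hasFDerivAt.clm_apply hX.hasFDerivAt).fderiv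
    have h2 := (hY.hasFDerivAt.comp w (hΨ.differentiableAt two_ne_zero).hasFDerivAt).fderiv
    have h3 : fderiv ℝ (fun w' ↦ fderiv ℝ Ψ w' (X w')) w = fderiv ℝ (Y ∘ Ψ) w :=
      Filter.EventuallyEq.fderiv_eq hXY
    rw [h1, h2] at h3
    have h4 := DFunLike.congr_fun h3 a
    simp only [add_apply, ContinuousLinearMap.comp_apply, ContinuousLinearMap.flip_apply] at h4
    rw [← h4, hs (X w) a, add_comm]
  rw [fderiv_pullbackField hG hΨ, e1, e1, ← e0]
  simp only [pullbackField_apply, map_add, add_apply]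
  ring

/-- The transformation law of the Christoffel symbols of the first kind. -/
lemma christoffelLower_pullbackField (hG : DifferentiableAt ℝ G (Ψ w)) (hΨ : ContDiffAt ℝ 2 Ψ w)
    (hsymm : ∀ a b, G (Ψ w) a b = G (Ψ w) b a) (u v a : W) :
    christoffelLower (pullbackField G Ψ) w u v a
      = christoffelLower G (Ψ w) (fderiv ℝ Ψ w u) (fderiv ℝ Ψ w v) (fderiv ℝ Ψ w a)
        + G (Ψ w) (fderiv ℝ (fderiv ℝ Ψ) w u v) (fderiv ℝ Ψ w a) := by
  have hs : ∀ a b, fderiv ℝ (fderiv ℝ Ψ) w a b = fderiv ℝ (fderiv ℝ Ψ) w b a :=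
    (hΨ.isSymmSndFDerivAt (by simp)).eq
  simp only [christoffelLower, fderiv_pullbackField hG hΨ]
  rw [hs v u, hs a v, hs a u, hsymm (fderiv ℝ Ψ w v), hsymm (fderiv ℝ Ψ w u)]
  ring

end Naturality

/-! ### Traces and raising indices -/

section Traces

set_option synthInstance.maxHeartbeats 200000

variable {n : ℕ}

lemma sum_coordVec (v : EuclideanSpace ℝ (Fin n)) : ∑ i, v i • coordVec i = v := by
  ext j
  simp [coordVec, Finset.sum_apply, Pi.single_apply]

lemma coordVec_apply (i j : Fin n) : (coordVec i : EuclideanSpace ℝ (Fin n)) j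
    = if j = i then 1 else 0 := by
  simp [coordVec]

lemma posDef_gramMatrix {g : EuclideanSpace ℝ (Fin n) →L[ℝ] EuclideanSpace ℝ (Fin n) →L[ℝ] ℝ}
    (hsymm : ∀ u v, g u v = g v u) (hpos : ∀ u, u ≠ 0 → 0 < g u u) :
    (gramMatrix coordVec fun a b ↦ g a b).PosDef := by
  refine Matrix.PosDef.of_dotProduct_mulVec_pos ?_ fun x hx ↦ ?_
  · ext i j
    simp [gramMatrix, hsymm]
  · set v : EuclideanSpace ℝ (Fin n) := WithLp.toLp 2 x with hv
    have hv0 : v ≠ 0 := by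
      intro h
      apply hx
      funext i
      have := congrArg (fun z : EuclideanSpace ℝ (Fin n) ↦ z i) h
      simpa [hv] using this
    have h := hpos v hv0
    rw [← sum_coordVec v] at h
    simp only [map_sum, map_smul, smul_eq_mul, sum_apply, smul_apply] at h
    refine h.trans_eq ?_
    simp only [dotProduct, Matrix.mulVec, gramMatrix, Matrix.of_apply, star_trivial,
      Finset.mul_sum, hv]
    refine Finset.sum_congr rfl fun i _ ↦ Finset.sum_congr rfl fun j _ ↦ ?_
    rw [hsymm]
    ring

/-- Raising an index: the vector `Σ gᵏˡ c(eₗ) eₖ` represents the linear form `c`. -/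
lemma inner_raise {g : EuclideanSpace ℝ (Fin n) →L[ℝ] EuclideanSpace ℝ (Fin n) →L[ℝ] ℝ}
    (hsymm : ∀ u v, g u v = g v u) (hpos : ∀ u, u ≠ 0 → 0 < g u u)
    (c : EuclideanSpace ℝ (Fin n) →ₗ[ℝ] ℝ) (v : EuclideanSpace ℝ (Fin n)) :
    g (∑ k, (∑ l, (gramMatrix coordVec fun a b ↦ g a b)⁻¹ k l * c (coordVec l)) • coordVec k) v
      = c v := by
  set M := gramMatrix coordVec fun a b ↦ g a b with hM
  have hdet : IsUnit M.det := (posDef_gramMatrix hsymm hpos).det_pos.ne'.isUnit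
  have hMs : ∀ i j, M i j = M j i := fun i j ↦ hsymm _ _
  have key : ∀ m, g (∑ k, (∑ l, M⁻¹ k l * c (coordVec l)) • coordVec k) (coordVec m)
      = c (coordVec m) := by
    intro m
    simp only [map_sum, map_smul, sum_apply, smul_apply, smul_eq_mul,
      Finset.sum_mul]
    rw [Finset.sum_comm]
    have h1 : ∀ l, ∑ k, M⁻¹ k l * c (coordVec l) * g (coordVec k) (coordVec m)
        = (if m = l then 1 else 0) * c (coordVec l) := by
      intro l
      have h2 : (M * M⁻¹) m l = if m = l then 1 else 0 := by
        rw [Matrix.mul_nonsing_inv _ hdet, Matrix.one_apply]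
      rw [← h2, Matrix.mul_apply, Finset.sum_mul]
      refine Finset.sum_congr rfl fun k _ ↦ ?_
      rw [hMs m k]
      simp only [hM, gramMatrix, Matrix.of_apply]
      ring
    simp [h1]
  conv_lhs => rw [← sum_coordVec v]
  conv_rhs => rw [← sum_coordVec v]
  rw [map_sum (g _), map_sum c]
  exact Finset.sum_congr rfl fun m _ ↦ by rw [map_smul, map_smul, key m]

/-- The trace of an endomorphism as the metric trace of the associated bilinear form. -/
lemma metricTrace_endomorphism
    {g : EuclideanSpace ℝ (Fin n) →L[ℝ] EuclideanSpace ℝ (Fin n) →L[ℝ] ℝ}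
    (hsymm : ∀ u v, g u v = g v u) (hpos : ∀ u, u ≠ 0 → 0 < g u u)
    (T : EuclideanSpace ℝ (Fin n) → EuclideanSpace ℝ (Fin n)) :
    metricTrace coordVec (fun a b ↦ g a b) (fun a b ↦ g (T a) b)
      = ∑ i, T (coordVec i) i := by
  set M := gramMatrix coordVec fun a b ↦ g a b with hM
  have hdet : IsUnit M.det := (posDef_gramMatrix hsymm hpos).det_pos.ne'.isUnit
  have hMs : ∀ i j, M i j = M j i := fun i j ↦ hsymm _ _
  simp only [metricTrace]
  rw [← hM]
  refine Finset.sum_congr rfl fun i _ ↦ ?_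
  have h1 : ∀ j, g (T (coordVec i)) (coordVec j) = ∑ k, T (coordVec i) k * M k j := by
    intro j
    conv_lhs => rw [← sum_coordVec (T (coordVec i))]
    simp [hM, gramMatrix]
  simp only [h1, Finset.mul_sum]
  rw [Finset.sum_comm]
  have h2 : ∀ k, ∑ j, M⁻¹ i j * (T (coordVec i) k * M k j)
      = T (coordVec i) k * (if i = k then 1 else 0) := by
    intro k
    have h3 : (M⁻¹ * M) i k = if i = k then 1 else 0 := by
      rw [Matrix.nonsing_inv_mul _ hdet, Matrix.one_apply]
    rw [← h3, Matrix.mul_apply, Finset.mul_sum]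
    refine Finset.sum_congr rfl fun j _ ↦ ?_
    rw [hMs k j]; ring
  simp [h2]

lemma metricTrace_swap {V : Type*} (e : Fin n → V) {g : V → V → ℝ} (hsymm : ∀ u v, g u v = g v u)
    (B : V → V → ℝ) : metricTrace e g (fun a b ↦ B b a) = metricTrace e g B := by
  have hMt : (gramMatrix e g).transpose = gramMatrix e g := by
    ext i j; exact hsymm _ _
  have h : ∀ i j, (gramMatrix e g)⁻¹ i j = (gramMatrix e g)⁻¹ j i := by
    intro i j
    conv_lhs => rw [← hMt, ← Matrix.transpose_nonsing_inv]
    rfl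
  simp only [metricTrace]
  rw [Finset.sum_comm]
  exact Finset.sum_congr rfl fun i _ ↦ Finset.sum_congr rfl fun j _ ↦ by rw [h]

lemma metricTrace_add {V : Type*} (e : Fin n → V) (g B C : V → V → ℝ) :
    metricTrace e g (fun a b ↦ B a b + C a b) = metricTrace e g B + metricTrace e g C := by
  simp only [metricTrace, mul_add, Finset.sum_add_distrib]

lemma metricTrace_const_mul {V : Type*} (e : Fin n → V) (g B : V → V → ℝ) (c : ℝ) :
    metricTrace e g (fun a b ↦ c * B a b) = c * metricTrace e g B := by
  simp only [metricTrace, Finset.mul_sum]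
  exact Finset.sum_congr rfl fun i _ ↦ Finset.sum_congr rfl fun j _ ↦ by ring

/-- The metric trace does not depend on the basis. -/
lemma metricTrace_comp (A : EuclideanSpace ℝ (Fin n) →L[ℝ] EuclideanSpace ℝ (Fin n))
    (hA : Function.Bijective A)
    (g B : EuclideanSpace ℝ (Fin n) →L[ℝ] EuclideanSpace ℝ (Fin n) →L[ℝ] ℝ) :
    metricTrace coordVec (fun a b ↦ g (A a) (A b)) (fun a b ↦ B (A a) (A b))
      = metricTrace coordVec (fun a b ↦ g a b) (fun a b ↦ B a b) := by
  set P : Matrix (Fin n) (Fin n) ℝ := Matrix.of fun i j ↦ A (coordVec j) i with hP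
  have expand : ∀ C : EuclideanSpace ℝ (Fin n) →L[ℝ] EuclideanSpace ℝ (Fin n) →L[ℝ] ℝ,
      (Matrix.of fun i j ↦ C (A (coordVec i)) (A (coordVec j)))
        = P.transpose * (Matrix.of fun i j ↦ C (coordVec i) (coordVec j)) * P := by
    intro C
    ext i j
    simp only [Matrix.mul_apply, Matrix.of_apply, Matrix.transpose_apply, hP]
    conv_lhs => rw [← sum_coordVec (A (coordVec i)), ← sum_coordVec (A (coordVec j))]
    simp only [map_sum, map_smul, sum_apply, smul_apply, smul_eq_mul,
      Finset.mul_sum, Finset.sum_mul]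
    refine Finset.sum_congr rfl fun k _ ↦ Finset.sum_congr rfl fun l _ ↦ ?_
    ring
  have hPu : IsUnit P := by
    obtain ⟨A', hA'⟩ : ∃ A' : EuclideanSpace ℝ (Fin n) → EuclideanSpace ℝ (Fin n),
      Function.RightInverse A' A := hA.2.hasRightInverse
    have h : P * (Matrix.of fun i j ↦ A' (coordVec j) i) = 1 := by
      ext i j
      have h1 := congrArg (fun v : EuclideanSpace ℝ (Fin n) ↦ v i) (hA' (coordVec j))
      rw [← sum_coordVec (A' (coordVec j))] at h1
      simp only [map_sum, map_smul] at h1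
      simp only [Matrix.mul_apply, Matrix.of_apply, Matrix.one_apply, hP]
      rw [coordVec_apply] at h1
      rw [← h1]
      simp [mul_comm]
    exact IsUnit.of_mul_eq_one _ h
  have tr : ∀ M N : Matrix (Fin n) (Fin n) ℝ,
      ∑ i, ∑ j, M i j * N i j = (M * N.transpose).trace := by
    intro M N
    simp [Matrix.trace, Matrix.mul_apply]
  have hPd : IsUnit P.det := (Matrix.isUnit_iff_isUnit_det P).1 hPu
  have hPtd : IsUnit P.transpose.det := by rwa [Matrix.det_transpose]
  have e1 := expand g
  have e2 := expand B
  simp only [metricTrace]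
  have t1 := tr (gramMatrix coordVec fun a b ↦ g (A a) (A b))⁻¹
    (Matrix.of fun i j ↦ B (A (coordVec i)) (A (coordVec j)))
  have t2 := tr (gramMatrix coordVec fun a b ↦ g a b)⁻¹
    (Matrix.of fun i j ↦ B (coordVec i) (coordVec j))
  simp only [Matrix.of_apply] at t1 t2
  rw [t1, t2, e2]
  unfold gramMatrix
  rw [e1]
  set M := Matrix.of fun i j ↦ g (coordVec i) (coordVec j)
  set N := Matrix.of fun i j ↦ B (coordVec i) (coordVec j)
  rw [Matrix.mul_inv_rev, Matrix.mul_inv_rev, Matrix.transpose_mul, Matrix.transpose_mul,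
    Matrix.transpose_transpose, Matrix.trace_mul_comm]
  have h1 : P.transpose * (N.transpose * P) * (P⁻¹ * (M⁻¹ * P.transpose⁻¹))
      = P.transpose * (N.transpose * M⁻¹) * P.transpose⁻¹ := by
    simp only [Matrix.mul_assoc]
    rw [← Matrix.mul_assoc P, Matrix.mul_nonsing_inv _ hPd, Matrix.one_mul]
  rw [h1, Matrix.trace_mul_comm, ← Matrix.mul_assoc, Matrix.nonsing_inv_mul _ hPtd,
    Matrix.one_mul, Matrix.trace_mul_comm]

/-- The metric trace in dimension two. -/
lemma metricTrace_fin_two {V : Type*} (e : Fin 2 → V) (g B : V → V → ℝ) :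
    metricTrace e g B = (g (e 1) (e 1) * B (e 0) (e 0) - g (e 0) (e 1) * B (e 0) (e 1)
      - g (e 1) (e 0) * B (e 1) (e 0) + g (e 0) (e 0) * B (e 1) (e 1))
      / (g (e 0) (e 0) * g (e 1) (e 1) - g (e 0) (e 1) * g (e 1) (e 0)) := by
  simp only [metricTrace, Fin.sum_univ_two, Matrix.inv_def, Matrix.adjugate_fin_two,
    Matrix.det_fin_two, gramMatrix, Ring.inverse_eq_inv', Matrix.smul_apply, Matrix.of_apply,
    Matrix.cons_val', Matrix.cons_val_zero, Matrix.cons_val_one, Matrix.cons_val_fin_one,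
    smul_eq_mul]
  ring

/-- Lowering the index of the Christoffel symbols. -/
lemma inner_christoffel
    {g : EuclideanSpace ℝ (Fin n) →
      EuclideanSpace ℝ (Fin n) →L[ℝ] EuclideanSpace ℝ (Fin n) →L[ℝ] ℝ}
    {y : EuclideanSpace ℝ (Fin n)} (hsymm : ∀ u v, g y u v = g y v u)
    (hpos : ∀ u, u ≠ 0 → 0 < g y u u) (u v a : EuclideanSpace ℝ (Fin n)) :
    g y (christoffel g y u v) a = christoffelLower g y u v a := by
  set c : EuclideanSpace ℝ (Fin n) →ₗ[ℝ] ℝ :=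
    { toFun := fun a ↦ christoffelLower g y u v a
      map_add' := fun a b ↦ by simp only [christoffelLower, map_add, add_apply]; ring
      map_smul' := fun r a ↦ by
        simp only [christoffelLower, map_smul, smul_apply, smul_eq_mul, RingHom.id_apply]
        ring } with hc
  exact inner_raise hsymm hpos c a

end Traces

/-! ### Tensors and vector fields in charts -/

section Charts

variable {n : ℕ} {M : Type*} [TopologicalSpace M] [ChartedSpace (EuclideanSpace ℝ (Fin n)) M]

lemma coordMap_apply (p s : M) (v : TangentSpace (𝓡 n) s) :
    coordMap p s v = mfderiv (𝓡 n) 𝓘(ℝ, EuclideanSpace ℝ (Fin n)) (extChartAt (𝓡 n) p) s v := rfl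

variable [IsManifold (𝓡 n) ∞ M]

lemma coordMap_coordMapSymm {p : M} {y : EuclideanSpace ℝ (Fin n)}
    (hy : y ∈ (extChartAt (𝓡 n) p).target) (v : EuclideanSpace ℝ (Fin n)) :
    coordMap p ((extChartAt (𝓡 n) p).symm y) (coordMapSymm p y v) = v := by
  have h := mfderiv_extChartAt_comp_mfderivWithin_extChartAt_symm (I := 𝓡 n) hy
  rw [ModelWithCorners.range_eq_univ, mfderivWithin_univ] at h
  exact DFunLike.congr_fun h v

lemma coordMapSymm_coordMap {p : M} {y : EuclideanSpace ℝ (Fin n)}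
    (hy : y ∈ (extChartAt (𝓡 n) p).target)
    (v : TangentSpace (𝓡 n) ((extChartAt (𝓡 n) p).symm y)) :
    coordMapSymm p y (coordMap p ((extChartAt (𝓡 n) p).symm y) v) = v := by
  have h := mfderivWithin_extChartAt_symm_comp_mfderiv_extChartAt (I := 𝓡 n) hy
  rw [ModelWithCorners.range_eq_univ, mfderivWithin_univ] at h
  exact DFunLike.congr_fun h v

lemma coordMap_self (p : M) (v : TangentSpace (𝓡 n) p) : coordMap p p v = v := by
  rw [coordMap_apply, mfderiv_extChartAt_self]
  rfl

lemma inverse_coordMap_self (p : M) (v : EuclideanSpace ℝ (Fin n)) :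
    (coordMap p p).inverse v = v := by
  have h : (coordMap (n := n) p p).IsInvertible :=
    isInvertible_mfderiv_extChartAt (mem_extChartAt_source p)
  obtain ⟨A, hA⟩ := h
  rw [← hA, ContinuousLinearMap.inverse_equiv]
  have := coordMap_self (n := n) p (A.symm v)
  rw [← hA] at this
  exact this.symm.trans (A.apply_symm_apply v)

lemma coordFrame_eq (p : M) (i : Fin n) : coordFrame p i = coordVec i :=
  inverse_coordMap_self p _

/-- The components of a tensor field evaluated on components of vectors. -/
lemma tensorInChart_coordMap (T : Tensor2 n M) {p s : M} (hs : s ∈ (extChartAt (𝓡 n) p).source)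
    (u v : TangentSpace (𝓡 n) s) :
    tensorInChart T p (extChartAt (𝓡 n) p s) (coordMap p s u) (coordMap p s v) = T s u v := by
  obtain ⟨y, hy, rfl⟩ : ∃ y ∈ (extChartAt (𝓡 n) p).target, (extChartAt (𝓡 n) p).symm y = s :=
    ⟨_, (extChartAt (𝓡 n) p).map_source hs, (extChartAt (𝓡 n) p).left_inv hs⟩
  rw [(extChartAt (𝓡 n) p).right_inv hy]
  change T _ (coordMapSymm p y _) (coordMapSymm p y _) = _
  rw [coordMapSymm_coordMap hy, coordMapSymm_coordMap hy]

/-- The coordinate change from the chart at `p` to the chart at `p'`. -/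
noncomputable def chartChange (p p' : M) (y : EuclideanSpace ℝ (Fin n)) :
    EuclideanSpace ℝ (Fin n) :=
  extChartAt (𝓡 n) p' ((extChartAt (𝓡 n) p).symm y)

lemma contMDiffAt_extChartAt_symm {p : M} {y : EuclideanSpace ℝ (Fin n)}
    (hy : y ∈ (extChartAt (𝓡 n) p).target) :
    ContMDiffAt 𝓘(ℝ, EuclideanSpace ℝ (Fin n)) (𝓡 n) ∞ (extChartAt (𝓡 n) p).symm y :=
  (contMDiffOn_extChartAt_symm p).contMDiffAt ((isOpen_extChartAt_target p).mem_nhds hy)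

lemma contMDiffAt_extChartAt_of_mem {p s : M} (hs : s ∈ (extChartAt (𝓡 n) p).source) :
    ContMDiffAt (𝓡 n) 𝓘(ℝ, EuclideanSpace ℝ (Fin n)) ∞ (extChartAt (𝓡 n) p) s :=
  contMDiffAt_extChartAt' (by rwa [extChartAt_source] at hs)

lemma contDiffAt_chartChange {p p' : M} {y : EuclideanSpace ℝ (Fin n)}
    (hy : y ∈ (extChartAt (𝓡 n) p).target)
    (hy' : (extChartAt (𝓡 n) p).symm y ∈ (extChartAt (𝓡 n) p').source) :
    ContDiffAt ℝ ∞ (chartChange p p') y :=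
  ((contMDiffAt_extChartAt_of_mem hy').comp y (contMDiffAt_extChartAt_symm hy)).contDiffAt

lemma fderiv_chartChange {p p' : M} {y : EuclideanSpace ℝ (Fin n)}
    (hy : y ∈ (extChartAt (𝓡 n) p).target)
    (hy' : (extChartAt (𝓡 n) p).symm y ∈ (extChartAt (𝓡 n) p').source)
    (v : EuclideanSpace ℝ (Fin n)) :
    fderiv ℝ (chartChange p p') y v
      = coordMap p' ((extChartAt (𝓡 n) p).symm y) (coordMapSymm p y v) := by
  have h := mfderiv_comp y ((contMDiffAt_extChartAt_of_mem hy').mdifferentiableAt (by simp))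
    ((contMDiffAt_extChartAt_symm hy).mdifferentiableAt (by simp))
  have h' : fderiv ℝ (chartChange p p') y = mfderiv 𝓘(ℝ, EuclideanSpace ℝ (Fin n))
    𝓘(ℝ, EuclideanSpace ℝ (Fin n)) (extChartAt (𝓡 n) p' ∘ (extChartAt (𝓡 n) p).symm) y :=
    mfderiv_eq_fderiv.symm
  rw [h', h]
  rfl

lemma fderiv_chartChange_coordMap {p p' s : M} (hs : s ∈ (extChartAt (𝓡 n) p).source)
    (hs' : s ∈ (extChartAt (𝓡 n) p').source) (v : TangentSpace (𝓡 n) s) :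
    fderiv ℝ (chartChange p p') (extChartAt (𝓡 n) p s) (coordMap p s v) = coordMap p' s v := by
  obtain ⟨y, hy, rfl⟩ : ∃ y ∈ (extChartAt (𝓡 n) p).target, (extChartAt (𝓡 n) p).symm y = s :=
    ⟨_, (extChartAt (𝓡 n) p).map_source hs, (extChartAt (𝓡 n) p).left_inv hs⟩
  rw [(extChartAt (𝓡 n) p).right_inv hy, fderiv_chartChange hy hs', coordMapSymm_coordMap hy]

lemma tensorInChart_eq_pullbackField (T : Tensor2 n M) {p p' : M} {y : EuclideanSpace ℝ (Fin n)}
    (hy : y ∈ (extChartAt (𝓡 n) p).target)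
    (hy' : (extChartAt (𝓡 n) p).symm y ∈ (extChartAt (𝓡 n) p').source) :
    tensorInChart T p y = pullbackField (tensorInChart T p') (chartChange p p') y := by
  ext u v
  rw [pullbackField_apply, fderiv_chartChange hy hy', fderiv_chartChange hy hy', chartChange,
    tensorInChart_coordMap T hy']
  rfl

lemma eventually_mem_chart_overlap {p p' : M} {y : EuclideanSpace ℝ (Fin n)}
    (hy : y ∈ (extChartAt (𝓡 n) p).target)
    (hy' : (extChartAt (𝓡 n) p).symm y ∈ (extChartAt (𝓡 n) p').source) :
    ∀ᶠ z in 𝓝 y, z ∈ (extChartAt (𝓡 n) p).target ∧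
      (extChartAt (𝓡 n) p).symm z ∈ (extChartAt (𝓡 n) p').source :=
  Filter.Eventually.and ((isOpen_extChartAt_target p).mem_nhds hy)
    ((contMDiffAt_extChartAt_symm hy).continuousAt.preimage_mem_nhds
      ((isOpen_extChartAt_source p').mem_nhds hy'))

/-- The components of a smooth vector field along a map are smooth. -/
lemma IsSmoothFieldAlong.contMDiffOn_coordMap {m : ℕ} {N : Type*} [TopologicalSpace N]
    [ChartedSpace (EuclideanSpace ℝ (Fin m)) N] {f : N → M}
    {Y : ∀ s : N, TangentSpace (𝓡 n) (f s)} (hY : IsSmoothFieldAlong (m := m) f Y) (p : M) :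
    ContMDiffOn (𝓡 m) 𝓘(ℝ, EuclideanSpace ℝ (Fin n)) ∞ (fun s ↦ coordMap p (f s) (Y s))
      (f ⁻¹' (extChartAt (𝓡 n) p).source) := by
  set e := trivializationAt (EuclideanSpace ℝ (Fin n)) (TangentSpace (𝓡 n) (M := M)) p with he
  have h1 := e.contMDiffOn (IB := 𝓡 n) (n := ∞)
  have h2 : ContMDiffOn (𝓡 m) ((𝓡 n).prod 𝓘(ℝ, EuclideanSpace ℝ (Fin n))) ∞
      (fun s ↦ e (⟨f s, Y s⟩ : TangentBundle (𝓡 n) M)) (f ⁻¹' (extChartAt (𝓡 n) p).source) :=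
    h1.comp (ContMDiff.contMDiffOn hY) fun s hs ↦ by
      refine e.mem_source.2 ?_
      simpa [he] using! hs
  have h3 : ContMDiffOn (𝓡 m) 𝓘(ℝ, EuclideanSpace ℝ (Fin n)) ∞
      (fun s ↦ (e (⟨f s, Y s⟩ : TangentBundle (𝓡 n) M)).2)
      (f ⁻¹' (extChartAt (𝓡 n) p).source) := contMDiff_snd.comp_contMDiffOn h2
  refine h3.congr fun s hs ↦ ?_
  have hs' : f s ∈ (chartAt (EuclideanSpace ℝ (Fin n)) p).source := by simpa using! hs
  have h4 : e.continuousLinearMapAt ℝ (f s) (Y s) = (e ⟨f s, Y s⟩).2 := by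
    rw [Trivialization.continuousLinearMapAt_apply,
      Trivialization.coe_linearMapAt_of_mem _ (by simpa [he] using! hs')]
  rw [← h4]
  exact (DFunLike.congr_fun
    (TangentBundle.continuousLinearMapAt_trivializationAt (I := 𝓡 n) hs') (Y s)).symm

end Charts

section Fields

variable {n : ℕ} {M : Type*} [TopologicalSpace M] [ChartedSpace (EuclideanSpace ℝ (Fin n)) M]
  [IsManifold (𝓡 n) ∞ M]

lemma contMDiffOn_coordMapSymm (p : M) (u : EuclideanSpace ℝ (Fin n)) :
    ContMDiffOn 𝓘(ℝ, EuclideanSpace ℝ (Fin n)) (𝓡 n).tangent ∞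
      (fun y ↦ (⟨(extChartAt (𝓡 n) p).symm y, coordMapSymm p y u⟩ : TangentBundle (𝓡 n) M))
      (extChartAt (𝓡 n) p).target := by
  set e := trivializationAt (EuclideanSpace ℝ (Fin n)) (TangentSpace (𝓡 n) (M := M)) p with he
  have h1 := e.contMDiffOn_symm (IB := 𝓡 n) (n := ∞)
  have hmem : ∀ y ∈ (extChartAt (𝓡 n) p).target, (extChartAt (𝓡 n) p).symm y ∈
      (chartAt (EuclideanSpace ℝ (Fin n)) p).source := fun y hy ↦ by
    simpa using! (extChartAt (𝓡 n) p).map_target hy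
  have hbase : ∀ y ∈ (extChartAt (𝓡 n) p).target, (extChartAt (𝓡 n) p).symm y ∈ e.baseSet :=
    fun y hy ↦ by simpa [he] using! hmem y hy
  have h2 : ContMDiffOn 𝓘(ℝ, EuclideanSpace ℝ (Fin n)) ((𝓡 n).prod 𝓘(ℝ, EuclideanSpace ℝ (Fin n)))
      ∞ (fun y ↦ ((extChartAt (𝓡 n) p).symm y, u)) (extChartAt (𝓡 n) p).target :=
    (contMDiffOn_extChartAt_symm p).prodMk contMDiffOn_const
  refine (h1.comp h2 fun y hy ↦ e.mem_target.2 (hbase y hy)).congr fun y hy ↦ ?_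
  have h3 : e.symmL ℝ ((extChartAt (𝓡 n) p).symm y) u = coordMapSymm p y u := by
    have h := TangentBundle.symmL_trivializationAt (I := 𝓡 n) (hmem y hy)
    rw [(extChartAt (𝓡 n) p).right_inv hy, ModelWithCorners.range_eq_univ, mfderivWithin_univ] at h
    exact DFunLike.congr_fun h u
  rw [← h3, Trivialization.symmL_apply _ (hbase y hy)]
  exact e.mk_symm (hbase y hy) u

/-- The components of a smooth tensor field are smooth. -/
lemma Tensor2.IsSmooth.contDiffOn_tensorInChart {T : Tensor2 n M} (hT : T.IsSmooth) (p : M) :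
    ContDiffOn ℝ ∞ (tensorInChart T p) (extChartAt (𝓡 n) p).target := by
  refine contDiffOn_clm_apply.2 fun u ↦ contDiffOn_clm_apply.2 fun v ↦ ?_
  rw [← contMDiffOn_iff_contDiffOn]
  intro y hy
  have h0 := (contMDiffOn_extChartAt_symm (I := 𝓡 n) (n := ∞) p) y hy
  have : ContMDiffWithinAt 𝓘(ℝ, EuclideanSpace ℝ (Fin n)) ((𝓡 n).prod 𝓘(ℝ)) ∞
      (fun y ↦ TotalSpace.mk' ℝ (E := Bundle.Trivial M ℝ) ((extChartAt (𝓡 n) p).symm y)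
        (T ((extChartAt (𝓡 n) p).symm y) (coordMapSymm p y u) (coordMapSymm p y v)))
      (extChartAt (𝓡 n) p).target y := by
    apply ContMDiffWithinAt.clm_bundle_apply₂ (F₁ := EuclideanSpace ℝ (Fin n))
      (F₂ := EuclideanSpace ℝ (Fin n))
    · exact ContMDiffAt.comp_contMDiffWithinAt y (ContMDiff.contMDiffAt hT) h0
    · exact contMDiffOn_coordMapSymm p u y hy
    · exact contMDiffOn_coordMapSymm p v y hy
  simp only [contMDiffWithinAt_totalSpace] at this
  exact this.2

end Fields

section Immersion

variable {m n : ℕ} {M : Type*} [TopologicalSpace M] [ChartedSpace (EuclideanSpace ℝ (Fin n)) M]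
  {N : Type*} [TopologicalSpace N] [ChartedSpace (EuclideanSpace ℝ (Fin m)) N] {f : N → M} {s : N}

/-- The differential of an immersion is injective: in suitable charts it is `u ↦ (u, 0)`. -/
lemma Manifold.IsImmersionAt.mfderiv_injective (h : Manifold.IsImmersionAt (𝓡 m) (𝓡 n) ∞ f s) :
    Function.Injective (mfderiv (𝓡 m) (𝓡 n) f s) := by
  set φ := h.domChart.extend (𝓡 m) with hφ
  set ψ := h.codChart.extend (𝓡 n) with hψ
  set L : EuclideanSpace ℝ (Fin n) →L[ℝ] EuclideanSpace ℝ (Fin m) :=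
    (ContinuousLinearMap.fst ℝ _ h.complement).comp
      (h.equiv.symm : EuclideanSpace ℝ (Fin n) →L[ℝ]
        EuclideanSpace ℝ (Fin m) × h.complement) with hL
  have hs : s ∈ φ.source := by simpa [hφ] using h.mem_domChart_source
  have key : ∀ s' ∈ φ.source, L (ψ (f s')) = φ s' := by
    intro s' hs'
    have h1 := h.writtenInCharts (φ.map_source hs')
    simp only [Function.comp_apply] at h1
    rw [← hφ, φ.left_inv hs', ← hψ] at h1
    rw [h1]
    simp [hL]
  have hφsymm : ContMDiffAt 𝓘(ℝ, EuclideanSpace ℝ (Fin m)) (𝓡 m) ∞ φ.symm (φ s) := by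
    refine (contMDiffOn_extend_symm h.domChart_mem_maximalAtlas).contMDiffAt ?_
    have : IsOpen ((𝓡 m) '' h.domChart.target) := by
      simpa using! h.domChart.open_target
    refine this.mem_nhds ⟨h.domChart s, h.domChart.map_source h.mem_domChart_source, rfl⟩
  have hψc : ContMDiffAt (𝓡 n) 𝓘(ℝ, EuclideanSpace ℝ (Fin n)) ∞ ψ (f s) :=
    (h.codChart.contMDiffOn_extend h.codChart_mem_maximalAtlas).contMDiffAt
      (h.codChart.open_source.mem_nhds (h.source_subset_preimage_source h.mem_domChart_source))
  have hG : MDifferentiableAt (𝓡 n) (𝓡 m) (fun x ↦ φ.symm (L (ψ x))) (f s) := by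
    have h1 : ContMDiffAt (𝓡 n) 𝓘(ℝ, EuclideanSpace ℝ (Fin m)) ∞ (fun x ↦ L (ψ x)) (f s) :=
      L.contMDiff.contMDiffAt.comp _ hψc
    have h2 : ContMDiffAt (𝓡 n) (𝓡 m) ∞ (φ.symm ∘ fun x ↦ L (ψ x)) (f s) := by
      refine ContMDiffAt.comp _ ?_ h1
      rw [key s hs]
      exact hφsymm
    exact h2.mdifferentiableAt (by simp)
  have hf : MDifferentiableAt (𝓡 m) (𝓡 n) f s := h.contMDiffAt.mdifferentiableAt (by simp)
  have hcomp := mfderiv_comp s hG hf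
  have hid : ((fun x ↦ φ.symm (L (ψ x))) ∘ f) =ᶠ[𝓝 s] id := by
    filter_upwards [(h.domChart.open_source).mem_nhds h.mem_domChart_source] with s' hs'
    have hs'' : s' ∈ φ.source := by simpa [hφ] using hs'
    simp only [Function.comp_apply, key s' hs'', φ.left_inv hs'', id]
  rw [hid.mfderiv_eq, mfderiv_id] at hcomp
  intro u v huv
  have h1 := DFunLike.congr_fun hcomp u
  have h2 := DFunLike.congr_fun hcomp v
  exact h1.trans ((congrArg (mfderiv (𝓡 n) (𝓡 m) (fun x ↦ φ.symm (L (ψ x))) (f s)) huv).trans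
    h2.symm)

end Immersion

/-! ### Lie derivatives, covariant derivatives and divergence in charts -/

section Lie

variable {n : ℕ} {M : Type*} [TopologicalSpace M] [ChartedSpace (EuclideanSpace ℝ (Fin n)) M]

/-- The components of a vector field in the preferred chart at `p`. -/
noncomputable def fieldInChart (x : ∀ p : M, TangentSpace (𝓡 n) p) (p : M)
    (y : EuclideanSpace ℝ (Fin n)) : EuclideanSpace ℝ (Fin n) :=
  coordMap p ((extChartAt (𝓡 n) p).symm y) (x ((extChartAt (𝓡 n) p).symm y))

/-- The components of a vector field along a map in the preferred charts at `s₀` and `p₀`. -/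
noncomputable def fieldAlongInCharts {m : ℕ} {N : Type*} [TopologicalSpace N]
    [ChartedSpace (EuclideanSpace ℝ (Fin m)) N] (f : N → M)
    (Y : ∀ s : N, TangentSpace (𝓡 n) (f s)) (s₀ : N) (p₀ : M) (y : EuclideanSpace ℝ (Fin m)) :
    EuclideanSpace ℝ (Fin n) :=
  coordMap p₀ (f ((extChartAt (𝓡 m) s₀).symm y)) (Y ((extChartAt (𝓡 m) s₀).symm y))

/-- A map between manifolds in the preferred charts at `s₀` and `p₀`. -/
noncomputable def mapInCharts {m : ℕ} {N : Type*} [TopologicalSpace N]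
    [ChartedSpace (EuclideanSpace ℝ (Fin m)) N] (f : N → M) (s₀ : N) (p₀ : M)
    (y : EuclideanSpace ℝ (Fin m)) : EuclideanSpace ℝ (Fin n) :=
  extChartAt (𝓡 n) p₀ (f ((extChartAt (𝓡 m) s₀).symm y))

variable [IsManifold (𝓡 n) ∞ M]

lemma contDiffOn_fieldInChart {x : ∀ p : M, TangentSpace (𝓡 n) p}
    (hx : IsSmoothFieldAlong (m := n) (fun p : M ↦ p) x) (p : M) :
    ContDiffOn ℝ ∞ (fieldInChart x p) (extChartAt (𝓡 n) p).target := by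
  rw [← contMDiffOn_iff_contDiffOn]
  exact (hx.contMDiffOn_coordMap p).comp (contMDiffOn_extChartAt_symm p)
    fun y hy ↦ (extChartAt (𝓡 n) p).map_target hy

lemma fderiv_chartChange_fieldInChart (x : ∀ p : M, TangentSpace (𝓡 n) p) {p p' : M}
    {y : EuclideanSpace ℝ (Fin n)} (hy : y ∈ (extChartAt (𝓡 n) p).target)
    (hy' : (extChartAt (𝓡 n) p).symm y ∈ (extChartAt (𝓡 n) p').source) :
    fderiv ℝ (chartChange p p') y (fieldInChart x p y)
      = fieldInChart x p' (chartChange p p' y) := by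
  rw [fderiv_chartChange hy hy', fieldInChart, coordMapSymm_coordMap hy]
  exact congrArg (fun s ↦ coordMap p' s (x s)) ((extChartAt (𝓡 n) p').left_inv hy').symm

lemma lieDeriv_eq (x : ∀ p : M, TangentSpace (𝓡 n) p) (T : Tensor2 n M) (p : M)
    (u v : EuclideanSpace ℝ (Fin n)) :
    lieDeriv x T p u v
      = fderiv ℝ (tensorInChart T p) (extChartAt (𝓡 n) p p)
          (fieldInChart x p (extChartAt (𝓡 n) p p)) u v
        + tensorInChart T p (extChartAt (𝓡 n) p p)
          (fderiv ℝ (fieldInChart x p) (extChartAt (𝓡 n) p p) u) v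
        + tensorInChart T p (extChartAt (𝓡 n) p p) u
          (fderiv ℝ (fieldInChart x p) (extChartAt (𝓡 n) p p) v) := by
  have hid : ∀ w : EuclideanSpace ℝ (Fin n), coordMap p p w = w := coordMap_self p
  rw [← hid u, ← hid v]
  conv_lhs => rw [hid u, hid v]
  rfl

set_option synthInstance.maxHeartbeats 200000 in
/-- The vanishing of a Lie derivative, which is defined in preferred charts, in an arbitrary
chart. -/
lemma lie_tensorInChart_eq_zero {T : Tensor2 n M} (hT : T.IsSmooth)
    {x : ∀ p : M, TangentSpace (𝓡 n) p} (hx : IsSmoothFieldAlong (m := n) (fun p : M ↦ p) x)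
    (hL : ∀ p u v, lieDeriv x T p u v = 0) {p : M} {y : EuclideanSpace ℝ (Fin n)}
    (hy : y ∈ (extChartAt (𝓡 n) p).target) (u v : EuclideanSpace ℝ (Fin n)) :
    fderiv ℝ (tensorInChart T p) y (fieldInChart x p y) u v
      + tensorInChart T p y (fderiv ℝ (fieldInChart x p) y u) v
      + tensorInChart T p y u (fderiv ℝ (fieldInChart x p) y v) = 0 := by
  set p' := (extChartAt (𝓡 n) p).symm y with hp'
  have hp's : p' ∈ (extChartAt (𝓡 n) p').source := mem_extChartAt_source p'
  have hκ : chartChange p p' y = extChartAt (𝓡 n) p' p' := rfl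
  have ht' : chartChange p p' y ∈ (extChartAt (𝓡 n) p').target := mem_extChartAt_target p'
  have hev := eventually_mem_chart_overlap hy hp's
  have hTeq : tensorInChart T p =ᶠ[𝓝 y] pullbackField (tensorInChart T p') (chartChange p p') :=
    hev.mono fun z hz ↦ tensorInChart_eq_pullbackField T hz.1 hz.2
  have diff : ∀ {F : Type _} [NormedAddCommGroup F] [NormedSpace ℝ F]
      {f : EuclideanSpace ℝ (Fin n) → F} {q : M} {z : EuclideanSpace ℝ (Fin n)},
      ContDiffOn ℝ ∞ f (extChartAt (𝓡 n) q).target → z ∈ (extChartAt (𝓡 n) q).target →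
      DifferentiableAt ℝ f z := fun hf hz ↦
    (hf.contDiffAt ((isOpen_extChartAt_target _).mem_nhds hz)).differentiableAt (by simp)
  have hlie := lie_pullbackField (G := tensorInChart T p') (Ψ := chartChange p p') (w := y)
    (X := fieldInChart x p) (Y := fieldInChart x p')
    (diff (hT.contDiffOn_tensorInChart p') ht')
    ((contDiffAt_chartChange hy hp's).of_le ENat.LEInfty.out)
    (diff (contDiffOn_fieldInChart hx p) hy) (diff (contDiffOn_fieldInChart hx p') ht')
    (hev.mono fun z hz ↦ fderiv_chartChange_fieldInChart x hz.1 hz.2) u v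
  rw [hTeq.fderiv_eq, hTeq.self_of_nhds, hlie]
  exact (lieDeriv_eq x T p' _ _).symm.trans (hL p' _ _)

end Lie

section CovariantDerivative

set_option synthInstance.maxHeartbeats 200000

variable {m n : ℕ} {M : Type*} [TopologicalSpace M] [ChartedSpace (EuclideanSpace ℝ (Fin n)) M]

lemma tensorInChart_symm {T : Tensor2 n M} (hT : ∀ p u v, T p u v = T p v u) (p : M)
    (y u v : EuclideanSpace ℝ (Fin n)) : tensorInChart T p y u v = tensorInChart T p y v u :=
  hT _ _ _

variable [IsManifold (𝓡 n) ∞ M] {N : Type*} [TopologicalSpace N]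
  [ChartedSpace (EuclideanSpace ℝ (Fin m)) N] {f : N → M}

lemma contMDiffAt_coordMap_along {Y : ∀ s : N, TangentSpace (𝓡 n) (f s)}
    (hf : ContMDiff (𝓡 m) (𝓡 n) ∞ f)
    (hY : IsSmoothFieldAlong (m := m) f Y) {p₀ : M} {s : N}
    (hp : f s ∈ (extChartAt (𝓡 n) p₀).source) :
    ContMDiffAt (𝓡 m) 𝓘(ℝ, EuclideanSpace ℝ (Fin n)) ∞ (fun s ↦ coordMap p₀ (f s) (Y s)) s :=
  (hY.contMDiffOn_coordMap p₀).contMDiffAt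
    (hf.continuous.continuousAt.preimage_mem_nhds ((isOpen_extChartAt_source p₀).mem_nhds hp))

variable [IsManifold (𝓡 m) ∞ N]

lemma tensorInChart_self (T : Tensor2 n M) (p : M) (u v : EuclideanSpace ℝ (Fin n)) :
    tensorInChart T p (extChartAt (𝓡 n) p p) u v = T p u v := by
  have h := tensorInChart_coordMap T (mem_extChartAt_source (I := 𝓡 n) p) u v
  have hid : ∀ w : EuclideanSpace ℝ (Fin n), coordMap p p w = w := coordMap_self p
  rwa [hid u, hid v] at h

/-- The chain rule for a function on a manifold, read in the chart at `s₀`. -/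
lemma fderiv_comp_extChartAt_symm {F : Type*} [NormedAddCommGroup F] [NormedSpace ℝ F] {k : N → F}
    {s₀ s : N} (hs : s ∈ (extChartAt (𝓡 m) s₀).source) (hk : MDifferentiableAt (𝓡 m) 𝓘(ℝ, F) k s)
    (a : TangentSpace (𝓡 m) s) :
    fderiv ℝ (k ∘ (extChartAt (𝓡 m) s₀).symm) (extChartAt (𝓡 m) s₀ s) (coordMap s₀ s a)
      = mfderiv (𝓡 m) 𝓘(ℝ, F) k s a := by
  obtain ⟨y, hy, rfl⟩ : ∃ y ∈ (extChartAt (𝓡 m) s₀).target, (extChartAt (𝓡 m) s₀).symm y = s :=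
    ⟨_, (extChartAt (𝓡 m) s₀).map_source hs, (extChartAt (𝓡 m) s₀).left_inv hs⟩
  rw [(extChartAt (𝓡 m) s₀).right_inv hy]
  have h := mfderiv_comp y hk ((contMDiffAt_extChartAt_symm hy).mdifferentiableAt (by simp))
  have h' : fderiv ℝ (k ∘ (extChartAt (𝓡 m) s₀).symm) y = mfderiv 𝓘(ℝ, EuclideanSpace ℝ (Fin m))
    𝓘(ℝ, F) (k ∘ (extChartAt (𝓡 m) s₀).symm) y := mfderiv_eq_fderiv.symm
  rw [h', h]
  exact congrArg (mfderiv (𝓡 m) 𝓘(ℝ, F) k ((extChartAt (𝓡 m) s₀).symm y))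
    (coordMapSymm_coordMap hy a)

lemma fderiv_mapInCharts {s₀ s : N} {p₀ : M} (hf : MDifferentiableAt (𝓡 m) (𝓡 n) f s)
    (hs : s ∈ (extChartAt (𝓡 m) s₀).source)
    (hp : f s ∈ (extChartAt (𝓡 n) p₀).source) (a : TangentSpace (𝓡 m) s) :
    fderiv ℝ (mapInCharts (n := n) f s₀ p₀) (extChartAt (𝓡 m) s₀ s) (coordMap s₀ s a)
      = coordMap p₀ (f s) (mfderiv (𝓡 m) (𝓡 n) f s a) := by
  have hk := (contMDiffAt_extChartAt_of_mem hp).mdifferentiableAt (by simp)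
  refine (fderiv_comp_extChartAt_symm hs (hk.comp s hf) a).trans ?_
  rw [mfderiv_comp s hk hf]
  rfl

lemma contDiffAt_mapInCharts (hf : ContMDiff (𝓡 m) (𝓡 n) ∞ f) {s₀ : N} {p₀ : M}
    {y : EuclideanSpace ℝ (Fin m)} (hy : y ∈ (extChartAt (𝓡 m) s₀).target)
    (hp : f ((extChartAt (𝓡 m) s₀).symm y) ∈ (extChartAt (𝓡 n) p₀).source) :
    ContDiffAt ℝ ∞ (mapInCharts (n := n) f s₀ p₀) y := by
  have h := hf.contMDiffAt.comp y (contMDiffAt_extChartAt_symm hy)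
  exact (ContMDiffAt.comp y (contMDiffAt_extChartAt_of_mem hp) h).contDiffAt

lemma contDiffAt_fieldAlongInCharts {Y : ∀ s : N, TangentSpace (𝓡 n) (f s)}
    (hf : ContMDiff (𝓡 m) (𝓡 n) ∞ f) (hY : IsSmoothFieldAlong (m := m) f Y) {s₀ : N} {p₀ : M}
    {y : EuclideanSpace ℝ (Fin m)} (hy : y ∈ (extChartAt (𝓡 m) s₀).target)
    (hp : f ((extChartAt (𝓡 m) s₀).symm y) ∈ (extChartAt (𝓡 n) p₀).source) :
    ContDiffAt ℝ ∞ (fieldAlongInCharts f Y s₀ p₀) y :=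
  ((contMDiffAt_coordMap_along hf hY hp).comp y (contMDiffAt_extChartAt_symm hy)).contDiffAt

/-- The covariant derivative, which is defined in preferred charts, in arbitrary charts. -/
lemma inner_covDerivAlong {g : Tensor2 n M} (hsymm : ∀ p u v, g p u v = g p v u)
    (hpos : ∀ p u, u ≠ 0 → 0 < g p u u) {Y : ∀ s : N, TangentSpace (𝓡 n) (f s)}
    (hf : ContMDiff (𝓡 m) (𝓡 n) ∞ f) (hY : IsSmoothFieldAlong (m := m) f Y) {s₀ s : N} {p₀ : M}
    (hs : s ∈ (extChartAt (𝓡 m) s₀).source) (hp : f s ∈ (extChartAt (𝓡 n) p₀).source)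
    (hg : DifferentiableAt ℝ (tensorInChart g (f s)) (extChartAt (𝓡 n) (f s) (f s)))
    (a : TangentSpace (𝓡 m) s) (b : TangentSpace (𝓡 n) (f s)) :
    g (f s) (covDerivAlong g f Y s a) b
      = tensorInChart g p₀ (extChartAt (𝓡 n) p₀ (f s))
          (fderiv ℝ (fieldAlongInCharts f Y s₀ p₀) (extChartAt (𝓡 m) s₀ s) (coordMap s₀ s a))
          (coordMap p₀ (f s) b)
        + christoffelLower (tensorInChart g p₀) (extChartAt (𝓡 n) p₀ (f s))
          (coordMap p₀ (f s) (mfderiv (𝓡 m) (𝓡 n) f s a)) (coordMap p₀ (f s) (Y s))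
          (coordMap p₀ (f s) b) := by
  revert b
  set P := f s with hP
  intro b
  have hPs : P ∈ (extChartAt (𝓡 n) P).source := mem_extChartAt_source P
  have hy : extChartAt (𝓡 m) s₀ s ∈ (extChartAt (𝓡 m) s₀).target :=
    (extChartAt (𝓡 m) s₀).map_source hs
  have hsy : (extChartAt (𝓡 m) s₀).symm (extChartAt (𝓡 m) s₀ s) = s :=
    (extChartAt (𝓡 m) s₀).left_inv hs
  have hz : extChartAt (𝓡 n) p₀ P ∈ (extChartAt (𝓡 n) p₀).target :=
    (extChartAt (𝓡 n) p₀).map_source hp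
  have hzP : (extChartAt (𝓡 n) p₀).symm (extChartAt (𝓡 n) p₀ P) = P :=
    (extChartAt (𝓡 n) p₀).left_inv hp
  have hzs : (extChartAt (𝓡 n) p₀).symm (extChartAt (𝓡 n) p₀ P) ∈ (extChartAt (𝓡 n) P).source := by
    rw [hzP]; exact hPs
  have hFy : mapInCharts (n := n) f s₀ p₀ (extChartAt (𝓡 m) s₀ s) = extChartAt (𝓡 n) p₀ P := by
    rw [mapInCharts, hsy]
  have hκz : chartChange p₀ P (extChartAt (𝓡 n) p₀ P) = extChartAt (𝓡 n) P P := by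
    rw [chartChange, hzP]
  have hκ := contDiffAt_chartChange hz hzs
  have hκ2 : ContDiffAt ℝ 2 (chartChange p₀ P) (extChartAt (𝓡 n) p₀ P) := hκ.of_le ENat.LEInfty.out
  have hfs : MDifferentiableAt (𝓡 m) (𝓡 n) f s := hf.contMDiffAt.mdifferentiableAt (by simp)
  -- the derivative of the components of `Y` in the chart at `P`
  have hYd : DifferentiableAt ℝ (fieldAlongInCharts f Y s₀ p₀) (extChartAt (𝓡 m) s₀ s) :=
    (contDiffAt_fieldAlongInCharts hf hY hy (by rw [hsy]; exact hp)).differentiableAt (by simp)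
  have hFd : DifferentiableAt ℝ (mapInCharts (n := n) f s₀ p₀) (extChartAt (𝓡 m) s₀ s) :=
    (contDiffAt_mapInCharts hf hy (by rw [hsy]; exact hp)).differentiableAt (by simp)
  have hY0 : fieldAlongInCharts f Y s₀ p₀ (extChartAt (𝓡 m) s₀ s) = coordMap p₀ P (Y s) :=
    congrArg (fun s ↦ coordMap p₀ (f s) (Y s)) hsy
  obtain ⟨d, hd⟩ : ∃ d : EuclideanSpace ℝ (Fin n), d = mfderiv (𝓡 m) 𝓘(ℝ, EuclideanSpace ℝ (Fin n))
    (fun s ↦ coordMap P (f s) (Y s)) s a := ⟨_, rfl⟩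
  have hder : d = fderiv ℝ (fderiv ℝ (chartChange p₀ P)) (extChartAt (𝓡 n) p₀ P)
          (coordMap p₀ P (mfderiv (𝓡 m) (𝓡 n) f s a)) (coordMap p₀ P (Y s))
        + fderiv ℝ (chartChange p₀ P) (extChartAt (𝓡 n) p₀ P)
          (fderiv ℝ (fieldAlongInCharts f Y s₀ p₀) (extChartAt (𝓡 m) s₀ s) (coordMap s₀ s a)) := by
    refine hd.trans ((fderiv_comp_extChartAt_symm hs
      ((contMDiffAt_coordMap_along hf hY hPs).mdifferentiableAt (by simp)) a).symm.trans ?_)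
    have hev : ((fun s ↦ coordMap P (f s) (Y s)) ∘ (extChartAt (𝓡 m) s₀).symm)
        =ᶠ[𝓝 (extChartAt (𝓡 m) s₀ s)] fun y ↦
          fderiv ℝ (chartChange p₀ P) (mapInCharts (n := n) f s₀ p₀ y)
          (fieldAlongInCharts f Y s₀ p₀ y) := by
      have hc : ContinuousAt (fun y ↦ f ((extChartAt (𝓡 m) s₀).symm y)) (extChartAt (𝓡 m) s₀ s) :=
        hf.continuous.continuousAt.comp (contMDiffAt_extChartAt_symm hy).continuousAt
      have h1 := hc.preimage_mem_nhds ((isOpen_extChartAt_source (I := 𝓡 n) p₀).mem_nhds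
        (by rw [hsy]; exact hp))
      have h2 := hc.preimage_mem_nhds ((isOpen_extChartAt_source (I := 𝓡 n) P).mem_nhds
        (by rw [hsy]; exact hPs))
      filter_upwards [h1, h2] with y h1 h2
      exact (fderiv_chartChange_coordMap h1 h2 _).symm
    rw [hev.fderiv_eq]
    have hκd : DifferentiableAt ℝ (fderiv ℝ (chartChange p₀ P))
        (mapInCharts (n := n) f s₀ p₀ (extChartAt (𝓡 m) s₀ s)) := by
      rw [hFy]
      exact (hκ2.fderiv_right (m := 1) (by norm_num)).differentiableAt one_ne_zero
    rw [((hasFDerivAt_comp_field hκd hFd).clm_apply hYd.hasFDerivAt).fderiv]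
    have hFa := fderiv_mapInCharts hfs hs hp a
    simp only [add_apply, ContinuousLinearMap.comp_apply, ContinuousLinearMap.flip_apply,
      hFa, hFy, hY0]
    exact add_comm _ _
  have hcov : covDerivAlong g f Y s a
      = d + christoffel (tensorInChart g P) (extChartAt (𝓡 n) P P)
          (coordMap P P (mfderiv (𝓡 m) (𝓡 n) f s a)) (coordMap P P (Y s)) :=
    hd ▸ inverse_coordMap_self P _
  have hb : b = fderiv ℝ (chartChange p₀ P) (extChartAt (𝓡 n) p₀ P) (coordMap p₀ P b) :=
    ((fderiv_chartChange_coordMap hp hPs b).trans (coordMap_self P b)).symm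
  have hG : ∀ u v, tensorInChart g P (extChartAt (𝓡 n) P P) u v
      = tensorInChart g P (extChartAt (𝓡 n) P P) v u := fun u v ↦ by
    rw [tensorInChart_self, tensorInChart_self]
    exact hsymm P u v
  have hGpos : ∀ u, u ≠ 0 → 0 < tensorInChart g P (extChartAt (𝓡 n) P P) u u := fun u hu ↦ by
    rw [tensorInChart_self]
    exact hpos P u hu
  have hpull : tensorInChart g p₀ =ᶠ[𝓝 (extChartAt (𝓡 n) p₀ P)]
      pullbackField (tensorInChart g P) (chartChange p₀ P) :=
    (eventually_mem_chart_overlap hz hzs).mono fun z hz ↦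
      tensorInChart_eq_pullbackField g hz.1 hz.2
  have hchr : ∀ u v w, christoffelLower (tensorInChart g p₀) (extChartAt (𝓡 n) p₀ P) u v w
      = christoffelLower (pullbackField (tensorInChart g P) (chartChange p₀ P))
        (extChartAt (𝓡 n) p₀ P) u v w := fun u v w ↦ by
    simp only [christoffelLower, hpull.fderiv_eq]
  have hadd : ∀ (B : EuclideanSpace ℝ (Fin n) →L[ℝ] EuclideanSpace ℝ (Fin n) →L[ℝ] ℝ)
      (u v w c : EuclideanSpace ℝ (Fin n)), B (u + v + w) c = B u c + B v c + B w c := by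
    intro B u v w c
    simp only [map_add, add_apply]
  have key : ∀ c : EuclideanSpace ℝ (Fin n),
      tensorInChart g P (extChartAt (𝓡 n) P P) (covDerivAlong g f Y s a)
        (fderiv ℝ (chartChange p₀ P) (extChartAt (𝓡 n) p₀ P) c)
      = tensorInChart g p₀ (extChartAt (𝓡 n) p₀ P)
          (fderiv ℝ (fieldAlongInCharts f Y s₀ p₀) (extChartAt (𝓡 m) s₀ s) (coordMap s₀ s a)) c
        + christoffelLower (tensorInChart g p₀) (extChartAt (𝓡 n) p₀ P)
          (coordMap p₀ P (mfderiv (𝓡 m) (𝓡 n) f s a)) (coordMap p₀ P (Y s)) c := by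
    intro c
    -- the second derivative of the chart change cancels the inhomogeneous term in the
    -- transformation law of the Christoffel symbols
    rw [hcov, hder, hadd, inner_christoffel hG hGpos, hchr, christoffelLower_pullbackField
      (by rw [hκz]; exact hg) hκ2 (by rw [hκz]; exact hG), hpull.self_of_nhds, pullbackField_apply,
      hκz, ← fderiv_chartChange_coordMap hp hPs, ← fderiv_chartChange_coordMap hp hPs (Y s)]
    ring
  rw [← key, ← hb]
  exact (tensorInChart_self g P _ _).symm

end CovariantDerivative

section Divergence

set_option synthInstance.maxHeartbeats 200000

lemma fderiv_apply_apply {W E : Type*} [NormedAddCommGroup W] [NormedSpace ℝ W]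
    [NormedAddCommGroup E] [NormedSpace ℝ E] {G : W → E →L[ℝ] E →L[ℝ] ℝ} {w : W}
    (hG : DifferentiableAt ℝ G w) (a : W) (u v : E) :
    fderiv ℝ G w a u v = fderiv ℝ (fun w ↦ G w u v) w a := by
  rw [fderiv_clm_apply (hG.clm_apply (differentiableAt_const _)) (differentiableAt_const _),
    fderiv_clm_apply hG (differentiableAt_const _)]
  simp

variable {n : ℕ} {M : Type*} [TopologicalSpace M] [ChartedSpace (EuclideanSpace ℝ (Fin n)) M]
  [IsManifold (𝓡 n) ∞ M]

/-- `2 div Y` is the metric trace of `𝓛_Y g`. -/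
lemma two_mul_divergence {g : Tensor2 n M} (hsymm : ∀ p u v, g p u v = g p v u)
    (hpos : ∀ p u, u ≠ 0 → 0 < g p u u) {Y : ∀ p : M, TangentSpace (𝓡 n) p}
    (hY : IsSmoothFieldAlong (m := n) (fun p : M ↦ p) Y) {p : M} {y : EuclideanSpace ℝ (Fin n)}
    (hy : y = extChartAt (𝓡 n) p p) (hg : DifferentiableAt ℝ (tensorInChart g p) y) :
    2 * divergence g Y p = metricTrace coordVec (fun a b ↦ tensorInChart g p y a b)
      fun a b ↦ fderiv ℝ (tensorInChart g p) y (fieldInChart Y p y) a b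
        + tensorInChart g p y (fderiv ℝ (fieldInChart Y p) y a) b
        + tensorInChart g p y a (fderiv ℝ (fieldInChart Y p) y b) := by
  subst hy
  set y := extChartAt (𝓡 n) p p with hy
  set G := tensorInChart g p with hG
  have hGs : ∀ z u v, G z u v = G z v u := fun z u v ↦ hsymm _ _ _
  have hGpos : ∀ u, u ≠ 0 → 0 < G y u u := fun u hu ↦ by
    rw [hG, hy, tensorInChart_self]
    exact hpos p u hu
  have hdGs : ∀ w u v, fderiv ℝ G y w u v = fderiv ℝ G y w v u := fun w u v ↦ by
    rw [fderiv_apply_apply hg, fderiv_apply_apply hg]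
    simp only [hGs _ u v]
  have hid : ∀ w : EuclideanSpace ℝ (Fin n), coordMap p p w = w := coordMap_self p
  set T : EuclideanSpace ℝ (Fin n) → EuclideanSpace ℝ (Fin n) :=
    fun a ↦ covDerivAlong (m := n) g (fun x : M ↦ x) Y p a with hT
  have hY0 : fieldInChart Y p y = Y p :=
    (congrArg (fun s ↦ coordMap p s (Y s)) ((extChartAt (𝓡 n) p).left_inv
      (mem_extChartAt_source p))).trans (coordMap_self p _)
  have hcov : ∀ a b, G y (T a) b = G y (fderiv ℝ (fieldInChart Y p) y a) b
      + christoffelLower G y a (fieldInChart Y p y) b := by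
    intro a b
    have h := inner_covDerivAlong (f := fun x : M ↦ x) hsymm hpos contMDiff_id hY
      (mem_extChartAt_source (I := 𝓡 n) p) (mem_extChartAt_source (I := 𝓡 n) p) hg a b
    have hm : mfderiv (𝓡 n) (𝓡 n) (fun x : M ↦ x) p a = a :=
      DFunLike.congr_fun (mfderiv_id (I := 𝓡 n) (x := p)) a
    rw [hm, hid a, hid b, hid (Y p), ← hY0] at h
    exact (tensorInChart_self g p _ _).trans h
  have hdiv : divergence g Y p =
      metricTrace coordVec (fun a b ↦ G y a b) fun a b ↦ G y (T a) b := by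
    rw [metricTrace_endomorphism (hGs y) hGpos]
    refine Finset.sum_congr rfl fun i _ ↦ ?_
    rw [coordFrame_eq]
    exact congrArg (fun v : EuclideanSpace ℝ (Fin n) ↦ v i) (coordMap_self p _)
  rw [two_mul]
  nth_rewrite 2 [hdiv]
  rw [← metricTrace_swap coordVec (fun u v ↦ hGs y u v) fun a b ↦ G y (T a) b, hdiv,
    ← metricTrace_add]
  congr 1
  funext a b
  rw [hcov, hcov, hGs y (fderiv ℝ (fieldInChart Y p) y b) a]
  simp only [christoffelLower]
  rw [hdGs (fieldInChart Y p y) b a, hdGs a _ b, hdGs b _ a]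
  ring

end Divergence

/-! ### Coordinates adapted to a surface -/

section NormalCoordinates

set_option synthInstance.maxHeartbeats 200000

variable {V E : Type*} [NormedAddCommGroup V] [NormedSpace ℝ V] [NormedAddCommGroup E]
  [NormedSpace ℝ E] {F N : V → E} {G : E → E →L[ℝ] E →L[ℝ] ℝ} {B : Set V} {y : V}

/-- Coordinates `(y, z)` adapted to the surface `y ↦ F y`, of which `z = 0` is the surface, and
`∂_z = N` there. -/
noncomputable def collar {V : Type*} (F N : V → E) (w : V × ℝ) : E := F w.1 + w.2 • N w.1

lemma collar_zero {V : Type*} {F N : V → E} (y : V) : collar F N (y, 0) = F y := by simp [collar]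

lemma contDiffOn_collar (hF : ContDiffOn ℝ ∞ F B) (hN : ContDiffOn ℝ ∞ N B) :
    ContDiffOn ℝ ∞ (collar F N) (B ×ˢ Set.univ) := by
  have h1 : ContDiffOn ℝ ∞ (fun w : V × ℝ ↦ F w.1) (B ×ˢ Set.univ) :=
    hF.comp contDiff_fst.contDiffOn fun w hw ↦ hw.1
  have h2 : ContDiffOn ℝ ∞ (fun w : V × ℝ ↦ N w.1) (B ×ˢ Set.univ) :=
    hN.comp contDiff_fst.contDiffOn fun w hw ↦ hw.1
  exact h1.add (contDiff_snd.contDiffOn.smul h2)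

lemma fderiv_collar {w : V × ℝ} (hF : DifferentiableAt ℝ F w.1) (hN : DifferentiableAt ℝ N w.1)
    (v : V × ℝ) : fderiv ℝ (collar F N) w v
      = fderiv ℝ F w.1 v.1 + (w.2 • fderiv ℝ N w.1 v.1 + v.2 • N w.1) := by
  have h1 : HasFDerivAt (fun w : V × ℝ ↦ F w.1)
      ((fderiv ℝ F w.1).comp (ContinuousLinearMap.fst ℝ V ℝ)) w :=
    hF.hasFDerivAt.comp w hasFDerivAt_fst
  have h2 : HasFDerivAt (fun w : V × ℝ ↦ N w.1)
      ((fderiv ℝ N w.1).comp (ContinuousLinearMap.fst ℝ V ℝ)) w :=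
    hN.hasFDerivAt.comp w hasFDerivAt_fst
  have h := (h1.add ((hasFDerivAt_snd (𝕜 := ℝ) (p := w)).smul h2)).fderiv
  rw [show collar F N = (fun w : V × ℝ ↦ F w.1) + fun w : V × ℝ ↦ w.2 • N w.1 from rfl]
  refine (DFunLike.congr_fun h v).trans ?_
  simp

lemma fderiv_collar_zero (hF : DifferentiableAt ℝ F y) (hN : DifferentiableAt ℝ N y) (u : V)
    (c : ℝ) : fderiv ℝ (collar F N) (y, 0) (u, c) = fderiv ℝ F y u + c • N y := by
  rw [fderiv_collar (w := (y, 0)) hF hN]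
  simp

lemma mk_zero_mem {V : Type*} {B : Set V} {y : V} (hy : y ∈ B) :
    (y, (0 : ℝ)) ∈ B ×ˢ (Set.univ : Set ℝ) := ⟨hy, trivial⟩

lemma fderiv_fderiv_collar (hB : IsOpen B) (hF : ContDiffOn ℝ ∞ F B) (hN : ContDiffOn ℝ ∞ N B)
    (hy : y ∈ B) (u : V) :
    fderiv ℝ (fderiv ℝ (collar F N)) (y, 0) (u, 0) (0, 1) = fderiv ℝ N y u := by
  have hd : ∀ {f : V → E}, ContDiffOn ℝ ∞ f B → ∀ y ∈ B, DifferentiableAt ℝ f y := fun hf y hy ↦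
    (hf.contDiffAt (hB.mem_nhds hy)).differentiableAt (by simp)
  have hO : IsOpen (B ×ˢ (Set.univ : Set ℝ)) := hB.prod isOpen_univ
  have hC : ContDiffAt ℝ 2 (collar F N) (y, 0) :=
    ((contDiffOn_collar hF hN).contDiffAt (hO.mem_nhds (mk_zero_mem hy))).of_le ENat.LEInfty.out
  have hCd : DifferentiableAt ℝ (fderiv ℝ (collar F N)) (y, 0) :=
    (hC.fderiv_right (m := 1) (by norm_num)).differentiableAt one_ne_zero
  have h1 : fderiv ℝ (fderiv ℝ (collar F N)) (y, 0) (u, 0) (0, 1)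
      = fderiv ℝ (fun w ↦ fderiv ℝ (collar F N) w (0, 1)) (y, 0) (u, 0) := by
    rw [fderiv_clm_apply hCd (differentiableAt_const _)]
    simp
  have h2 : (fun w ↦ fderiv ℝ (collar F N) w (0, 1)) =ᶠ[𝓝 (y, 0)] fun w ↦ N w.1 := by
    filter_upwards [hO.mem_nhds (mk_zero_mem hy)] with w hw
    rw [fderiv_collar (hd hF _ hw.1) (hd hN _ hw.1)]
    simp
  have h3 : HasFDerivAt (fun w : V × ℝ ↦ N w.1)
      ((fderiv ℝ N y).comp (ContinuousLinearMap.fst ℝ V ℝ)) (y, 0) :=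
    HasFDerivAt.comp (y, (0 : ℝ)) (hd hN y hy).hasFDerivAt hasFDerivAt_fst
  rw [h1, h2.fderiv_eq, h3.fderiv]
  simp

/-- The derivative of a function of `(y, z)` along the slice `z = 0`. -/
lemma fderiv_slice {H : Type*} [NormedAddCommGroup H] [NormedSpace ℝ H] {k : V × ℝ → H}
    (hk : DifferentiableAt ℝ k (y, 0)) (u : V) :
    fderiv ℝ k (y, 0) (u, 0) = fderiv ℝ (fun y ↦ k (y, 0)) y u := by
  have h1 : HasFDerivAt (fun y : V ↦ (y, (0 : ℝ))) (ContinuousLinearMap.inl ℝ V ℝ) y :=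
    hasFDerivAt_prodMk_left y 0
  have h2 := (HasFDerivAt.comp y hk.hasFDerivAt h1).fderiv
  rw [show (fun y ↦ k (y, 0)) = k ∘ fun y : V ↦ (y, (0 : ℝ)) from rfl, h2]
  simp

/-- The second fundamental form `g(∇_u N, v)` of a surface with normal field `N` is half the
derivative of the metric in the direction normal to the surface. -/
lemma secondFundamentalForm_eq (hB : IsOpen B) (hF : ContDiffOn ℝ ∞ F B)
    (hN : ContDiffOn ℝ ∞ N B) (hy : y ∈ B) (hG : DifferentiableAt ℝ G (F y))
    (hsymm : ∀ z a b, G z a b = G z b a)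
    (hnormal : ∀ y ∈ B, ∀ u, G (F y) (N y) (fderiv ℝ F y u) = 0) (u v : V) :
    G (F y) (fderiv ℝ N y u) (fderiv ℝ F y v)
      + christoffelLower G (F y) (fderiv ℝ F y u) (N y) (fderiv ℝ F y v)
    = 1 / 2 * fderiv ℝ (pullbackField G (collar F N)) (y, 0) (0, 1) (u, 0) (v, 0) := by
  have hd : ∀ {f : V → E}, ContDiffOn ℝ ∞ f B → ∀ y ∈ B, DifferentiableAt ℝ f y := fun hf y hy ↦
    (hf.contDiffAt (hB.mem_nhds hy)).differentiableAt (by simp)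
  have hO : IsOpen (B ×ˢ (Set.univ : Set ℝ)) := hB.prod isOpen_univ
  have hC : ContDiffAt ℝ 2 (collar F N) (y, 0) :=
    ((contDiffOn_collar hF hN).contDiffAt (hO.mem_nhds (mk_zero_mem hy))).of_le ENat.LEInfty.out
  have hG' : DifferentiableAt ℝ G (collar F N (y, 0)) := by rwa [collar_zero]
  have hg := differentiableAt_pullbackField hG' hC
  have h := christoffelLower_pullbackField hG' hC (hsymm _) (u, 0) (0, 1) (v, 0)
  rw [collar_zero, fderiv_fderiv_collar hB hF hN hy] at h
  simp only [fderiv_collar_zero (hd hF y hy) (hd hN y hy), zero_smul, add_zero, map_zero, one_smul,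
    zero_add] at h
  rw [add_comm, ← h, christoffelLower]
  have hz : ∀ u v : V, fderiv ℝ (pullbackField G (collar F N)) (y, 0) (u, 0) (0, 1) (v, 0) = 0 := by
    intro u v
    have hgd := (hg.clm_apply (differentiableAt_const ((0, 1) : V × ℝ))).clm_apply
      (differentiableAt_const ((v, 0) : V × ℝ))
    rw [fderiv_apply_apply hg, fderiv_slice hgd]
    have : (fun y : V ↦ pullbackField G (collar F N) (y, 0) (0, 1) (v, 0)) =ᶠ[𝓝 y] fun _ ↦ 0 := by
      filter_upwards [hB.mem_nhds hy] with y' hy'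
      rw [pullbackField_apply, collar_zero, fderiv_collar_zero (hd hF y' hy') (hd hN y' hy'),
        fderiv_collar_zero (hd hF y' hy') (hd hN y' hy')]
      simpa using hnormal y' hy' v
    rw [this.fderiv_eq]
    simp
  have hs : ∀ w a b, fderiv ℝ (pullbackField G (collar F N)) (y, 0) w a b
      = fderiv ℝ (pullbackField G (collar F N)) (y, 0) w b a := by
    intro w a b
    rw [fderiv_apply_apply hg, fderiv_apply_apply hg]
    simp only [pullbackField_apply, hsymm _ (fderiv ℝ (collar F N) _ a)]
  rw [hz, hs (v, 0), hz]
  ring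

end NormalCoordinates

/-! ### The metric of an initial data set in coordinates adapted to a surface -/

namespace EmbeddedSurface

set_option synthInstance.maxHeartbeats 200000

variable {M : Type*} [TopologicalSpace M] [ChartedSpace (EuclideanSpace ℝ (Fin 3)) M]
  [IsManifold (𝓡 3) ∞ M] {D : InitialDataSet M}

lemma _root_.InitialDataSet.h_symm (D : InitialDataSet M) (p : M) (u v : TangentSpace (𝓡 3) p) :
    D.h p u v = D.h p v u := D.metric.symm p u v

lemma _root_.InitialDataSet.h_pos (D : InitialDataSet M) (p : M) (u : TangentSpace (𝓡 3) p)
    (hu : u ≠ 0) : 0 < D.h p u u := D.metric.pos p u hu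

lemma _root_.InitialDataSet.h_smooth (D : InitialDataSet M) : Tensor2.IsSmooth D.h :=
  D.metric.contMDiff

variable {S : Type*} [TopologicalSpace S] [ChartedSpace (EuclideanSpace ℝ (Fin 2)) S]
  [IsManifold (𝓡 2) ∞ S] (𝒮 : EmbeddedSurface D S)

lemma contMDiff_emb : ContMDiff (𝓡 2) (𝓡 3) ∞ 𝒮.emb := fun s ↦
  (𝒮.isSmoothEmbedding.isImmersion.isImmersionAt s).contMDiffAt

lemma mfderiv_emb_injective (s : S) : Function.Injective (mfderiv (𝓡 2) (𝓡 3) 𝒮.emb s) :=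
  (𝒮.isSmoothEmbedding.isImmersion.isImmersionAt s).mfderiv_injective

lemma mdifferentiableAt_emb (s : S) : MDifferentiableAt (𝓡 2) (𝓡 3) 𝒮.emb s :=
  𝒮.contMDiff_emb.contMDiffAt.mdifferentiableAt (by simp)

lemma q_symm (p : S) (u v : TangentSpace (𝓡 2) p) : 𝒮.q p u v = 𝒮.q p v u := D.h_symm _ _ _

lemma q_pos (p : S) (u : TangentSpace (𝓡 2) p) (hu : u ≠ 0) : 0 < 𝒮.q p u u :=
  D.h_pos _ _ fun h ↦ hu (𝒮.mfderiv_emb_injective p (h.trans (map_zero _).symm))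

/-- The coordinates of the chart at `s₀` of points whose image lies in the chart at `emb s₀`. -/
def chartDomain (s₀ : S) : Set (EuclideanSpace ℝ (Fin 2)) :=
  {y | y ∈ (extChartAt (𝓡 2) s₀).target ∧
    𝒮.emb ((extChartAt (𝓡 2) s₀).symm y) ∈ (extChartAt (𝓡 3) (𝒮.emb s₀)).source}

/-- The embedding in charts. -/
noncomputable def coordEmb (s₀ : S) : EuclideanSpace ℝ (Fin 2) → EuclideanSpace ℝ (Fin 3) :=
  mapInCharts 𝒮.emb s₀ (𝒮.emb s₀)

/-- The unit normal in charts. -/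
noncomputable def coordNormal (s₀ : S) : EuclideanSpace ℝ (Fin 2) → EuclideanSpace ℝ (Fin 3) :=
  fieldAlongInCharts 𝒮.emb 𝒮.normal s₀ (𝒮.emb s₀)

variable {s₀ : S} {y : EuclideanSpace ℝ (Fin 2)}

lemma isOpen_chartDomain (s₀ : S) : IsOpen (𝒮.chartDomain s₀) := by
  have h : ContinuousOn (fun y ↦ 𝒮.emb ((extChartAt (𝓡 2) s₀).symm y))
      (extChartAt (𝓡 2) s₀).target :=
    𝒮.contMDiff_emb.continuous.comp_continuousOn (continuousOn_extChartAt_symm s₀)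
  exact h.isOpen_inter_preimage (isOpen_extChartAt_target s₀) (isOpen_extChartAt_source _)

lemma mem_chartDomain (s₀ : S) : extChartAt (𝓡 2) s₀ s₀ ∈ 𝒮.chartDomain s₀ :=
  ⟨mem_extChartAt_target s₀, by
    rw [(extChartAt (𝓡 2) s₀).left_inv (mem_extChartAt_source s₀)]
    exact mem_extChartAt_source _⟩

lemma contDiffOn_coordEmb (s₀ : S) : ContDiffOn ℝ ∞ (𝒮.coordEmb s₀) (𝒮.chartDomain s₀) :=
  fun _ hy ↦ (contDiffAt_mapInCharts 𝒮.contMDiff_emb hy.1 hy.2).contDiffWithinAt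

lemma contDiffOn_coordNormal (s₀ : S) : ContDiffOn ℝ ∞ (𝒮.coordNormal s₀) (𝒮.chartDomain s₀) :=
  fun _ hy ↦ (contDiffAt_fieldAlongInCharts 𝒮.contMDiff_emb 𝒮.normal_smooth hy.1
    hy.2).contDiffWithinAt

lemma differentiableAt_coordEmb (hy : y ∈ 𝒮.chartDomain s₀) :
    DifferentiableAt ℝ (𝒮.coordEmb s₀) y :=
  ((𝒮.contDiffOn_coordEmb s₀).contDiffAt
    ((𝒮.isOpen_chartDomain s₀).mem_nhds hy)).differentiableAt (by simp)

lemma differentiableAt_coordNormal (hy : y ∈ 𝒮.chartDomain s₀) :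
    DifferentiableAt ℝ (𝒮.coordNormal s₀) y :=
  ((𝒮.contDiffOn_coordNormal s₀).contDiffAt
    ((𝒮.isOpen_chartDomain s₀).mem_nhds hy)).differentiableAt (by simp)

lemma fderiv_coordEmb (hy : y ∈ 𝒮.chartDomain s₀) (u : EuclideanSpace ℝ (Fin 2)) :
    fderiv ℝ (𝒮.coordEmb s₀) y u = coordMap (𝒮.emb s₀) (𝒮.emb ((extChartAt (𝓡 2) s₀).symm y))
      (mfderiv (𝓡 2) (𝓡 3) 𝒮.emb ((extChartAt (𝓡 2) s₀).symm y) (coordMapSymm s₀ y u)) := by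
  have h := fderiv_mapInCharts (p₀ := 𝒮.emb s₀) (𝒮.mdifferentiableAt_emb _)
    ((extChartAt (𝓡 2) s₀).map_target hy.1) hy.2 (coordMapSymm s₀ y u)
  rw [(extChartAt (𝓡 2) s₀).right_inv hy.1, coordMap_coordMapSymm hy.1] at h
  exact h

lemma metric_coordEmb (hy : y ∈ 𝒮.chartDomain s₀) (u v : EuclideanSpace ℝ (Fin 2)) :
    tensorInChart D.h (𝒮.emb s₀) (𝒮.coordEmb s₀ y) (fderiv ℝ (𝒮.coordEmb s₀) y u)
      (fderiv ℝ (𝒮.coordEmb s₀) y v) = tensorInChart 𝒮.q s₀ y u v := by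
  rw [fderiv_coordEmb 𝒮 hy, fderiv_coordEmb 𝒮 hy]
  exact tensorInChart_coordMap D.h hy.2 _ _

lemma metric_coordNormal_coordEmb (hy : y ∈ 𝒮.chartDomain s₀) (u : EuclideanSpace ℝ (Fin 2)) :
    tensorInChart D.h (𝒮.emb s₀) (𝒮.coordEmb s₀ y) (𝒮.coordNormal s₀ y)
      (fderiv ℝ (𝒮.coordEmb s₀) y u) = 0 := by
  rw [fderiv_coordEmb 𝒮 hy]
  exact (tensorInChart_coordMap D.h hy.2 _ _).trans (𝒮.normal_orthogonal _ _)

lemma metric_coordNormal (hy : y ∈ 𝒮.chartDomain s₀) :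
    tensorInChart D.h (𝒮.emb s₀) (𝒮.coordEmb s₀ y) (𝒮.coordNormal s₀ y)
      (𝒮.coordNormal s₀ y) = 1 :=
  (tensorInChart_coordMap D.h hy.2 _ _).trans (𝒮.normal_unit _)

lemma coordEmb_mem_target (hy : y ∈ 𝒮.chartDomain s₀) :
    𝒮.coordEmb s₀ y ∈ (extChartAt (𝓡 3) (𝒮.emb s₀)).target :=
  (extChartAt (𝓡 3) (𝒮.emb s₀)).map_source hy.2

lemma differentiableAt_metric {p : M} {z : EuclideanSpace ℝ (Fin 3)}
    (hz : z ∈ (extChartAt (𝓡 3) p).target) : DifferentiableAt ℝ (tensorInChart D.h p) z :=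
  ((D.h_smooth.contDiffOn_tensorInChart p).contDiffAt
    ((isOpen_extChartAt_target p).mem_nhds hz)).differentiableAt (by simp)

lemma tensorInChart_q_pos (hy : y ∈ 𝒮.chartDomain s₀) (u : EuclideanSpace ℝ (Fin 2))
    (hu : u ≠ 0) : 0 < tensorInChart 𝒮.q s₀ y u u := by
  refine 𝒮.q_pos _ (coordMapSymm s₀ y u) fun h ↦ hu ?_
  rw [← coordMap_coordMapSymm hy.1 u, h, map_zero]

/-- The metric in coordinates `(y, z)` adapted to the surface. -/
noncomputable def adaptedMetric (s₀ : S) : EuclideanSpace ℝ (Fin 2) × ℝ →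
    EuclideanSpace ℝ (Fin 2) × ℝ →L[ℝ] EuclideanSpace ℝ (Fin 2) × ℝ →L[ℝ] ℝ :=
  pullbackField (tensorInChart D.h (𝒮.emb s₀)) (collar (𝒮.coordEmb s₀) (𝒮.coordNormal s₀))

lemma adaptedMetric_symm (s₀ : S) (w u v : EuclideanSpace ℝ (Fin 2) × ℝ) :
    𝒮.adaptedMetric s₀ w u v = 𝒮.adaptedMetric s₀ w v u := by
  rw [adaptedMetric, pullbackField_apply, pullbackField_apply, tensorInChart_symm D.h_symm]

lemma adaptedMetric_zero (hy : y ∈ 𝒮.chartDomain s₀) (u v : EuclideanSpace ℝ (Fin 2)) (c d : ℝ) :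
    𝒮.adaptedMetric s₀ (y, 0) (u, c) (v, d) = tensorInChart 𝒮.q s₀ y u v + c * d := by
  have hsymm : ∀ a b, tensorInChart D.h (𝒮.emb s₀) (𝒮.coordEmb s₀ y) a b
    = tensorInChart D.h (𝒮.emb s₀) (𝒮.coordEmb s₀ y) b a := tensorInChart_symm D.h_symm _ _
  rw [adaptedMetric, pullbackField_apply, collar_zero,
    fderiv_collar_zero (𝒮.differentiableAt_coordEmb hy) (𝒮.differentiableAt_coordNormal hy),
    fderiv_collar_zero (𝒮.differentiableAt_coordEmb hy) (𝒮.differentiableAt_coordNormal hy)]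
  simp only [map_add, map_smul, add_apply, smul_apply, smul_eq_mul,
    hsymm _ (𝒮.coordNormal s₀ y), metric_coordNormal_coordEmb 𝒮 hy, metric_coordNormal 𝒮 hy,
    metric_coordEmb 𝒮 hy]
  ring

end EmbeddedSurface

/-! ### The mean curvature and the Killing equation in adapted coordinates -/

namespace EmbeddedSurface

set_option synthInstance.maxHeartbeats 200000

variable {M : Type*} [TopologicalSpace M] [ChartedSpace (EuclideanSpace ℝ (Fin 3)) M]
  [IsManifold (𝓡 3) ∞ M] {D : InitialDataSet M}
  {S : Type*} [TopologicalSpace S] [ChartedSpace (EuclideanSpace ℝ (Fin 2)) S]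
  [IsManifold (𝓡 2) ∞ S] (𝒮 : EmbeddedSurface D S) {s₀ : S} {y : EuclideanSpace ℝ (Fin 2)}

/-- The mean curvature in adapted coordinates: the metric trace of `½ ∂_z g_ab`. -/
lemma Z₂_eq_metricTrace (hy : y ∈ 𝒮.chartDomain s₀) :
    𝒮.Z₂ ((extChartAt (𝓡 2) s₀).symm y) = metricTrace coordVec
      (fun a b ↦ tensorInChart 𝒮.q s₀ y a b)
      fun a b ↦ 1 / 2 * fderiv ℝ (𝒮.adaptedMetric s₀) (y, 0) (0, 1) (a, 0) (b, 0) := by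
  set s := (extChartAt (𝓡 2) s₀).symm y with hs
  have hsrc : s ∈ (extChartAt (𝓡 2) s₀).source := (extChartAt (𝓡 2) s₀).map_target hy.1
  have hsy : extChartAt (𝓡 2) s₀ s = y := (extChartAt (𝓡 2) s₀).right_inv hy.1
  -- `½ ∂_z g` as a bilinear form
  set C : EuclideanSpace ℝ (Fin 2) →L[ℝ] EuclideanSpace ℝ (Fin 2) →L[ℝ] ℝ :=
    (1 / 2 : ℝ) • pullbackForm (fderiv ℝ (𝒮.adaptedMetric s₀) (y, 0) (0, 1))
      (ContinuousLinearMap.inl ℝ (EuclideanSpace ℝ (Fin 2)) ℝ) with hC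
  have hCa : ∀ a b, C a b = 1 / 2 * fderiv ℝ (𝒮.adaptedMetric s₀) (y, 0) (0, 1) (a, 0) (b, 0) :=
    fun a b ↦ rfl
  obtain ⟨A, hA⟩ : ∃ A : EuclideanSpace ℝ (Fin 2) →L[ℝ] EuclideanSpace ℝ (Fin 2),
    A = coordMap s₀ s := ⟨_, rfl⟩
  have hAinj : Function.Bijective A := by
    rw [hA]
    exact ⟨fun u v huv ↦ (coordMapSymm_coordMap hy.1 u).symm.trans
      ((congrArg (coordMapSymm s₀ y) huv).trans (coordMapSymm_coordMap hy.1 v)),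
      fun v ↦ ⟨coordMapSymm s₀ y v, coordMap_coordMapSymm hy.1 v⟩⟩
  have hAa : ∀ a : TangentSpace (𝓡 2) s, A a = coordMap s₀ s a := fun a ↦ DFunLike.congr_fun hA a
  have hdf : ∀ a : TangentSpace (𝓡 2) s, coordMap (𝒮.emb s₀) (𝒮.emb s)
      (mfderiv (𝓡 2) (𝓡 3) 𝒮.emb s a) = fderiv ℝ (𝒮.coordEmb s₀) y (A a) := fun a ↦ by
    rw [hAa, fderiv_coordEmb 𝒮 hy]
    exact (congrArg (fun v ↦ coordMap (𝒮.emb s₀) (𝒮.emb s) (mfderiv (𝓡 2) (𝓡 3) 𝒮.emb s v))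
      (coordMapSymm_coordMap hy.1 a)).symm
  have hform : ∀ a b : TangentSpace (𝓡 2) s, D.h (𝒮.emb s)
      (covDerivAlong (m := 2) D.h 𝒮.emb 𝒮.normal s a) (mfderiv (𝓡 2) (𝓡 3) 𝒮.emb s b)
      = C (A a) (A b) := fun a b ↦ by
    rw [inner_covDerivAlong D.h_symm D.h_pos 𝒮.contMDiff_emb 𝒮.normal_smooth hsrc hy.2
      (differentiableAt_metric (mem_extChartAt_target _)), hdf, hdf, hCa, hsy, ← hAa]
    exact secondFundamentalForm_eq (𝒮.isOpen_chartDomain s₀) (𝒮.contDiffOn_coordEmb s₀)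
      (𝒮.contDiffOn_coordNormal s₀) hy (differentiableAt_metric (𝒮.coordEmb_mem_target hy))
      (tensorInChart_symm D.h_symm _) (fun y hy ↦ 𝒮.metric_coordNormal_coordEmb hy) (A a) (A b)
  have hq : ∀ a b : TangentSpace (𝓡 2) s, 𝒮.q s a b = tensorInChart 𝒮.q s₀ y (A a) (A b) :=
    fun a b ↦ by
      rw [hAa, hAa, ← hsy]
      exact (tensorInChart_coordMap _ hsrc a b).symm
  have hfr : (coordFrame s : Fin 2 → EuclideanSpace ℝ (Fin 2)) = coordVec :=
    funext fun i ↦ coordFrame_eq s i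
  have h := metricTrace_comp A hAinj (tensorInChart 𝒮.q s₀ y) C
  refine Eq.trans ?_ h
  rw [Z₂]
  have e1 : (fun a b : TangentSpace (𝓡 2) s ↦ 𝒮.q s a b)
      = fun a b : TangentSpace (𝓡 2) s ↦ tensorInChart 𝒮.q s₀ y (A a) (A b) := by
    funext a b; exact hq a b
  have e2 : (fun a b : TangentSpace (𝓡 2) s ↦ D.h (𝒮.emb s)
      (covDerivAlong (m := 2) D.h 𝒮.emb 𝒮.normal s a) (mfderiv (𝓡 2) (𝓡 3) 𝒮.emb s b))
      = fun a b : TangentSpace (𝓡 2) s ↦ C (A a) (A b) := by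
    funext a b; exact hform a b
  rw [e1, e2]
  exact congrArg (fun e : Fin 2 → EuclideanSpace ℝ (Fin 2) ↦ metricTrace e
    (fun a b ↦ tensorInChart 𝒮.q s₀ y (A a) (A b)) fun a b ↦ C (A a) (A b)) hfr

lemma adaptedFrame_castSucc (a : Fin 2) : adaptedFrame a.castSucc = (coordVec a, 0) := by
  fin_cases a <;> rfl

lemma adaptedComp_castSucc (hy : y ∈ 𝒮.chartDomain s₀) (a b : Fin 2) :
    adaptedComp (𝒮.adaptedMetric s₀) a.castSucc b.castSucc (y, 0)
      = tensorInChart 𝒮.q s₀ y (coordVec a) (coordVec b) := by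
  rw [adaptedComp, adaptedFrame_castSucc, adaptedFrame_castSucc, 𝒮.adaptedMetric_zero hy]
  ring

lemma adaptedComp_det_pos (hy : y ∈ 𝒮.chartDomain s₀) :
    0 < adaptedComp (𝒮.adaptedMetric s₀) 0 0 (y, 0) * adaptedComp (𝒮.adaptedMetric s₀) 1 1 (y, 0)
      - adaptedComp (𝒮.adaptedMetric s₀) 0 1 (y, 0) ^ 2 := by
  have hsymm := tensorInChart_symm 𝒮.q_symm s₀ y
  have h := (posDef_gramMatrix hsymm (𝒮.tensorInChart_q_pos hy)).det_pos
  rw [Matrix.det_fin_two] at h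
  simp only [gramMatrix, Matrix.of_apply, hsymm (coordVec 1) (coordVec 0)] at h
  have h00 := 𝒮.adaptedComp_castSucc hy 0 0
  have h01 := 𝒮.adaptedComp_castSucc hy 0 1
  have h11 := 𝒮.adaptedComp_castSucc hy 1 1
  simp only [Fin.castSucc_zero, Fin.castSucc_one] at h00 h01 h11
  rw [h00, h01, h11]
  linarith

/-- The domain of the adapted coordinates. -/
def adaptedDomain (s₀ : S) : Set (EuclideanSpace ℝ (Fin 2) × ℝ) :=
  {w | w ∈ 𝒮.chartDomain s₀ ×ˢ (Set.univ : Set ℝ) ∧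
    collar (𝒮.coordEmb s₀) (𝒮.coordNormal s₀) w ∈ (extChartAt (𝓡 3) (𝒮.emb s₀)).target ∧
    (fderiv ℝ (collar (𝒮.coordEmb s₀) (𝒮.coordNormal s₀)) w).IsInvertible}

lemma contDiffOn_collar_coord (s₀ : S) :
    ContDiffOn ℝ ∞ (collar (𝒮.coordEmb s₀) (𝒮.coordNormal s₀))
      (𝒮.chartDomain s₀ ×ˢ (Set.univ : Set ℝ)) :=
  contDiffOn_collar (𝒮.contDiffOn_coordEmb s₀) (𝒮.contDiffOn_coordNormal s₀)

lemma isOpen_adaptedDomain (s₀ : S) : IsOpen (𝒮.adaptedDomain s₀) := by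
  have hO : IsOpen (𝒮.chartDomain s₀ ×ˢ (Set.univ : Set ℝ)) :=
    (𝒮.isOpen_chartDomain s₀).prod isOpen_univ
  have h1 := (𝒮.contDiffOn_collar_coord s₀).continuousOn.isOpen_inter_preimage hO
    (isOpen_extChartAt_target (I := 𝓡 3) (𝒮.emb s₀))
  have h2 := ((𝒮.contDiffOn_collar_coord s₀).fderiv_of_isOpen (m := ∞) hO
    (by simp)).continuousOn.isOpen_inter_preimage hO (ContinuousLinearEquiv.isOpen
      (𝕜 := ℝ) (E := EuclideanSpace ℝ (Fin 2) × ℝ) (F := EuclideanSpace ℝ (Fin 3)))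
  refine (congrArg IsOpen ?_).mpr (h1.inter h2)
  ext w
  constructor
  · rintro ⟨hw, h1, h2⟩
    exact ⟨⟨hw, h1⟩, hw, h2⟩
  · rintro ⟨⟨hw, h1⟩, -, h2⟩
    exact ⟨hw, h1, h2⟩

lemma mk_zero_mem_adaptedDomain (hy : y ∈ 𝒮.chartDomain s₀) : (y, 0) ∈ 𝒮.adaptedDomain s₀ := by
  refine ⟨⟨hy, trivial⟩, ?_, ?_⟩
  · rw [collar_zero]
    exact 𝒮.coordEmb_mem_target hy
  · set A := fderiv ℝ (collar (𝒮.coordEmb s₀) (𝒮.coordNormal s₀)) (y, 0) with hA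
    have hinj : Function.Injective A := by
      refine (injective_iff_map_eq_zero A).2 fun w hw ↦ ?_
      have h : 𝒮.adaptedMetric s₀ (y, 0) w w = 0 := by
        rw [adaptedMetric, pullbackField_apply, ← hA, hw]
        simp
      obtain ⟨u, c⟩ := w
      rw [adaptedMetric_zero 𝒮 hy] at h
      have hu : u = 0 := by
        by_contra hu
        have := 𝒮.tensorInChart_q_pos hy u hu
        nlinarith [mul_self_nonneg c]
      subst hu
      simpa using h
    have hfin : Module.finrank ℝ (EuclideanSpace ℝ (Fin 2) × ℝ)
        = Module.finrank ℝ (EuclideanSpace ℝ (Fin 3)) := by simp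
    exact ⟨(LinearEquiv.ofInjectiveOfFinrankEq (A : _ →ₗ[ℝ] _) hinj hfin).toContinuousLinearEquiv,
      ContinuousLinearMap.ext fun _ ↦ rfl⟩

lemma contDiffOn_adaptedMetric (s₀ : S) :
    ContDiffOn ℝ ∞ (𝒮.adaptedMetric s₀) (𝒮.adaptedDomain s₀) :=
  ContDiffOn.pullbackField (𝒮.isOpen_adaptedDomain s₀)
    (D.h_smooth.contDiffOn_tensorInChart (𝒮.emb s₀))
    ((𝒮.contDiffOn_collar_coord s₀).mono fun _ hw ↦ hw.1) fun _ hw ↦ hw.2.1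

/-- A vector field in adapted coordinates. -/
noncomputable def adaptedField (x : ∀ p : M, TangentSpace (𝓡 3) p) (s₀ : S)
    (w : EuclideanSpace ℝ (Fin 2) × ℝ) : EuclideanSpace ℝ (Fin 2) × ℝ :=
  (fderiv ℝ (collar (𝒮.coordEmb s₀) (𝒮.coordNormal s₀)) w).inverse
    (fieldInChart x (𝒮.emb s₀) (collar (𝒮.coordEmb s₀) (𝒮.coordNormal s₀) w))

variable {x : ∀ p : M, TangentSpace (𝓡 3) p}

lemma contDiffOn_adaptedField (hx : IsSmoothFieldAlong (m := 3) (fun p : M ↦ p) x) (s₀ : S) :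
    ContDiffOn ℝ ∞ (𝒮.adaptedField x s₀) (𝒮.adaptedDomain s₀) := by
  have hΨ := (𝒮.contDiffOn_collar_coord s₀).mono fun w (hw : w ∈ 𝒮.adaptedDomain s₀) ↦ hw.1
  have h1 : ContDiffOn ℝ ∞ (fun w ↦ fieldInChart x (𝒮.emb s₀)
      (collar (𝒮.coordEmb s₀) (𝒮.coordNormal s₀) w)) (𝒮.adaptedDomain s₀) :=
    (contDiffOn_fieldInChart hx (𝒮.emb s₀)).comp hΨ fun w hw ↦ hw.2.1
  have h2 := hΨ.fderiv_of_isOpen (m := ∞) (𝒮.isOpen_adaptedDomain s₀) (by simp)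
  have h3 : ContDiffOn ℝ ∞ (fun w ↦
      (fderiv ℝ (collar (𝒮.coordEmb s₀) (𝒮.coordNormal s₀)) w).inverse) (𝒮.adaptedDomain s₀) :=
    fun w hw ↦ (hw.2.2.contDiffAt_map_inverse).comp_contDiffWithinAt w (h2 w hw)
  exact h3.clm_apply h1

lemma fderiv_collar_adaptedField {w : EuclideanSpace ℝ (Fin 2) × ℝ}
    (hw : w ∈ 𝒮.adaptedDomain s₀) :
    fderiv ℝ (collar (𝒮.coordEmb s₀) (𝒮.coordNormal s₀)) w (𝒮.adaptedField x s₀ w)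
      = fieldInChart x (𝒮.emb s₀) (collar (𝒮.coordEmb s₀) (𝒮.coordNormal s₀) w) := by
  obtain ⟨A, hA⟩ := hw.2.2
  rw [adaptedField, ← hA, ContinuousLinearMap.inverse_equiv]
  exact A.apply_symm_apply _

/-- The Killing equation in adapted coordinates. -/
lemma killing_adapted (hx : D.IsSymmetry x) {w : EuclideanSpace ℝ (Fin 2) × ℝ}
    (hw : w ∈ 𝒮.adaptedDomain s₀) (u v : EuclideanSpace ℝ (Fin 2) × ℝ) :
    fderiv ℝ (𝒮.adaptedMetric s₀) w (𝒮.adaptedField x s₀ w) u v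
      + 𝒮.adaptedMetric s₀ w (fderiv ℝ (𝒮.adaptedField x s₀) w u) v
      + 𝒮.adaptedMetric s₀ w u (fderiv ℝ (𝒮.adaptedField x s₀) w v) = 0 := by
  have hO := 𝒮.isOpen_adaptedDomain s₀
  have hΨ : ContDiffAt ℝ 2 (collar (𝒮.coordEmb s₀) (𝒮.coordNormal s₀)) w :=
    (((𝒮.contDiffOn_collar_coord s₀).mono fun w (hw : w ∈ 𝒮.adaptedDomain s₀) ↦ hw.1).contDiffAt
      (hO.mem_nhds hw)).of_le ENat.LEInfty.out
  refine (lie_pullbackField (differentiableAt_metric hw.2.1) hΨ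
    (((𝒮.contDiffOn_adaptedField hx.smooth s₀).contDiffAt (hO.mem_nhds hw)).differentiableAt
      (by simp))
    (((contDiffOn_fieldInChart hx.smooth (𝒮.emb s₀)).contDiffAt
      ((isOpen_extChartAt_target _).mem_nhds hw.2.1)).differentiableAt (by simp)) ?_ u v).trans
    (lie_tensorInChart_eq_zero D.h_smooth hx.smooth hx.lie_metric hw.2.1 _ _)
  filter_upwards [hO.mem_nhds hw] with w' hw'
  exact 𝒮.fderiv_collar_adaptedField hw'

/-- Along the surface, the components of a vector field in adapted coordinates are those of its
tangential part and its normal component. -/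
lemma adaptedField_zero {α : S → ℝ} {τ : ∀ p : S, TangentSpace (𝓡 2) p}
    (hdecomp : ∀ p : S,
      x (𝒮.emb p) = α p • 𝒮.normal p + mfderiv (𝓡 2) (𝓡 3) 𝒮.emb p (τ p))
    (hy : y ∈ 𝒮.chartDomain s₀) :
    𝒮.adaptedField x s₀ (y, 0) = (fieldInChart τ s₀ y, α ((extChartAt (𝓡 2) s₀).symm y)) := by
  have hw := 𝒮.mk_zero_mem_adaptedDomain hy
  have h1 := 𝒮.fderiv_collar_adaptedField (x := x) hw
  have h2 : fderiv ℝ (collar (𝒮.coordEmb s₀) (𝒮.coordNormal s₀)) (y, 0)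
      (fieldInChart τ s₀ y, α ((extChartAt (𝓡 2) s₀).symm y))
      = fieldInChart x (𝒮.emb s₀) (collar (𝒮.coordEmb s₀) (𝒮.coordNormal s₀) (y, 0)) := by
    rw [fderiv_collar_zero (𝒮.differentiableAt_coordEmb hy) (𝒮.differentiableAt_coordNormal hy),
      fderiv_coordEmb 𝒮 hy, fieldInChart, coordMapSymm_coordMap hy.1, collar_zero]
    have e1 : fieldInChart x (𝒮.emb s₀) (𝒮.coordEmb s₀ y) = coordMap (𝒮.emb s₀)
        (𝒮.emb ((extChartAt (𝓡 2) s₀).symm y)) (x (𝒮.emb ((extChartAt (𝓡 2) s₀).symm y))) :=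
      congrArg (fun s ↦ coordMap (𝒮.emb s₀) s (x s))
        ((extChartAt (𝓡 3) (𝒮.emb s₀)).left_inv hy.2)
    rw [e1, hdecomp, map_add, map_smul, add_comm]
    rfl
  obtain ⟨A, hA⟩ := hw.2.2
  rw [← hA] at h1 h2
  exact A.injective (h1.trans h2.symm)

end EmbeddedSurface

/-! ### Symmetries with a divergence-free tangential part -/

namespace EmbeddedSurface

set_option synthInstance.maxHeartbeats 200000

variable {M : Type*} [TopologicalSpace M] [ChartedSpace (EuclideanSpace ℝ (Fin 3)) M]
  [IsManifold (𝓡 3) ∞ M] {D : InitialDataSet M}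
  {S : Type*} [TopologicalSpace S] [ChartedSpace (EuclideanSpace ℝ (Fin 2)) S]
  [IsManifold (𝓡 2) ∞ S] (𝒮 : EmbeddedSurface D S) {s₀ : S} {y : EuclideanSpace ℝ (Fin 2)}
  {x : ∀ p : M, TangentSpace (𝓡 3) p} {α : S → ℝ} {τ : ∀ p : S, TangentSpace (𝓡 2) p}

/-- The first variation of area: the trace over `S` of the Killing equation. -/
lemma normal_mul_Z₂_add_divergence (hx : D.IsSymmetry x) (hα : ContMDiff (𝓡 2) 𝓘(ℝ, ℝ) ∞ α)
    (hτ : IsSmoothFieldAlong (m := 2) (fun p : S ↦ p) τ)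
    (hdecomp : ∀ p : S,
      x (𝒮.emb p) = α p • 𝒮.normal p + mfderiv (𝓡 2) (𝓡 3) 𝒮.emb p (τ p)) (p : S) :
    α p * 𝒮.Z₂ p + divergence 𝒮.q τ p = 0 := by
  set y := extChartAt (𝓡 2) p p with hy
  have hyD : y ∈ 𝒮.chartDomain p := 𝒮.mem_chartDomain p
  have hD := 𝒮.isOpen_chartDomain p
  have hp : (extChartAt (𝓡 2) p).symm y = p :=
    (extChartAt (𝓡 2) p).left_inv (mem_extChartAt_source p)
  have hw := 𝒮.mk_zero_mem_adaptedDomain hyD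
  have hO := 𝒮.isOpen_adaptedDomain p
  have hg : DifferentiableAt ℝ (𝒮.adaptedMetric p) (y, 0) :=
    ((𝒮.contDiffOn_adaptedMetric p).contDiffAt (hO.mem_nhds hw)).differentiableAt (by simp)
  have hX : DifferentiableAt ℝ (𝒮.adaptedField x p) (y, 0) :=
    ((𝒮.contDiffOn_adaptedField hx.smooth p).contDiffAt (hO.mem_nhds hw)).differentiableAt (by simp)
  -- the induced metric is the restriction of the adapted metric
  set ι := ContinuousLinearMap.inl ℝ (EuclideanSpace ℝ (Fin 2)) ℝ with hι
  have hqg : tensorInChart 𝒮.q p =ᶠ[𝓝 y] fun y ↦ pullbackField (𝒮.adaptedMetric p) ι y := by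
    filter_upwards [hD.mem_nhds hyD] with y' hy'
    ext u v
    rw [pullbackField_apply, ι.fderiv]
    refine Eq.trans ?_ (𝒮.adaptedMetric_zero hy' u v 0 0).symm
    ring
  have hgι : DifferentiableAt ℝ (𝒮.adaptedMetric p) (ι y) := hg
  have hq : DifferentiableAt ℝ (tensorInChart 𝒮.q p) y :=
    hqg.differentiableAt_iff.2 (differentiableAt_pullbackField hgι ι.contDiff.contDiffAt)
  have hdq : ∀ w a b, fderiv ℝ (tensorInChart 𝒮.q p) y w a b
      = fderiv ℝ (𝒮.adaptedMetric p) (y, 0) (w, 0) (a, 0) (b, 0) := by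
    intro w a b
    have hgd := (hg.clm_apply
      (differentiableAt_const ((a, 0) : EuclideanSpace ℝ (Fin 2) × ℝ))).clm_apply
      (differentiableAt_const ((b, 0) : EuclideanSpace ℝ (Fin 2) × ℝ))
    rw [fderiv_apply_apply hq, fderiv_apply_apply hg, fderiv_slice hgd]
    have he : (fun y ↦ tensorInChart 𝒮.q p y a b)
        =ᶠ[𝓝 y] fun y ↦ 𝒮.adaptedMetric p (y, 0) (a, 0) (b, 0) := by
      filter_upwards [hD.mem_nhds hyD] with y' hy'
      simpa using (𝒮.adaptedMetric_zero hy' a b 0 0).symm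
    rw [he.fderiv_eq]
  have hdX : ∀ a, fderiv ℝ (𝒮.adaptedField x p) (y, 0) (a, 0)
      = (fderiv ℝ (fieldInChart τ p) y a,
        fderiv ℝ (fun y ↦ α ((extChartAt (𝓡 2) p).symm y)) y a) := by
    intro a
    have h1 : DifferentiableAt ℝ (fieldInChart τ p) y :=
      ((contDiffOn_fieldInChart hτ p).contDiffAt
        ((isOpen_extChartAt_target _).mem_nhds hyD.1)).differentiableAt (by simp)
    have h2 : DifferentiableAt ℝ (fun y ↦ α ((extChartAt (𝓡 2) p).symm y)) y :=
      (hα.contMDiffAt.comp y (contMDiffAt_extChartAt_symm hyD.1)).contDiffAt.differentiableAt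
        (by simp)
    have h3 : (fun y ↦ 𝒮.adaptedField x p (y, 0)) =ᶠ[𝓝 y]
        fun y ↦ (fieldInChart τ p y, α ((extChartAt (𝓡 2) p).symm y)) := by
      filter_upwards [hD.mem_nhds hyD] with y' hy'
      exact 𝒮.adaptedField_zero hdecomp hy'
    rw [fderiv_slice hX, h3.fderiv_eq, (h1.hasFDerivAt.prodMk h2.hasFDerivAt).fderiv]
    rfl
  have hdiv := two_mul_divergence 𝒮.q_symm 𝒮.q_pos hτ hy hq
  have hZ := 𝒮.Z₂_eq_metricTrace hyD
  rw [hp] at hZ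
  have hform : ∀ a b, fderiv ℝ (tensorInChart 𝒮.q p) y (fieldInChart τ p y) a b
      + tensorInChart 𝒮.q p y (fderiv ℝ (fieldInChart τ p) y a) b
      + tensorInChart 𝒮.q p y a (fderiv ℝ (fieldInChart τ p) y b)
      = -2 * α p * (1 / 2 * fderiv ℝ (𝒮.adaptedMetric p) (y, 0) (0, 1) (a, 0) (b, 0)) := by
    intro a b
    have hK := 𝒮.killing_adapted hx hw (a, 0) (b, 0)
    rw [𝒮.adaptedField_zero hdecomp hyD, hp, hdX, hdX, 𝒮.adaptedMetric_zero hyD,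
      𝒮.adaptedMetric_zero hyD] at hK
    have hsplit : ((fieldInChart τ p y, α p) : EuclideanSpace ℝ (Fin 2) × ℝ)
        = (fieldInChart τ p y, 0) + α p • (0, 1) := by simp
    rw [hsplit] at hK
    simp only [map_add, map_smul, add_apply, smul_apply, smul_eq_mul] at hK
    rw [hdq]
    linarith
  simp only [hform, metricTrace_const_mul] at hdiv hZ
  rw [hZ]
  linarith

/-- The mean curvature in the chart at `s₀`, written with the components of the adapted metric: the
form in which the Jacobi equation refers to it. -/
lemma Z₂_eq_sliceMeanCurvature (hy : y ∈ 𝒮.chartDomain s₀) :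
    𝒮.Z₂ ((extChartAt (𝓡 2) s₀).symm y) = sliceMeanCurvature (𝒮.adaptedMetric s₀) y
      / (2 * (adaptedComp (𝒮.adaptedMetric s₀) 0 0 (y, 0)
          * adaptedComp (𝒮.adaptedMetric s₀) 1 1 (y, 0)
        - adaptedComp (𝒮.adaptedMetric s₀) 0 1 (y, 0) ^ 2)) := by
  have hw := 𝒮.mk_zero_mem_adaptedDomain hy
  have hO := 𝒮.isOpen_adaptedDomain s₀
  have hg : DifferentiableAt ℝ (𝒮.adaptedMetric s₀) (y, 0) :=
    ((𝒮.contDiffOn_adaptedMetric s₀).contDiffAt (hO.mem_nhds hw)).differentiableAt (by simp)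
  have hd : ∀ a b : Fin 2, adaptedDeriv 2
      (adaptedComp (𝒮.adaptedMetric s₀) a.castSucc b.castSucc) (y, 0)
      = fderiv ℝ (𝒮.adaptedMetric s₀) (y, 0) (0, 1) (coordVec a, 0) (coordVec b, 0) := by
    intro a b
    rw [← adaptedFrame_castSucc, ← adaptedFrame_castSucc, fderiv_apply_apply hg]
    rfl
  have hds : fderiv ℝ (𝒮.adaptedMetric s₀) (y, 0) (0, 1) (coordVec 1, 0) (coordVec 0, 0)
      = fderiv ℝ (𝒮.adaptedMetric s₀) (y, 0) (0, 1) (coordVec 0, 0) (coordVec 1, 0) := by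
    rw [fderiv_apply_apply hg, fderiv_apply_apply hg]
    simp only [𝒮.adaptedMetric_symm s₀ _ (coordVec 1, 0)]
  have hdet := 𝒮.adaptedComp_det_pos hy
  have h00 := 𝒮.adaptedComp_castSucc hy 0 0
  have h01 := 𝒮.adaptedComp_castSucc hy 0 1
  have h11 := 𝒮.adaptedComp_castSucc hy 1 1
  have d00 := hd 0 0
  have d01 := hd 0 1
  have d11 := hd 1 1
  simp only [Fin.castSucc_zero, Fin.castSucc_one] at h00 h01 h11 d00 d01 d11
  rw [h00, h01, h11] at hdet
  rw [𝒮.Z₂_eq_metricTrace hy, metricTrace_fin_two, sliceMeanCurvature, d00, d01, d11, h00, h01,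
    h11, hds, tensorInChart_symm 𝒮.q_symm s₀ y (coordVec 1) (coordVec 0), ← sq,
    div_eq_div_iff hdet.ne' (by positivity)]
  ring

lemma continuous_Z₂ : Continuous 𝒮.Z₂ := by
  refine continuous_iff_continuousAt.2 fun s₀ ↦ ?_
  have hy₀ := 𝒮.mem_chartDomain s₀
  have hB := 𝒮.isOpen_chartDomain s₀
  have slice : ∀ {f : EuclideanSpace ℝ (Fin 2) × ℝ → ℝ}, ContDiffOn ℝ ∞ f (𝒮.adaptedDomain s₀) →
      ContinuousAt (fun y ↦ f (y, 0)) (extChartAt (𝓡 2) s₀ s₀) := fun {f} hf ↦ by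
    have h : ContinuousAt f (extChartAt (𝓡 2) s₀ s₀, 0) := hf.continuousOn.continuousAt
      ((𝒮.isOpen_adaptedDomain s₀).mem_nhds (𝒮.mk_zero_mem_adaptedDomain hy₀))
    exact ContinuousAt.comp (f := fun y : EuclideanSpace ℝ (Fin 2) ↦ (y, (0 : ℝ))) h
      (Continuous.continuousAt (by fun_prop))
  have hc := fun i j ↦ slice ((𝒮.contDiffOn_adaptedMetric s₀).adaptedComp i j)
  have hd := fun i j ↦ slice (((𝒮.contDiffOn_adaptedMetric s₀).adaptedComp i j).adaptedDeriv
    (𝒮.isOpen_adaptedDomain s₀) 2)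
  have hnum : ContinuousAt (sliceMeanCurvature (𝒮.adaptedMetric s₀)) (extChartAt (𝓡 2) s₀ s₀) :=
    (((hc 1 1).mul (hd 0 0)).sub ((continuousAt_const.mul (hc 0 1)).mul (hd 0 1))).add
      ((hc 0 0).mul (hd 1 1))
  have hquot := hnum.div (continuousAt_const.mul
    (((hc 0 0).mul (hc 1 1)).sub ((hc 0 1).pow 2)))
    (mul_pos two_pos (𝒮.adaptedComp_det_pos hy₀)).ne'
  have hφ : ContinuousAt (extChartAt (𝓡 2) s₀) s₀ := continuousAt_extChartAt s₀
  refine (ContinuousAt.comp hquot hφ).congr ?_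
  filter_upwards [hφ.preimage_mem_nhds (hB.mem_nhds hy₀),
    extChartAt_source_mem_nhds (I := 𝓡 2) s₀] with s h1 h2
  have h := 𝒮.Z₂_eq_sliceMeanCurvature h1
  rw [(extChartAt (𝓡 2) s₀).left_inv h2] at h
  exact h.symm

/-- Unique continuation for the normal component of a symmetry along the surface. -/
lemma eventually_normal_component_eq_zero (hx : D.IsSymmetry x)
    (hdecomp : ∀ p : S,
      x (𝒮.emb p) = α p • 𝒮.normal p + mfderiv (𝓡 2) (𝓡 3) 𝒮.emb p (τ p))
    (hαZ : ∀ p, α p * 𝒮.Z₂ p = 0) (hs₀ : s₀ ∈ closure (interior {s | α s = 0})) :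
    ∀ᶠ s in 𝓝 s₀, α s = 0 := by
  set y₀ := extChartAt (𝓡 2) s₀ s₀ with hy₀
  have hyD := 𝒮.mem_chartDomain s₀
  have hB := 𝒮.isOpen_chartDomain s₀
  obtain ⟨r, hr, hrB⟩ := Metric.isOpen_iff.1 hB y₀ hyD
  have hφ : ContinuousAt (extChartAt (𝓡 2) s₀) s₀ := continuousAt_extChartAt s₀
  have hcomp : ∀ {y}, y ∈ 𝒮.chartDomain s₀ → (𝒮.adaptedField x s₀ (y, 0)).2
      = α ((extChartAt (𝓡 2) s₀).symm y) := fun hy ↦ by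
    rw [𝒮.adaptedField_zero hdecomp hy]
  have hclosure : y₀ ∈ closure (interior {y | (𝒮.adaptedField x s₀ (y, 0)).2 = 0}) := by
    rw [mem_closure_iff_frequently] at hs₀ ⊢
    refine hφ.tendsto.frequently ((hs₀.and_eventually
      (Filter.Eventually.and (hφ.preimage_mem_nhds (hB.mem_nhds hyD))
        (extChartAt_source_mem_nhds (I := 𝓡 2) s₀))).mono ?_)
    rintro s ⟨h1, h2, h3⟩
    have hs := (extChartAt (𝓡 2) s₀).left_inv h3
    have hσ : ContinuousAt (extChartAt (𝓡 2) s₀).symm (extChartAt (𝓡 2) s₀ s) :=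
      (contMDiffAt_extChartAt_symm h2.1).continuousAt
    rw [mem_interior_iff_mem_nhds]
    filter_upwards [hσ.preimage_mem_nhds (isOpen_interior.mem_nhds (by rwa [hs])),
      hB.mem_nhds h2] with y h4 h5
    have h6 : (extChartAt (𝓡 2) s₀).symm y ∈ {s | α s = 0} := interior_subset h4
    exact (hcomp h5).trans h6
  have key := eventually_killing_normal_eq_zero (g := 𝒮.adaptedMetric s₀)
    (X := 𝒮.adaptedField x s₀) (O := 𝒮.adaptedDomain s₀) (y₀ := y₀) (r := r)
    (𝒮.isOpen_adaptedDomain s₀) hr (fun y hy ↦ 𝒮.mk_zero_mem_adaptedDomain (hrB hy))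
    (𝒮.contDiffOn_adaptedMetric s₀) (𝒮.contDiffOn_adaptedField hx.smooth s₀)
    (fun w _ ↦ 𝒮.adaptedMetric_symm s₀ w)
    (fun w hw u v ↦ 𝒮.killing_adapted hx hw u v) ?_ ?_ ?_
    (fun y hy ↦ 𝒮.adaptedComp_det_pos (hrB hy)) ?_ hclosure
  · filter_upwards [hφ.eventually key, hφ.eventually (hB.mem_nhds hyD),
      extChartAt_source_mem_nhds (I := 𝓡 2) s₀] with s h1 h2 h3
    rwa [hcomp h2, (extChartAt (𝓡 2) s₀).left_inv h3] at h1
  · intro y hy a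
    have he2 : adaptedFrame 2 = (0, 1) := rfl
    rw [adaptedComp, adaptedFrame_castSucc, he2, 𝒮.adaptedMetric_zero (hrB hy)]
    simp
  · intro y hy
    have he2 : adaptedFrame 2 = (0, 1) := rfl
    rw [adaptedComp, he2, 𝒮.adaptedMetric_zero (hrB hy)]
    simp
  · intro y hy
    refine (𝒮.tensorInChart_q_pos (hrB hy) (coordVec 1) ?_).trans_eq
      (𝒮.adaptedComp_castSucc (hrB hy) 1 1).symm
    simp [coordVec]
  · intro y hy hne
    rw [hcomp (hrB hy)] at hne
    have h := (mul_eq_zero.1 (hαZ ((extChartAt (𝓡 2) s₀).symm y))).resolve_left hne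
    rw [𝒮.Z₂_eq_sliceMeanCurvature (hrB hy), div_eq_zero_iff] at h
    exact h.resolve_right (mul_pos two_pos (𝒮.adaptedComp_det_pos (hrB hy))).ne'

end EmbeddedSurface

theorem lemma1
    {M : Type*} [TopologicalSpace M] [T2Space M] [SecondCountableTopology M]
    [ChartedSpace (EuclideanSpace ℝ (Fin 3)) M] [IsManifold (𝓡 3) ∞ M]
    {S : Type*} [TopologicalSpace S] [CompactSpace S] [ConnectedSpace S]
    [ChartedSpace (EuclideanSpace ℝ (Fin 2)) S] [IsManifold (𝓡 2) ∞ S]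
    (D : InitialDataSet M) (𝒮 : EmbeddedSurface D S) (hMOTS : 𝒮.IsMOTS)
    (x : ∀ p : M, TangentSpace (𝓡 3) p) (hx : D.IsSymmetry x)
    (α : S → ℝ) (hα : ContMDiff (𝓡 2) 𝓘(ℝ, ℝ) ∞ α)
    (τ : ∀ p : S, TangentSpace (𝓡 2) p) (hτ : IsSmoothFieldAlong (m := 2) (fun p : S ↦ p) τ)
    (hdecomp : ∀ p : S,
      x (𝒮.emb p) = α p • 𝒮.normal p + mfderiv (𝓡 2) (𝓡 3) 𝒮.emb p (τ p)) :
    (∀ p : S, α p * 𝒮.Z₂ p + divergence 𝒮.q τ p = 0) ∧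
      ((∀ p : S, divergence 𝒮.q τ p = 0) → 𝒮.IsTangent x ∨ 𝒮.IsMinimal) := by
  have h1 := 𝒮.normal_mul_Z₂_add_divergence hx hα hτ hdecomp
  refine ⟨h1, fun hdiv ↦ ?_⟩
  have hαZ : ∀ p, α p * 𝒮.Z₂ p = 0 := fun p ↦ by
    have := h1 p
    rwa [hdiv p, add_zero] at this
  by_cases hA : (interior {s | α s = 0}).Nonempty
  · -- the interior of the zero set of `α` is closed by unique continuation
    left
    have hclosed : IsClosed (interior {s | α s = 0}) := isClosed_of_closure_subset fun s hs ↦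
      mem_interior_iff_mem_nhds.2 (𝒮.eventually_normal_component_eq_zero hx hdecomp hαZ hs)
    have huniv := IsClopen.eq_univ ⟨hclosed, isOpen_interior⟩ hA
    intro p
    have hp' : p ∈ interior {s | α s = 0} := huniv ▸ Set.mem_univ p
    have hp : α p = 0 := (interior_subset hp' : p ∈ {s | α s = 0})
    exact ⟨τ p, by rw [hdecomp p, hp, zero_smul, zero_add]⟩
  · -- `α` does not vanish on a dense set, on which the mean curvature therefore does
    right
    have hdense : Dense {s | α s ≠ 0} := by
      have h := interior_eq_empty_iff_dense_compl.1 (Set.not_nonempty_iff_eq_empty.1 hA)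
      exact h
    have hZ : 𝒮.Z₂ = fun _ ↦ 0 := 𝒮.continuous_Z₂.ext_on hdense continuous_const fun s hs ↦
      (mul_eq_zero.1 (hαZ s)).resolve_left hs
    intro p
    have hk := hMOTS p
    have hp : 𝒮.Z₂ p = 0 := congrFun hZ p
    refine ⟨hk, ?_⟩
    rw [EmbeddedSurface.θk, hp, add_zero] at hk
    rw [EmbeddedSurface.θl, hk, hp, sub_zero]
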